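/- **Setting.** Fix integers $1\le d<D$, $K\ge 1$, constants $\kappa\ge1$, $\zeta$, $v>0$, and a sequence $\rho_N\to\infty$ with $\rho_N=o(\log N)$. Let $\mathcal S_d^2(\kappa)$ be the class of nonempty connected $d$-dimensional embedded $C^2$ submanifolds without boundary $S\subset(0,1)^D$ of $\mathbb R^D$ with $1/\kappa\le\operatorname{diam}(S)\le\kappa$ and reach (the supremum of the $t$ such that every point of $\mathbb R^D$ at distance less than $t$ from $S$ has a unique nearest point in $S$) at least $1/\kappa$. Put $B(S,\tau)=\{x\in(0,1)^D:\operatorname{dist}(x,S)<\tau\}$. Given $S_1,\dots,S_K\in\mathcal S_d^2(\kappa)$ and $0<\tau\le\rho_N^{-3}$, the data $x_1,\dots,x_N$ are independent: $N_k$ of them are uniformly distributed on $B(S_k,\tau)$, $k=1,\dots,K$, and the other $N_0$ ("outliers") are uniformly distributed on $(0,1)^D\setminus\bigcup_kB(S_k,\delta_0)$. Assume $N_k\le\zeta N_\ell$ for all $k\ne\ell$, $N-N_0\ge N/\rho_N$, and, if $N_0\neq0$, that $\delta_0>0$ and the region of the outliers has volume at least $v$. Let $m$ be an integer with $(\log\rho_N)^2\log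 N\le m\le\rho_N\log N$. **First estimator.** Let ${\rm Cor}(\epsilon)=\#\{(i,j):j\neq i,\ \|x_i-x_j\|\le\epsilon\}$, $A_r=\log{\rm Cor}(\rho_N^{-r})$ and $r_N=-\left\lfloor\frac{\log\log N-\log N}{d\log\rho_N}\right\rfloor-2$. Let $\hat r$ be the smallest $r\in\{3,\dots,r_N-2D-1\}$ with $(A_r-A_{r+1})/\log\rho_N>D-\frac12$, and $\hat r=r_N-2D$ if there is none. Let $\hat d=D$ if $\hat r=3$; otherwise let $\hat d$ be the integer closest to $(A_3-A_{\hat r})/(\hat r\log\rho_N)$. **Refined estimator.** For points $z_1,\dots,z_m$ let $\Lambda_{d'}(z_1,\dots,z_m)=\min_L\max_j\operatorname{dist}(z_j,L)$ over $d'$-dimensional affine subspaces $L$ of $\mathbb R^D$. Let $\alpha_{d'}(z_1,\dots,z_m)=1$ if the $z_j$ are distinct, their diameter is less than $\epsilon$ and $\Lambda_{d'}<\eta$, and $0$ otherwise. Let $$W_{ij}=\sum_{i_1,\dots,i_{m-2}}\alpha_{d'}(x_i,x_j,x_{i_1},\dots,x_{i_{m-2}}),\qquad D_i=\sum_jW_{ij},\qquad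 {\rm Cor}_{d',m}(\epsilon,\eta)=\sum_iD_i^{1/(m-1)}.$$ Let $B_s=\log{\rm Cor}_{\hat d,m}(\rho_N^{-\hat r},\rho_N^{-\hat r-s})$. Let $\hat s$ be the smallest $s\in\{0,\dots,\hat r-1\}$ with $(B_s-B_{s+1})/\log\rho_N>D-\hat d-\frac12$, and $\hat s=\hat r$ if there is none. Set $\hat\tau=\rho_N^{-\hat r-\hat s}$ if $\hat s<\hat r$, and $\hat\tau=\rho_N^{-2\hat r+1}$ if $\hat s=\hat r$. **Proposition.** There is $N^*$, depending only on $D,d,K,\kappa,\zeta,v$ and the sequence $(\rho_N)$, such that for all $N\ge N^*$ and all $S_1,\dots,S_K,\tau,\delta_0,N_0,\dots,N_K,m$ as above the following holds with probability at least $1-N^{-\sqrt{\rho_N}}$: if $\hat r=r_N-2D$, then - if $\hat s<\hat r$, then $\tau\in[\hat\tau/\rho_N,\ \rho_N\hat\tau]$; - if $\hat s=\hat r$, then $\tau\le\hat\tau$. -/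

import Mathlib

open MeasureTheory Filter Asymptotics

noncomputable section

namespace HOSC

/-- The ambient Euclidean space `ℝ^D`. -/
abbrev Space (D : ℕ) : Type := EuclideanSpace ℝ (Fin D)

/-! ### Surfaces -/

/-- The open unit hypercube `(0,1)^D`. -/
def cube (D : ℕ) : Set (Space D) := {x | ∀ i, 0 < x i ∧ x i < 1}

/-- `B(S, τ)`: the points of the open unit cube at distance less than `τ` from `S`. -/
def tube {D : ℕ} (S : Set (Space D)) (τ : ℝ) : Set (Space D) :=
  {x | x ∈ cube D ∧ Metric.infDist x S < τ}

/-- The reach of `S` (Federer): the supremum of the `t` such that each point of `ℝ^D` at distance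
less than `t` from `S` has a unique nearest point in `S`. -/
def reach {D : ℕ} (S : Set (Space D)) : ENNReal :=
  ⨆ (t : NNReal) (_ : ∀ x : Space D, Metric.infDist x S < t →
    ∃! s, s ∈ S ∧ dist x s = Metric.infDist x S), (t : ENNReal)

/-- `S` is a `d`-dimensional embedded `C²` submanifold (without boundary) of `ℝ^D`: near each of
its points, a `C²` diffeomorphism between open sets of `ℝ^D` maps `S` onto the
coordinate subspace `ℝ^d × {0}`. -/
def IsC2Submanifold {D : ℕ} (d : ℕ) (S : Set (Space D)) : Prop :=
  ∀ p ∈ S, ∃ Φ : OpenPartialHomeomorph (Space D) (Space D),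
    p ∈ Φ.source ∧ ContDiffOn ℝ 2 Φ Φ.source ∧ ContDiffOn ℝ 2 Φ.symm Φ.target ∧
      ∀ x ∈ Φ.source, x ∈ S ↔ ∀ i : Fin D, d ≤ (i : ℕ) → Φ x i = 0

/-- The class `𝒮_d²(κ)` of surfaces without boundary. -/
structure IsSurface {D : ℕ} (d : ℕ) (κ : ℝ) (S : Set (Space D)) : Prop where
  subset_cube : S ⊆ cube D
  connected : IsConnected S
  submanifold : IsC2Submanifold d S
  le_diam : 1 / κ ≤ Metric.diam S
  diam_le : Metric.diam S ≤ κ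
  le_reach : ENNReal.ofReal (1 / κ) ≤ reach S

/-! ### The generative model -/

/-- The region of the outliers: the cube minus the `δ₀`-neighborhoods of the surfaces. -/
def outlierRegion {D K : ℕ} (S : Fin K → Set (Space D)) (δ₀ : ℝ) : Set (Space D) :=
  cube D \ ⋃ k, tube (S k) δ₀

/-- The region from which a point with a given label is drawn; the label `some k` stands for the
`k`-th cluster and `none` for the outliers. -/
def region {D K : ℕ} (S : Fin K → Set (Space D)) (τ δ₀ : ℝ) : Option (Fin K) → Set (Space D)
  | some k => tube (S k) τ
  | none => outlierRegion S δ₀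

/-- The joint law of the data: independent points, the `i`-th one being uniformly distributed
on the region given by its label `c i`. -/
def dataLaw {D K N : ℕ} (S : Fin K → Set (Space D)) (τ δ₀ : ℝ) (c : Fin N → Option (Fin K)) :
    Measure (Fin N → Space D) :=
  Measure.pi fun i => ProbabilityTheory.cond volume (region S τ δ₀ (c i))

/-- The number of data points with label `l`. -/
def labelCount {K N : ℕ} (c : Fin N → Option (Fin K)) (l : Option (Fin K)) : ℕ :=
  Nat.card {i : Fin N // c i = l}

/-! ### The multiway affinity -/

/-- The simple kernel `φ(s) = 1_{|s| < 1}`. -/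
def kernel (s : ℝ) : ℝ := if |s| < 1 then 1 else 0

/-- `Λ_d(z₁, …, z_n)`: the minimum over the `d`-dimensional affine subspaces `L` of the largest
distance from one of the points to `L`. -/
def width {D n : ℕ} (d : ℕ) (z : Fin n → Space D) : ℝ :=
  ⨅ L : {L : AffineSubspace ℝ (Space D) //
      (L : Set (Space D)).Nonempty ∧ Module.finrank ℝ L.direction = d},
    ⨆ j, Metric.infDist (z j) (L.1 : Set (Space D))

open Classical in
/-- The affinity `α_d` of a tuple of points. -/
def affinity {D n : ℕ} (d : ℕ) (ε η : ℝ) (z : Fin n → Space D) : ℝ :=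
  if Function.Injective z then
    kernel (Metric.diam (Set.range z) / ε) * kernel (width d z / η)
  else 0

/-- The similarity `W_{ij} = ∑_{i₁, …, i_{m-2}} α_d(x_i, x_j, x_{i₁}, …, x_{i_{m-2}})`. -/
def weight {D N : ℕ} (d m : ℕ) (ε η : ℝ) (x : Fin N → Space D) (i j : Fin N) : ℝ :=
  ∑ w : Fin (m - 2) → Fin N,
    affinity d ε η fun a => x ((Fin.cons i (Fin.cons j w) : Fin (m - 2 + 1 + 1) → Fin N) a)

/-- The degree `D_i = ∑_j W_{ij}`. -/
def degree {D N : ℕ} (d m : ℕ) (ε η : ℝ) (x : Fin N → Space D) (i : Fin N) : ℝ :=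
  ∑ j, weight d m ε η x i j

/-! ### The correlation functions and the estimators -/

open Classical in
/-- The pairwise correlation function `Cor(ε)`. -/
def cor {D N : ℕ} (x : Fin N → Space D) (ε : ℝ) : ℝ :=
  ∑ i, ∑ j, if j ≠ i ∧ dist (x i) (x j) ≤ ε then 1 else 0

/-- The multiway correlation function `Cor_{d,m}(ε, η) = ∑_i D_i^{1/(m-1)}`. -/
def multiCor {D N : ℕ} (d m : ℕ) (x : Fin N → Space D) (ε η : ℝ) : ℝ :=
  ∑ i, degree d m ε η x i ^ (1 / ((m : ℝ) - 1))

/-- The first integer `r` in `{a, …, b - 1}` with `T r`; equal to `b` if there is none. -/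
def firstIndex (T : ℤ → Prop) (a b : ℤ) : ℤ :=
  open Classical in
  if h : ((Finset.Ico a b).filter T).Nonempty then ((Finset.Ico a b).filter T).min' h else b

/-- `r_N`, for the sample size `N`, the dimension `d` and the value `ρ` of `ρ_N`. -/
def rMax (d N : ℕ) (ρ : ℝ) : ℤ :=
  -⌊(Real.log (Real.log N) - Real.log N) / (d * Real.log ρ)⌋ - 2

/-- `A_r = log Cor(ρ^{-r})`. -/
def logCor {D N : ℕ} (ρ : ℝ) (x : Fin N → Space D) (r : ℤ) : ℝ := Real.log (cor x (ρ ^ (-r)))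

/-- `r̂`: the first kink of the pairwise correlation function in `{3, …, r_N - 2D - 1}`, equal to
`r_N - 2D` if there is none. -/
def rHat {D N : ℕ} (d : ℕ) (ρ : ℝ) (x : Fin N → Space D) : ℤ :=
  firstIndex (fun r => (logCor ρ x r - logCor ρ x (r + 1)) / Real.log ρ > (D : ℝ) - 1 / 2)
    3 (rMax d N ρ - 2 * D)

/-- `d̂`, the estimator of the intrinsic dimension. -/
def dHat {D N : ℕ} (d : ℕ) (ρ : ℝ) (x : Fin N → Space D) : ℤ :=
  if rHat d ρ x = 3 then (D : ℤ)
  else round ((logCor ρ x 3 - logCor ρ x (rHat d ρ x)) / (rHat d ρ x * Real.log ρ))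

/-- `B_s = log Cor_{d̂,m}(ρ^{-r̂}, ρ^{-r̂-s})`. -/
def logMultiCor {D N : ℕ} (d m : ℕ) (ρ : ℝ) (x : Fin N → Space D) (s : ℤ) : ℝ :=
  Real.log (multiCor (dHat d ρ x).toNat m x (ρ ^ (-rHat d ρ x)) (ρ ^ (-rHat d ρ x - s)))

/-- `ŝ`: the first kink of the multiway correlation function in `{0, …, r̂ - 1}`, equal to `r̂` if
there is none. -/
def sHat {D N : ℕ} (d m : ℕ) (ρ : ℝ) (x : Fin N → Space D) : ℤ :=
  firstIndex
    (fun s => (logMultiCor d m ρ x s - logMultiCor d m ρ x (s + 1)) / Real.log ρ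
      > (D : ℝ) - dHat d ρ x - 1 / 2)
    0 (rHat d ρ x)

/-- The refined estimator `τ̂` of the jitter level: `ρ^{-r̂-ŝ}` if there is a kink at `ŝ < r̂`,
and `ρ^{-r̂-ŝ+1} = ρ^{-2r̂+1}` if there is none. -/
def tauHat {D N : ℕ} (d m : ℕ) (ρ : ℝ) (x : Fin N → Space D) : ℝ :=
  if sHat d m ρ x < rHat d ρ x then ρ ^ (-rHat d ρ x - sHat d m ρ x)
  else ρ ^ (-rHat d ρ x - sHat d m ρ x + 1)

end HOSC

end

/-! Let M be the size of the largest cluster and put q(ε, η) = M ε^d (min(η, τ)/τ)^(D-d) (`level`):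
up to constants, the expected number of points of a large cluster in a piece of its tube of diameter
ε and thickness η. At the scales that matter, with high probability Cor(ε) is of order M q(ε, ε) and
Cor_{d,m}(ε, η) of order M q(ε, η), with constants independent of N. On a logarithmic scale, q(ε, ε)
has slope d in ε above τ and slope D below it, while q(ε, η) has slope 0 in η above τ and slope D -
d below it. Since log ρ eventually dominates the constants, one step of ratio ρ reveals the slope
with error less than 1/2.

Suppose r̂ = R := r_N - 2D. If τ ≥ ρ^(-(R-1)), the pairwise correlation would have a kink at the
first r with ρ^(-r) ≤ τ, and r̂ would be smaller. So τ < ρ^(-(R-1)), and the values of Cor at ρ^(-3)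
and ρ^(-R) force d̂ = d. With ε = ρ^(-R), the multiway correlation has no kink at s while ρ^(-R-s-1)
≥ τ, and has one at the first s with ρ^(-R-s) ≤ τ; this traps τ (`tauHat_spec`). At most seven
random events are needed, because above the jitter level a single pair of bounds serves all s:
Cor_{d,m}(ε, η) ≤ Cor(ε) from above (`multiCor_le_cor`), and the lower bound at max(τ, ε²) with
monotonicity in η (`multiCor_mono`). The inequality Cor_{d,m} ≤ Cor also supplies the lower bounds
for Cor.

Lower bound for Cor_{d,m} (`exists_multiCor_lower`): a fixed proportion of a tube is covered by
polynomially many pieces of diameter ε/2 lying within η/2 of a d-plane, each of sufficient volume.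
The condition ε² ≤ η enters because a surface of positive reach leaves its tangent plane
quadratically. Each piece receives at least a multiple of q points, and q dominates m, so nearly all
(m-1)-tuples in a piece count. Upper bound (`exists_multiCor_upper`): every tuple with nonzero
affinity lies in one of polynomially many slabs, so D_i is at most their number times the (m-1)st
power of the largest count. Since m is large compared with log N, the (m-1)st root reduces the
number of slabs to a factor 3.

There may be about ρ times as many outliers as clustered points, but only O(M) of them fall near the
surfaces, and the others see at most O(q/ρ) neighbors in a ball or slab (`exists_cnt_upper`,
`Setup.sum_le`). The volume estimates rest on Federer's theory of positive reach, developed from the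
growth of the distance function: quadratic deviation from tangent spaces, their Lipschitz variation,
and projections of patches covering discs. -/

noncomputable section

namespace HOSC

/-! ### Separated sets and coverings -/

/-- A finite set whose points are at mutual distance at least `h`. -/
def Sep {X : Type*} [PseudoMetricSpace X] (h : ℝ) (F : Finset X) : Prop :=
  ∀ x ∈ F, ∀ y ∈ F, x ≠ y → h ≤ dist x y

theorem exists_maximal_sep {X : Type*} [PseudoMetricSpace X] {P : Set X} {h : ℝ} (hh : 0 < h)
    {n : ℝ} (hn : ∀ F : Finset X, ↑F ⊆ P → Sep h F → (F.card : ℝ) ≤ n) :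
    ∃ F : Finset X, ↑F ⊆ P ∧ Sep h F ∧ ∀ x ∈ P, ∃ y ∈ F, dist x y < h := by
  classical
  have hfin : {k : ℕ | ∃ F : Finset X, ↑F ⊆ P ∧ Sep h F ∧ F.card = k}.Finite := by
    refine (Set.finite_Iic ⌊n⌋₊).subset ?_
    rintro k ⟨F, hF, hs, rfl⟩
    exact Nat.le_floor (hn F hF hs)
  obtain ⟨k, ⟨F, hF, hs, rfl⟩, hmax⟩ := hfin.exists_maximal ⟨0, ∅, by simp, by simp [Sep], rfl⟩
  refine ⟨F, hF, hs, fun x hx => ?_⟩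
  by_contra! hcon
  have hxF : x ∉ F := fun hxF => by
    have := hcon x hxF
    rw [dist_self] at this
    linarith
  have := hmax (y := (insert x F).card) ⟨insert x F, by
      intro y hy
      rcases Finset.mem_insert.1 (Finset.mem_coe.1 hy) with rfl | hy
      · exact hx
      · exact hF hy, ?_, rfl⟩ (by
      rw [Finset.card_insert_of_notMem hxF]; exact Nat.le_succ _)
  · rw [Finset.card_insert_of_notMem hxF] at this
    omega
  · intro a ha b hb hab
    rcases Finset.mem_insert.1 ha with h1 | h1 <;> rcases Finset.mem_insert.1 hb with h2 | h2
    · exact absurd (h1.trans h2.symm) hab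
    · rw [h1]; exact hcon b h2
    · rw [h2, dist_comm]; exact hcon a h1
    · exact hs a h1 b h2 hab

section Volume

variable {E : Type*} [NormedAddCommGroup E] [InnerProductSpace ℝ E] [FiniteDimensional ℝ E]
  [MeasurableSpace E] [BorelSpace E]

theorem volume_real_ball (x : E) {r : ℝ} (hr : 0 < r) :
    volume.real (Metric.ball x r)
      = r ^ Module.finrank ℝ E * volume.real (Metric.ball (0 : E) 1) := by
  rw [measureReal_def, Measure.addHaar_ball_of_pos _ _ hr, ENNReal.toReal_mul,
    ENNReal.toReal_ofReal (by positivity), measureReal_def]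

variable (E) in
theorem volume_real_unit_ball_pos : 0 < volume.real (Metric.ball (0 : E) 1) :=
  ENNReal.toReal_pos (Metric.measure_ball_pos _ _ one_pos).ne' measure_ball_lt_top.ne

theorem sep_volume_le {F : Finset E} {h : ℝ} (hh : 0 < h) (hs : Sep h F) {A : Set E}
    (hA : volume A ≠ ⊤) (hFA : ∀ y ∈ F, Metric.ball y (h / 2) ⊆ A) :
    F.card * ((h / 2) ^ Module.finrank ℝ E * volume.real (Metric.ball (0 : E) 1))
      ≤ volume.real A := by
  have hd : (F : Set E).PairwiseDisjoint fun y => Metric.ball y (h / 2) := by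
    intro a ha b hb hab
    refine Metric.ball_disjoint_ball ?_
    linarith [hs a ha b hb hab]
  have h1 := measureReal_biUnion_finset (μ := volume) hd (fun y _ => Metric.isOpen_ball.measurableSet)
    (fun y _ => measure_ball_lt_top.ne)
  have h2 : volume.real (⋃ y ∈ F, Metric.ball y (h / 2)) ≤ volume.real A :=
    measureReal_mono (Set.iUnion₂_subset hFA) hA
  rw [h1] at h2
  simpa [volume_real_ball _ (half_pos hh)] using h2

theorem sep_card_le {F : Finset E} {h R : ℝ} (hh : 0 < h) (hR : 0 ≤ R) (hs : Sep h F) {x : E}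
    (hF : ∀ y ∈ F, dist y x ≤ R) :
    (F.card : ℝ) ≤ (1 + 2 * R / h) ^ Module.finrank ℝ E := by
  have hω := volume_real_unit_ball_pos E
  have h1 := sep_volume_le hh hs (A := Metric.ball x (R + h / 2)) measure_ball_lt_top.ne
    (fun y hy => Metric.ball_subset_ball' (by linarith [hF y hy]))
  rw [volume_real_ball x (by positivity), ← mul_assoc] at h1
  have h2 := le_of_mul_le_mul_right h1 hω
  rw [← le_div_iff₀ (by positivity), ← div_pow] at h2
  have h3 : 1 + 2 * R / h = (R + h / 2) / (h / 2) := by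
    field_simp
    ring
  rwa [h3]

theorem exists_net {P : Set E} {h R : ℝ} (hh : 0 < h) (hR : 0 ≤ R) {x : E}
    (hP : ∀ y ∈ P, dist y x ≤ R) :
    ∃ F : Finset E, ↑F ⊆ P ∧ (F.card : ℝ) ≤ (1 + 2 * R / h) ^ Module.finrank ℝ E ∧ Sep h F ∧
      ∀ y ∈ P, ∃ z ∈ F, dist y z < h := by
  obtain ⟨F, h1, h2, h3⟩ := exists_maximal_sep (P := P) hh
    (fun F hF hs => sep_card_le hh hR hs (x := x) fun y hy => hP y (hF hy))
  exact ⟨F, h1, sep_card_le hh hR h2 (x := x) fun y hy => hP y (h1 hy), h2, h3⟩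

theorem cover_volume_le {F : Finset E} {h : ℝ} (hh : 0 < h) {A : Set E}
    (hA : ∀ x ∈ A, ∃ y ∈ F, dist x y < h) :
    volume.real A ≤ F.card * (h ^ Module.finrank ℝ E * volume.real (Metric.ball (0 : E) 1)) := by
  have h1 : A ⊆ ⋃ y ∈ F, Metric.ball y h := fun x hx => by
    obtain ⟨y, hy, hxy⟩ := hA x hx
    exact Set.mem_biUnion hy hxy
  calc volume.real A ≤ volume.real (⋃ y ∈ F, Metric.ball y h) :=
        measureReal_mono h1 (measure_biUnion_lt_top F.finite_toSet
          fun y _ => measure_ball_lt_top).ne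
    _ ≤ ∑ y ∈ F, volume.real (Metric.ball y h) := measureReal_biUnion_finset_le _ _
    _ = _ := by simp [volume_real_ball _ hh]

/-- The volume of the `η`-neighborhood of an affine subspace of dimension at most `d`, in a ball. -/
theorem volume_slab_le {d : ℕ} (hd : d ≤ Module.finrank ℝ E) (V : Submodule ℝ E)
    (hV : Module.finrank ℝ V ≤ d) (a z : E) {r η : ℝ} (hη : 0 < η) (hr : η ≤ r) :
    volume.real (Metric.ball z r ∩ {y | ∃ v ∈ V, ‖y - a - v‖ < η})
      ≤ 9 ^ d * 2 ^ Module.finrank ℝ E * volume.real (Metric.ball (0 : E) 1)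
        * (r ^ d * η ^ (Module.finrank ℝ E - d)) := by
  set n := Module.finrank ℝ E
  set ω := volume.real (Metric.ball (0 : E) 1)
  have hω : 0 < ω := volume_real_unit_ball_pos E
  have hr0 : 0 < r := hη.trans_le hr
  set A := Metric.ball z r ∩ {y | ∃ v ∈ V, ‖y - a - v‖ < η} with hA
  rcases A.eq_empty_or_nonempty with h0 | ⟨y0, hy0, v0, hv0, hyv0⟩
  · rw [h0]; simp; positivity
  -- Points of `A` are within 2r of each other and their feet in `V` are displaced by less than η ≤
  -- r each, so all feet lie in one ball of `V` of radius 4r. Taking the net inside `V` makes its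
  -- cardinality grow with the dimension of `V` instead of the ambient one.
  obtain ⟨F, -, hFc, -, hF⟩ := exists_net (E := V) (P := Metric.closedBall ⟨v0, hv0⟩ (4 * r))
    hη (by positivity : (0 : ℝ) ≤ 4 * r) (x := ⟨v0, hv0⟩) fun y hy => hy
  classical
  have h1 := cover_volume_le (F := F.image fun v : V => a + v) (h := 2 * η) (by positivity) (A := A) (by
    rintro y ⟨hy, v, hv, hyv⟩
    obtain ⟨w, hw, hvw⟩ := hF ⟨v, hv⟩ (by
      rw [Metric.mem_closedBall, Subtype.dist_eq, dist_eq_norm]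
      have e1 : v - v0 = (y - z) - (y0 - z) - (y - a - v) + (y0 - a - v0) := by abel
      rw [Metric.mem_ball, dist_eq_norm] at hy hy0
      show ‖v - v0‖ ≤ _
      rw [e1]
      have := norm_add_le ((y - z) - (y0 - z) - (y - a - v)) (y0 - a - v0)
      have := norm_sub_le ((y - z) - (y0 - z)) (y - a - v)
      have := norm_sub_le (y - z) (y0 - z)
      linarith)
    refine ⟨a + w, Finset.mem_image_of_mem _ hw, ?_⟩
    rw [Subtype.dist_eq, dist_eq_norm] at hvw
    rw [dist_eq_norm]
    have e1 : y - (a + w) = (y - a - v) + (v - w) := by abel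
    rw [e1]
    have := norm_add_le (y - a - v) (v - (w : E))
    have : ‖v - (w : E)‖ < η := hvw
    linarith)
  have hq : 1 ≤ r / η := by rwa [one_le_div hη]
  have hFc' : ((F.image fun v : V => a + v).card : ℝ) ≤ (9 * (r / η)) ^ d := by
    calc ((F.image fun v : V => a + v).card : ℝ) ≤ F.card := by exact_mod_cast Finset.card_image_le
      _ ≤ _ := hFc
      _ ≤ (9 * (r / η)) ^ Module.finrank ℝ V := by
        gcongr
        rw [mul_div_assoc, mul_div_assoc]
        linarith
      _ ≤ _ := pow_le_pow_right₀ (by linarith) hV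
  calc volume.real A ≤ _ := h1
    _ ≤ (9 * (r / η)) ^ d * ((2 * η) ^ n * ω) := by gcongr
    _ = _ := by
      have : η ^ n = η ^ d * η ^ (n - d) := by rw [← pow_add, Nat.add_sub_cancel' hd]
      rw [mul_pow, mul_pow, this, div_pow]
      field_simp

end Volume

/-! ### Sets of positive reach -/

section Reach

open Metric
open scoped RealInnerProductSpace

variable {E : Type*} [NormedAddCommGroup E] [InnerProductSpace ℝ E] [FiniteDimensional ℝ E]
  {S : Set E} {R : ℝ}

/-- Points at distance less than `R` from the closed set `S` have a unique nearest point in `S`. -/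
structure UniqueNearest (S : Set E) (R : ℝ) : Prop where
  pos : 0 < R
  nonempty : S.Nonempty
  closed : IsClosed S
  unique : ∀ x, infDist x S < R → ∃! s, s ∈ S ∧ dist x s = infDist x S

/-- `T` is the tangent space of `S` at `p`, and `S` has quadratic contact with it. -/
structure IsTangent (S : Set E) (p : E) (T : Submodule ℝ E) : Prop where
  contact : ∃ C > 0, ∃ r > 0, ∀ q ∈ S, dist q p < r → ∀ n ∈ Tᗮ, ⟪q - p, n⟫ ≤ C * ‖q - p‖ ^ 2 * ‖n‖
  approx : ∀ v ∈ T, ∀ e > 0, ∃ t₀ > 0, ∀ t, 0 < t → t ≤ t₀ → ∃ q ∈ S, ‖q - p - t • v‖ ≤ e * t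

namespace UniqueNearest

theorem exists_nearest (h : UniqueNearest S R) (x : E) : ∃ p ∈ S, dist x p = infDist x S := by
  obtain ⟨p, hp, hxp⟩ := h.closed.exists_infDist_eq_dist h.nonempty x
  exact ⟨p, hp, hxp.symm⟩

/-- By compactness and uniqueness, the points of `S` that are not close to `p` are farther from `x`
than `p` by a margin 2δ, which a displacement of `x` by less than δ cannot overcome. -/
theorem nearest_continuous (h : UniqueNearest S R) {x p : E} (hx : infDist x S < R) (hp : p ∈ S)
    (hxp : dist x p = infDist x S) {e : ℝ} (he : 0 < e) :
    ∃ δ > 0, ∀ y, dist y x < δ → ∀ q ∈ S, dist y q = infDist y S → dist q p < e := by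
  set a := infDist x S with ha
  set K := (S ∩ closedBall x (a + 2)) ∩ {q | e ≤ dist q p} with hK
  have hKc : IsCompact K := ((isCompact_closedBall x (a + 2)).inter_left h.closed).inter_right
    (isClosed_le continuous_const (continuous_id.dist continuous_const))
  have key : ∃ δ > 0, δ ≤ 1 ∧ ∀ q ∈ K, a + 2 * δ ≤ dist x q := by
    rcases K.eq_empty_or_nonempty with h0 | hne
    · exact ⟨1, one_pos, le_rfl, by simp [h0]⟩
    obtain ⟨q₀, hq₀, hmin⟩ := hKc.exists_isMinOn hne (continuous_const.dist continuous_id).continuousOn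
      (f := fun q => dist x q)
    have h1 : a ≤ dist x q₀ := infDist_le_dist_of_mem hq₀.1.1
    have h2 : a ≠ dist x q₀ := fun heq => by
      have := (h.unique x hx).unique ⟨hp, hxp⟩ ⟨hq₀.1.1, heq.symm⟩
      have h3 := hq₀.2
      rw [Set.mem_ofPred_eq, ← this, dist_self] at h3
      linarith
    have h3 := lt_of_le_of_ne h1 h2
    refine ⟨min 1 ((dist x q₀ - a) / 2), lt_min one_pos (by linarith), min_le_left _ _, ?_⟩
    intro q hq
    have := hmin hq
    simp only [Set.mem_ofPred_eq] at this
    linarith [min_le_right 1 ((dist x q₀ - a) / 2)]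
  obtain ⟨δ, hδ, hδ1, hKδ⟩ := key
  refine ⟨δ, hδ, fun y hy q hq hyq => ?_⟩
  by_contra! hcon
  have h1 : infDist y S ≤ infDist x S + dist y x := infDist_le_infDist_add_dist
  have h2 := dist_triangle x y q
  rw [dist_comm x y] at h2
  have h3 := hKδ q ⟨⟨hq, by rw [mem_closedBall, dist_comm]; linarith⟩, hcon⟩
  linarith

/-- A lower bound for the one-sided directional derivative of the distance function. The nearest
point `q` of the moved point is close to `p`, so in the expansion of ‖x + tu - q‖² the vector `x -
q` may be replaced by `x - p` in the linear term, while ‖x - q‖ ≥ dist(x, S). -/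
theorem infDist_perturb (h : UniqueNearest S R) {x p : E} (h0 : 0 < infDist x S)
    (hx : infDist x S < R) (hp : p ∈ S) (hxp : dist x p = infDist x S) (u : E) {θ : ℝ}
    (hθ : 0 < θ) :
    ∃ t₀ > 0, ∀ t, 0 < t → t ≤ t₀ →
      infDist x S + t * (⟪x - p, u⟫ / infDist x S - θ) ≤ infDist (x + t • u) S := by
  set a := infDist x S with ha
  set β := ⟪x - p, u⟫ / a - θ with hβ
  have haβ : a * β = ⟪x - p, u⟫ - a * θ := by rw [hβ]; field_simp
  have hu : 0 < ‖u‖ + 1 := by positivity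
  obtain ⟨δ, hδ, hcont⟩ := h.nearest_continuous hx hp hxp
    (e := a * θ / (2 * (‖u‖ + 1))) (by positivity)
  refine ⟨min (δ / (2 * (‖u‖ + 1))) (a * θ / (β ^ 2 + 1)), by positivity, fun t ht htt => ?_⟩
  have ht1 : t * (2 * (‖u‖ + 1)) ≤ δ := (le_div_iff₀ (by positivity)).1 (htt.trans (min_le_left _ _))
  have ht2 : t * (β ^ 2 + 1) ≤ a * θ := (le_div_iff₀ (by positivity)).1 (htt.trans (min_le_right _ _))
  obtain ⟨q, hq, hxq⟩ := h.exists_nearest (x + t • u)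
  have hqp := hcont (x + t • u) (by
    rw [dist_eq_norm, add_sub_cancel_left, norm_smul, Real.norm_of_nonneg ht.le]
    nlinarith [norm_nonneg u]) q hq hxq
  have h1 : a ≤ ‖x - q‖ := by rw [← dist_eq_norm]; exact infDist_le_dist_of_mem hq
  have h2 : ⟪q - p, u⟫ ≤ a * θ / 2 := by
    calc ⟪q - p, u⟫ ≤ ‖q - p‖ * ‖u‖ := real_inner_le_norm _ _
      _ ≤ a * θ / (2 * (‖u‖ + 1)) * (‖u‖ + 1) := by
        rw [dist_eq_norm] at hqp
        gcongr
        linarith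
      _ = _ := by field_simp
  have h3 : infDist (x + t • u) S ^ 2 = ‖x - q‖ ^ 2 + 2 * (t * ⟪x - q, u⟫) + t ^ 2 * ‖u‖ ^ 2 := by
    rw [← hxq, dist_eq_norm, show x + t • u - q = (x - q) + t • u by abel, norm_add_sq_real,
      inner_smul_right, norm_smul, mul_pow, Real.norm_eq_abs, sq_abs]
  have h4 : ⟪x - q, u⟫ = ⟪x - p, u⟫ - ⟪q - p, u⟫ := by
    rw [← inner_sub_left]; congr 1; abel
  have h5 : (a + t * β) ^ 2 ≤ infDist (x + t • u) S ^ 2 := by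
    rw [h3, h4]
    have e1 : (a + t * β) ^ 2 = a ^ 2 + 2 * t * (a * β) + t * (t * β ^ 2) := by ring
    have e2 : a ^ 2 ≤ ‖x - q‖ ^ 2 := by gcongr
    have e3 : t * (t * β ^ 2) ≤ t * (a * θ) := by
      apply mul_le_mul_of_nonneg_left _ ht.le
      linarith
    have e4 : t * ⟪q - p, u⟫ ≤ t * (a * θ / 2) := mul_le_mul_of_nonneg_left h2 ht.le
    have e5 : 0 ≤ t ^ 2 * ‖u‖ ^ 2 := by positivity
    rw [e1, haβ]
    nlinarith
  exact le_of_abs_le (abs_le_of_sq_le_sq h5 infDist_nonneg)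

/-- Federer's extension of normal segments, without a gradient flow. The distance to `S` grows at
unit speed away from the nearest point, so on the ball of radius `t - a` about `p + a n` it reaches
`t`; equality in the triangle inequality then forces the point where it does so to be `p + t n`. -/
theorem infDist_extend (h : UniqueNearest S R) {p n : E} {a t : ℝ} (hp : p ∈ S) (hn : ‖n‖ = 1)
    (ha : 0 < a) (hpa : infDist (p + a • n) S = a) (ht : 0 < t) (htR : t < R) :
    infDist (p + t • n) S = t := by
  have hle : infDist (p + t • n) S ≤ t := by
    refine (infDist_le_dist_of_mem hp).trans ?_
    rw [dist_eq_norm, add_sub_cancel_left, norm_smul, hn, Real.norm_of_nonneg ht.le, mul_one]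
  refine le_antisymm hle ?_
  rcases le_or_gt t a with hta | hta
  · have h1 : infDist (p + a • n) S ≤ infDist (p + t • n) S + dist (p + a • n) (p + t • n) :=
      infDist_le_infDist_add_dist
    rw [hpa, dist_add_left, dist_eq_norm, ← sub_smul, norm_smul, hn,
      Real.norm_of_nonneg (sub_nonneg.2 hta)] at h1
    linarith
  set x := p + a • n with hx
  have hcpt : IsCompact (closedBall x (t - a)) := isCompact_closedBall _ _
  have hne : (closedBall x (t - a)).Nonempty := nonempty_closedBall.2 (by linarith)
  -- Penalizing by `l` times the distance to `x` pushes a maximizer to the sphere: at an interior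
  -- one, moving away from its nearest point `q` would gain at a rate close to 1, hence more than
  -- `l`.
  have claim : ∀ l : ℝ, 0 ≤ l → l < 1 → ∃ z ∈ closedBall x (t - a), a + l * (t - a) ≤ infDist z S := by
    intro l hl0 hl1
    obtain ⟨z, hz, hmax⟩ := hcpt.exists_isMaxOn hne (f := fun z => infDist z S - l * dist z x)
      ((continuous_infDist_pt S).sub (continuous_const.mul
        (continuous_id.dist continuous_const))).continuousOn
    have hmax' : ∀ y ∈ closedBall x (t - a), infDist y S - l * dist y x ≤ infDist z S - l * dist z x :=
      fun y hy => hmax hy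
    have hgx := hmax' x (mem_closedBall_self (by linarith))
    rw [dist_self, mul_zero, sub_zero, hpa] at hgx
    have hlz : 0 ≤ l * dist z x := by positivity
    refine ⟨z, hz, ?_⟩
    rcases (mem_closedBall.1 hz).eq_or_lt with heq | hlt
    · rw [heq] at hgx; linarith
    exfalso
    set b := infDist z S with hb
    have hb0 : 0 < b := by linarith
    have hbR : b < R := by
      have : infDist z S ≤ infDist x S + dist z x := infDist_le_infDist_add_dist
      linarith
    obtain ⟨q, hq, hzq⟩ := h.exists_nearest z
    have hnq : ‖z - q‖ = b := by rw [← dist_eq_norm, hzq]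
    obtain ⟨t₀, ht₀, hper⟩ := h.infDist_perturb hb0 hbR hq hzq (z - q)
      (θ := (1 - l) * b / 2) (by have : 0 < 1 - l := by linarith
                                 positivity)
    rw [← hb, real_inner_self_eq_norm_sq, hnq] at hper
    set s := min t₀ ((t - a - dist z x) / b)
    have hs0 : 0 < s := lt_min ht₀ (div_pos (by linarith) hb0)
    have hs1 : s * b ≤ t - a - dist z x := (le_div_iff₀ hb0).1 (min_le_right _ _)
    have h1 := hper s hs0 (min_le_left _ _)
    have hd : dist (z + s • (z - q)) x ≤ dist z x + s * b := by
      refine (dist_triangle _ z _).trans ?_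
      rw [dist_self_add_left, norm_smul, hnq, Real.norm_of_nonneg hs0.le]
      linarith
    have h2 := hmax' (z + s • (z - q)) (by rw [mem_closedBall]; linarith)
    have h3 : b ^ 2 / b = b := by field_simp
    rw [h3] at h1
    have h4 : l * dist (z + s • (z - q)) x ≤ l * (dist z x + s * b) :=
      mul_le_mul_of_nonneg_left hd hl0
    have h5 : 0 < s * ((1 - l) * b / 2) := by
      have : 0 < 1 - l := by linarith
      positivity
    nlinarith
  obtain ⟨z, hz, hmax⟩ := hcpt.exists_isMaxOn hne (f := fun z => infDist z S)
    (continuous_infDist_pt S).continuousOn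
  have hmax' : ∀ y ∈ closedBall x (t - a), infDist y S ≤ infDist z S := fun y hy => hmax hy
  have hzt : t ≤ infDist z S := by
    by_contra! hcon
    have hxz := hmax' x (mem_closedBall_self (by linarith))
    rw [hpa] at hxz
    have hta' : 0 < t - a := by linarith
    obtain ⟨y, hy, hya⟩ := claim (((infDist z S - a) / (t - a) + 1) / 2)
      (by have : 0 ≤ (infDist z S - a) / (t - a) := div_nonneg (by linarith) hta'.le
          linarith)
      (by have : (infDist z S - a) / (t - a) < 1 := by rw [div_lt_one hta']; linarith
          linarith)
    have := hmax' y hy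
    have e1 : ((infDist z S - a) / (t - a) + 1) / 2 * (t - a) = (infDist z S - a + (t - a)) / 2 := by
      field_simp
    linarith
  have hw : ‖z - x‖ ≤ t - a := by rw [← dist_eq_norm]; exact hz
  have hzp : t ≤ ‖(z - x) + a • n‖ := by
    have : (z - x) + a • n = z - p := by rw [hx]; abel
    rw [this, ← dist_eq_norm]
    exact hzt.trans (infDist_le_dist_of_mem hp)
  have h1 : t ^ 2 ≤ ‖z - x‖ ^ 2 + 2 * (a * ⟪z - x, n⟫) + a ^ 2 := by
    have := pow_le_pow_left₀ ht.le hzp 2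
    rwa [norm_add_sq_real, inner_smul_right, norm_smul, hn, mul_one, Real.norm_eq_abs, sq_abs] at this
  have h1' : ‖z - x‖ ^ 2 ≤ (t - a) ^ 2 := by gcongr
  have h2 : t - a ≤ ⟪z - x, n⟫ := by
    by_contra! hcon
    nlinarith
  have h3 : ‖(z - x) - (t - a) • n‖ ^ 2 ≤ 0 := by
    rw [norm_sub_sq_real, inner_smul_right, norm_smul, hn, mul_one, Real.norm_eq_abs, sq_abs]
    nlinarith
  have h4 : (z - x) - (t - a) • n = 0 := by
    rw [← norm_eq_zero]
    exact pow_eq_zero_iff (two_ne_zero) |>.1 (le_antisymm h3 (sq_nonneg _))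
  have h5 : z = p + t • n := by
    have : z = x + (t - a) • n := by rw [← sub_eq_zero, ← h4]; abel
    rw [this, hx, sub_smul]; abel
  rwa [← h5]

/-- Quadratic contact makes `p` a nearest point of `p + a n` for small `a`; the segment is then
extended up to the reach. -/
theorem infDist_normal (h : UniqueNearest S R) {p n : E} {T : Submodule ℝ E} (hT : IsTangent S p T)
    (hp : p ∈ S) (hn : ‖n‖ = 1) (hnT : n ∈ Tᗮ) {t : ℝ} (ht : 0 < t) (htR : t < R) :
    infDist (p + t • n) S = t := by
  obtain ⟨C, hC, r, hr, hcon⟩ := hT.contact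
  set a := min (1 / (2 * C)) (r / 2) with ha
  have ha0 : 0 < a := by positivity
  have ha1 : a * (2 * C) ≤ 1 := (le_div_iff₀ (by positivity)).1 (min_le_left _ _)
  have ha2 : a ≤ r / 2 := min_le_right _ _
  refine h.infDist_extend hp hn ha0 ?_ ht htR
  refine le_antisymm ?_ ?_
  · refine (infDist_le_dist_of_mem hp).trans ?_
    rw [dist_eq_norm, add_sub_cancel_left, norm_smul, hn, Real.norm_of_nonneg ha0.le, mul_one]
  · rw [le_infDist h.nonempty]
    intro q hq
    rw [dist_comm, dist_eq_norm, ← sub_sub]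
    rcases lt_or_ge (dist q p) r with hqr | hqr
    · have h1 := hcon q hq hqr n hnT
      rw [hn, mul_one] at h1
      refine le_of_abs_le (abs_le_of_sq_le_sq ?_ (norm_nonneg _))
      rw [norm_sub_sq_real, inner_smul_right, norm_smul, hn, mul_one, Real.norm_eq_abs, sq_abs]
      have h2 : a * ⟪q - p, n⟫ ≤ a * (C * ‖q - p‖ ^ 2) := mul_le_mul_of_nonneg_left h1 ha0.le
      have h3 : a * (2 * C) * ‖q - p‖ ^ 2 ≤ 1 * ‖q - p‖ ^ 2 := by gcongr
      nlinarith
    · have := norm_sub_norm_le (q - p) (a • n)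
      rw [norm_smul, hn, mul_one, Real.norm_of_nonneg ha0.le, ← dist_eq_norm] at this
      linarith

/-- The open balls of radius t < R tangent to `S` at `p` contain no point of `S`. Expanding the
square of the distance from `q` to their centers and letting t tend to R gives the bound. -/
theorem inner_le (h : UniqueNearest S R) {p q n : E} {T : Submodule ℝ E} (hT : IsTangent S p T)
    (hp : p ∈ S) (hq : q ∈ S) (hn : ‖n‖ = 1) (hnT : n ∈ Tᗮ) :
    2 * R * ⟪q - p, n⟫ ≤ ‖q - p‖ ^ 2 := by
  have key : ∀ t, 0 < t → t < R → 2 * t * ⟪q - p, n⟫ ≤ ‖q - p‖ ^ 2 := by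
    intro t ht htR
    have h1 := h.infDist_normal hT hp hn hnT ht htR
    have h2 : t ≤ ‖(q - p) - t • n‖ := by
      rw [sub_sub, ← dist_eq_norm, dist_comm, ← h1, h1]
      conv_lhs => rw [← h1]
      exact infDist_le_dist_of_mem hq
    have h3 := pow_le_pow_left₀ ht.le h2 2
    rw [norm_sub_sq_real, inner_smul_right, norm_smul, hn, mul_one, Real.norm_eq_abs, sq_abs] at h3
    linarith
  by_contra! hcon
  have hR := h.pos
  have hc : 0 < ⟪q - p, n⟫ := by
    by_contra! hc
    nlinarith [sq_nonneg ‖q - p‖]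
  have h1 : ‖q - p‖ ^ 2 / (2 * ⟪q - p, n⟫) < R := by
    rw [div_lt_iff₀ (by positivity)]; linarith
  have h2 : 0 ≤ ‖q - p‖ ^ 2 / (2 * ⟪q - p, n⟫) := by positivity
  have h3 := key ((‖q - p‖ ^ 2 / (2 * ⟪q - p, n⟫) + R) / 2) (by linarith) (by linarith)
  have h4 : ‖q - p‖ ^ 2 = ‖q - p‖ ^ 2 / (2 * ⟪q - p, n⟫) * (2 * ⟪q - p, n⟫) := by field_simp
  nlinarith

/-- `inner_le` in the direction of the normal component itself: `S` leaves its tangent space at most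
quadratically. -/
theorem norm_sub_proj_le (h : UniqueNearest S R) {p q : E} {T : Submodule ℝ E}
    (hT : IsTangent S p T) (hp : p ∈ S) (hq : q ∈ S) :
    ‖(q - p) - T.starProjection (q - p)‖ ≤ ‖q - p‖ ^ 2 / (2 * R) := by
  set w := (q - p) - T.starProjection (q - p) with hw
  have hR := h.pos
  have hwT : w ∈ Tᗮ := T.sub_starProjection_mem_orthogonal (q - p)
  rcases eq_or_ne w 0 with h0 | h0
  · rw [h0, norm_zero]; positivity
  have hw0 : 0 < ‖w‖ := norm_pos_iff.2 h0
  have h1 := h.inner_le hT hp hq (n := ‖w‖⁻¹ • w) (by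
    rw [norm_smul, norm_inv, norm_norm, inv_mul_cancel₀ hw0.ne']) (Tᗮ.smul_mem _ hwT)
  have h2 : ⟪q - p, w⟫ = ‖w‖ ^ 2 := by
    have : q - p = w + T.starProjection (q - p) := by rw [hw]; abel
    rw [this, inner_add_left, real_inner_self_eq_norm_sq,
      Submodule.inner_right_of_mem_orthogonal (T.starProjection_apply_mem _) hwT, add_zero]
  rw [inner_smul_right, h2] at h1
  rw [le_div_iff₀ (by positivity)]
  have h3 : ‖w‖⁻¹ * ‖w‖ ^ 2 = ‖w‖ := by field_simp
  rw [h3] at h1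
  linarith

-- First variation: a tangent direction with positive inner product with `x - p` would lead to
-- points of `S` nearer to `x` than `p`.
omit [FiniteDimensional ℝ E] in
theorem nearest_normal {p x : E} {T : Submodule ℝ E} (hT : IsTangent S p T)
    (hxp : dist x p = infDist x S) : x - p ∈ Tᗮ := by
  have key : ∀ v ∈ T, ⟪x - p, v⟫ ≤ 0 := by
    intro v hv
    by_contra! hc
    set c := ⟪x - p, v⟫
    set e := c / (2 * (‖x - p‖ + 1)) with he
    have hn : 0 < ‖x - p‖ + 1 := by positivity
    have he0 : 0 < e := by positivity
    obtain ⟨t₀, ht₀, happ⟩ := hT.approx v hv e he0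
    set L := ‖v‖ + e
    have hL : 0 < L := by positivity
    set t := min t₀ (c / (2 * L ^ 2)) with htdef
    have ht : 0 < t := by positivity
    have ht2 : t * (2 * L ^ 2) ≤ c := (le_div_iff₀ (by positivity)).1 (min_le_right _ _)
    obtain ⟨q, hq, hqv⟩ := happ t ht (min_le_left _ _)
    have h1 : ‖x - p‖ ≤ ‖(x - p) - (q - p)‖ := by
      rw [sub_sub_sub_cancel_right, ← dist_eq_norm, ← dist_eq_norm, hxp]
      exact infDist_le_dist_of_mem hq
    have h2 := pow_le_pow_left₀ (norm_nonneg _) h1 2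
    rw [norm_sub_sq_real (x - p)] at h2
    have h3 : ‖q - p‖ ≤ t * L := by
      calc ‖q - p‖ = ‖(q - p - t • v) + t • v‖ := by rw [sub_add_cancel]
        _ ≤ e * t + t * ‖v‖ := by
          refine (norm_add_le _ _).trans (add_le_add hqv ?_)
          rw [norm_smul, Real.norm_of_nonneg ht.le]
        _ = t * L := by ring
    have h4 : ⟪x - p, q - p⟫ = ⟪x - p, q - p - t • v⟫ + t * c := by
      rw [inner_sub_right _ (q - p), inner_smul_right]; ring
    have h5 : -(‖x - p‖ * (e * t)) ≤ ⟪x - p, q - p - t • v⟫ := by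
      have := neg_le_of_abs_le (abs_real_inner_le_norm (x - p) (q - p - t • v))
      have h6 : ‖x - p‖ * ‖q - p - t • v‖ ≤ ‖x - p‖ * (e * t) := by gcongr
      linarith
    have h6 : e * (2 * (‖x - p‖ + 1)) = c := by rw [he]; field_simp
    have h7 : ‖q - p‖ ^ 2 ≤ (t * L) ^ 2 := by gcongr
    have h8 : 0 < t * e := by positivity
    have h9 : t * (t * (2 * L ^ 2)) ≤ t * c := mul_le_mul_of_nonneg_left ht2 ht.le
    have h10 : t * (e * (2 * (‖x - p‖ + 1))) = t * c := by rw [h6]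
    have h11 : 0 < t * c := by positivity
    nlinarith
  rw [Submodule.mem_orthogonal']
  intro v hv
  refine le_antisymm (key v hv) ?_
  have := key (-v) (T.neg_mem hv)
  rw [inner_neg_right] at this
  linarith

end UniqueNearest

end Reach

/-! ### Tangent spaces of sets of positive reach: variation and projection of patches -/

section Reach2

open Metric
open scoped RealInnerProductSpace

variable {E : Type*} [NormedAddCommGroup E] [InnerProductSpace ℝ E] [FiniteDimensional ℝ E]
  {S : Set E} {R : ℝ} {T : E → Submodule ℝ E}

/-- The component of a vector orthogonal to a subspace. -/
def perp (V : Submodule ℝ E) (v : E) : E := v - V.starProjection v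

theorem perp_add (V : Submodule ℝ E) (v w : E) : perp V (v + w) = perp V v + perp V w := by
  simp only [perp, map_add]; abel

theorem perp_sub (V : Submodule ℝ E) (v w : E) : perp V (v - w) = perp V v - perp V w := by
  simp only [perp, map_sub]; abel

theorem perp_smul (V : Submodule ℝ E) (c : ℝ) (v : E) : perp V (c • v) = c • perp V v := by
  simp only [perp, map_smul, smul_sub]

theorem norm_perp_le (V : Submodule ℝ E) (v : E) : ‖perp V v‖ ≤ ‖v‖ := by
  rw [perp, ← V.starProjection_orthogonal_val]
  exact Vᗮ.norm_starProjection_apply_le v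

theorem norm_le_two_mul_proj {V : Submodule ℝ E} {v : E} (h : ‖perp V v‖ ≤ ‖v‖ / 2) :
    ‖v‖ ≤ 2 * ‖V.starProjection v‖ := by
  have : v = perp V v + V.starProjection v := by rw [perp]; abel
  have h2 := norm_add_le (perp V v) (V.starProjection v)
  rw [← this] at h2
  linarith

namespace UniqueNearest

theorem infDist_add_normal (h : UniqueNearest S R) {p w : E} {V : Submodule ℝ E}
    (hT : IsTangent S p V) (hp : p ∈ S) (hw : w ∈ Vᗮ) (hwR : ‖w‖ < R) :
    infDist (p + w) S = ‖w‖ := by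
  rcases eq_or_ne w 0 with rfl | h0
  · simp [infDist_zero_of_mem hp]
  have hw0 : 0 < ‖w‖ := norm_pos_iff.2 h0
  have := h.infDist_normal hT hp (n := ‖w‖⁻¹ • w) (by
    rw [norm_smul, norm_inv, norm_norm, inv_mul_cancel₀ hw0.ne']) (Vᗮ.smul_mem _ hw) hw0 hwR
  rwa [smul_smul, mul_inv_cancel₀ hw0.ne', one_smul] at this

theorem eq_of_add_normal_eq (h : UniqueNearest S R) {p q w w' : E} {V V' : Submodule ℝ E}
    (hV : IsTangent S p V) (hV' : IsTangent S q V') (hp : p ∈ S) (hq : q ∈ S) (hw : w ∈ Vᗮ)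
    (hw' : w' ∈ V'ᗮ) (hwR : ‖w‖ < R) (hwR' : ‖w'‖ < R) (heq : p + w = q + w') : p = q := by
  have h1 := h.infDist_add_normal hV hp hw hwR
  have h2 := h.infDist_add_normal hV' hq hw' hwR'
  refine (h.unique (p + w) (by rw [h1]; exact hwR)).unique ⟨hp, ?_⟩ ⟨hq, ?_⟩
  · rw [h1, dist_self_add_left]
  · rw [heq, h2, dist_self_add_left]

/-- The converse of `norm_sub_proj_le`: `S` comes quadratically close to each tangent vector. If
not, maximize the excess of the distance over (2/R)‖w‖² on a disc of `T s`. The first-order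
condition there produces normals at `s` and at the nearest point `p` of `s + w`, shorter than the
reach, with the same endpoint; this forces p = s and w = 0. -/
theorem infDist_add_tangent_le (h : UniqueNearest S R) (hT : ∀ p ∈ S, IsTangent S p (T p)) {s u : E}
    (hs : s ∈ S) (hu : u ∈ T s) (huR : ‖u‖ ≤ R / 2) : infDist (s + u) S ≤ 2 / R * ‖u‖ ^ 2 := by
  have hR := h.pos
  obtain ⟨⟨w, hwT⟩, hw, hmax⟩ := (isCompact_closedBall (0 : T s) (R / 2)).exists_isMaxOn
    (nonempty_closedBall.2 (by positivity))
    (f := fun w : T s => infDist (s + w) S - 2 / R * ‖(w : E)‖ ^ 2) (by fun_prop)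
  have hmax' : ∀ y ∈ T s, ‖y‖ ≤ R / 2 →
      infDist (s + y) S - 2 / R * ‖y‖ ^ 2 ≤ infDist (s + w) S - 2 / R * ‖w‖ ^ 2 := fun y hy hyR =>
    hmax (a := ⟨y, hy⟩) (by rw [mem_closedBall_zero_iff]; exact hyR)
  have hwR : ‖w‖ ≤ R / 2 := by rw [mem_closedBall_zero_iff] at hw; exact hw
  by_contra! hcon
  have h1 := hmax' u hu huR
  set δ := infDist (s + w) S with hδ
  have hδw : 2 / R * ‖w‖ ^ 2 < δ := by linarith
  have hδ0 : 0 < δ := lt_of_le_of_lt (by positivity) hδw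
  have hδle : δ ≤ ‖w‖ := by
    refine (infDist_le_dist_of_mem hs).trans ?_
    rw [dist_self_add_left]
  -- The maximum is interior: on the boundary the penalty equals R/2, which the distance to `s` does
  -- not exceed.
  have hwlt : ‖w‖ < R / 2 := by
    refine lt_of_le_of_ne hwR fun heq => ?_
    rw [heq] at hδw hδle
    have : 2 / R * (R / 2) ^ 2 = R / 2 := by field_simp
    linarith
  obtain ⟨p, hp, hxp⟩ := h.exists_nearest (s + w)
  have hper := fun u => @UniqueNearest.infDist_perturb _ _ _ _ S R h (s + w) p hδ0 (by linarith) hp hxp u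
  set y := s + w - p with hy
  have key : ∀ v ∈ T s, ⟪y, v⟫ / δ ≤ 4 / R * ⟪w, v⟫ := by
    intro v hv
    by_contra! hlt
    set θ := (⟪y, v⟫ / δ - 4 / R * ⟪w, v⟫) / 2 with hθ
    have hθ0 : 0 < θ := by linarith
    obtain ⟨t₀, ht₀, hpt⟩ := hper v hθ0
    set t := min t₀ (min ((R / 2 - ‖w‖) / (‖v‖ + 1)) (θ / (2 / R * ‖v‖ ^ 2 + 1)))
    have hlt' : 0 < R / 2 - ‖w‖ := by linarith
    have ht : 0 < t := by positivity
    have ht1 : t * (‖v‖ + 1) ≤ R / 2 - ‖w‖ :=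
      (le_div_iff₀ (by positivity)).1 ((min_le_right _ _).trans (min_le_left _ _))
    have ht2 : t * (2 / R * ‖v‖ ^ 2 + 1) ≤ θ :=
      (le_div_iff₀ (by positivity)).1 ((min_le_right _ _).trans (min_le_right _ _))
    have h2 := hpt t ht (min_le_left _ _)
    have h3 := hmax' (w + t • v) ((T s).add_mem hwT ((T s).smul_mem _ hv)) (by
      refine (norm_add_le _ _).trans ?_
      rw [norm_smul, Real.norm_of_nonneg ht.le]
      linarith)
    rw [← add_assoc, norm_add_sq_real, inner_smul_right, norm_smul, mul_pow, Real.norm_eq_abs,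
      sq_abs] at h3
    rw [← hδ] at h2
    have h4 : t * (t * (2 / R * ‖v‖ ^ 2 + 1)) ≤ t * θ := mul_le_mul_of_nonneg_left ht2 ht.le
    have h5 : t * (⟪y, v⟫ / δ) = t * (4 / R * ⟪w, v⟫) + 2 * (t * θ) := by rw [hθ]; ring
    have h6 : 2 / R * (‖w‖ ^ 2 + 2 * (t * ⟪w, v⟫) + t ^ 2 * ‖v‖ ^ 2)
        = 2 / R * ‖w‖ ^ 2 + t * (4 / R * ⟪w, v⟫) + t * (t * (2 / R * ‖v‖ ^ 2)) := by ring
    have h7 : 0 < t * t := by positivity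
    rw [h6] at h3
    nlinarith
  have hyp : y ∈ (T p)ᗮ := nearest_normal (hT p hp) hxp
  have hynorm : ‖y‖ = δ := by rw [← dist_eq_norm, hxp]
  have hm : δ⁻¹ • y - (4 / R) • w ∈ (T s)ᗮ := by
    rw [Submodule.mem_orthogonal']
    intro v hv
    have e1 : ∀ v, ⟪δ⁻¹ • y - (4 / R) • w, v⟫ = ⟪y, v⟫ / δ - 4 / R * ⟪w, v⟫ := fun v => by
      rw [inner_sub_left, inner_smul_left, inner_smul_left]
      simp [div_eq_inv_mul]
    have h2 := key v hv
    have h3 := key (-v) ((T s).neg_mem hv)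
    rw [inner_neg_right, inner_neg_right, neg_div] at h3
    rw [e1]
    linarith
  -- The first-order condition says that y/δ - (4/R) w is normal at `s`. Multiplying it by R/4 gives
  -- p + (1 - R/(4δ)) y = s - (R/4)(y/δ - (4/R) w), with a normal of length less than R on each
  -- side.
  have hps : p = s := by
    refine h.eq_of_add_normal_eq (hT p hp) (hT s hs) hp hs (w := (1 - R / 4 * δ⁻¹) • y)
      (w' := (-(R / 4)) • (δ⁻¹ • y - (4 / R) • w)) (Submodule.smul_mem _ _ hyp)
      (Submodule.smul_mem _ _ hm) ?_ ?_ ?_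
    · rw [norm_smul, hynorm, Real.norm_eq_abs, ← abs_of_pos hδ0, ← abs_mul, abs_of_pos hδ0]
      have : (1 - R / 4 * δ⁻¹) * δ = δ - R / 4 := by field_simp
      rw [this, abs_lt]
      constructor <;> linarith
    · rw [norm_smul, norm_neg, Real.norm_of_nonneg (by positivity)]
      have h2 := norm_sub_le (δ⁻¹ • y) ((4 / R) • w)
      rw [norm_smul, norm_smul, hynorm, norm_inv, Real.norm_of_nonneg hδ0.le,
        inv_mul_cancel₀ hδ0.ne', Real.norm_of_nonneg (by positivity : 0 ≤ 4 / R)] at h2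
      have h3 : 4 / R * ‖w‖ ≤ 4 / R * (R / 2) := by gcongr
      have h4 : 4 / R * (R / 2) = 2 := by field_simp; norm_num
      have h5 : R / 4 * ‖δ⁻¹ • y - (4 / R) • w‖ ≤ R / 4 * 3 := by gcongr; linarith
      linarith
    · have h2 : (R / 4) • ((4 / R) • w) = w := by
        rw [smul_smul, show R / 4 * (4 / R) = 1 by field_simp, one_smul]
      have h3 : p + y = s + w := by rw [hy]; abel
      rw [neg_smul, smul_sub (R / 4), h2, smul_smul, sub_smul, one_smul, ← add_sub_assoc, h3]
      abel
  have hw0 : w = 0 := by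
    have h2 : y = w := by rw [hy, hps]; abel
    rw [h2, hps] at hyp
    have := (T s).inner_right_of_mem_orthogonal hwT hyp
    exact inner_self_eq_zero.1 this
  rw [hw0, norm_zero] at hδle
  linarith

/-- Follow the tangent vector at `s` for a length `r`: its end is within 2r²/R of a point `p` of
`S`. Since both `s` and `p` are quadratically close to the tangent plane at `q`, so is the vector.
-/
theorem perp_tangent_le (h : UniqueNearest S R) (hT : ∀ p ∈ S, IsTangent S p (T p)) {s q v : E}
    (hs : s ∈ S) (hq : q ∈ S) {r : ℝ} (hr : 0 < r) (hrR : r ≤ R / 4) (hqs : ‖q - s‖ ≤ r)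
    (hv : v ∈ T s) : ‖perp (T q) v‖ ≤ 7 * r / R * ‖v‖ := by
  have hR := h.pos
  rcases eq_or_ne v 0 with rfl | h0
  · simp [perp]
  have hv0 : 0 < ‖v‖ := norm_pos_iff.2 h0
  set u := (r / ‖v‖) • v with hu
  have hun : ‖u‖ = r := by
    rw [hu, norm_smul, Real.norm_of_nonneg (by positivity)]
    field_simp
  have h1 := h.infDist_add_tangent_le hT hs ((T s).smul_mem (r / ‖v‖) hv) (by
    rw [← hu, hun]; linarith)
  rw [← hu, hun] at h1
  obtain ⟨p, hp, hxp⟩ := h.exists_nearest (s + u)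
  rw [← hxp, dist_eq_norm] at h1
  have hrr : r ^ 2 / R ≤ r / 4 := by
    rw [div_le_iff₀ hR]; nlinarith
  have h2 : ‖p - q‖ ≤ 5 / 2 * r := by
    have e1 : p - q = u - (s + u - p) - (q - s) := by abel
    rw [e1]
    have := norm_sub_le (u - (s + u - p)) (q - s)
    have := norm_sub_le u (s + u - p)
    have : 2 / R * r ^ 2 = 2 * (r ^ 2 / R) := by ring
    linarith
  have h3 : ‖perp (T q) (p - q)‖ ≤ 25 / 8 * (r ^ 2 / R) := by
    refine (h.norm_sub_proj_le (hT q hq) hq hp).trans ?_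
    calc ‖p - q‖ ^ 2 / (2 * R) ≤ (5 / 2 * r) ^ 2 / (2 * R) := by gcongr
      _ = _ := by ring
  have h4 : ‖perp (T q) (s - q)‖ ≤ 1 / 2 * (r ^ 2 / R) := by
    refine (h.norm_sub_proj_le (hT q hq) hq hs).trans ?_
    rw [norm_sub_rev]
    calc ‖q - s‖ ^ 2 / (2 * R) ≤ r ^ 2 / (2 * R) := by gcongr
      _ = _ := by ring
  have h5 : ‖perp (T q) (s + u - p)‖ ≤ 2 * (r ^ 2 / R) :=
    (norm_perp_le _ _).trans (h1.trans_eq (by ring))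
  have h6 : ‖perp (T q) u‖ ≤ 7 * (r ^ 2 / R) := by
    have e1 : u = (p - q) - (s - q) + (s + u - p) := by abel
    rw [e1, perp_add, perp_sub]
    have := norm_add_le (perp (T q) (p - q) - perp (T q) (s - q)) (perp (T q) (s + u - p))
    have := norm_sub_le (perp (T q) (p - q)) (perp (T q) (s - q))
    have : 0 ≤ r ^ 2 / R := by positivity
    linarith
  rw [hu, perp_smul, norm_smul, Real.norm_of_nonneg (by positivity)] at h6
  have h7 := mul_le_mul_of_nonneg_left h6 (by positivity : 0 ≤ ‖v‖ / r)
  calc ‖perp (T q) v‖ = ‖v‖ / r * (r / ‖v‖ * ‖perp (T q) v‖) := by field_simp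
    _ ≤ _ := h7
    _ = _ := by field_simp

/-- With `norm_le_two_mul_proj`, this makes the projection of a patch of `S` to a tangent space
bi-Lipschitz. -/
theorem perp_sub_le (h : UniqueNearest S R) (hT : ∀ p ∈ S, IsTangent S p (T p)) {s q q' : E}
    (hs : s ∈ S) (hq : q ∈ S) (hq' : q' ∈ S) {r : ℝ} (hr : 0 < r) (hrR : r ≤ R / 16)
    (hqs : ‖q - s‖ ≤ r) (hqs' : ‖q' - s‖ ≤ r) :
    ‖perp (T s) (q' - q)‖ ≤ ‖q' - q‖ / 2 := by
  have hR := h.pos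
  set w := q' - q with hw
  have hwr : ‖w‖ ≤ 2 * r := by
    have e1 : w = (q' - s) - (q - s) := by rw [hw]; abel
    rw [e1]
    linarith [norm_sub_le (q' - s) (q - s)]
  have h1 : ‖perp (T q) w‖ ≤ r / R * ‖w‖ := by
    refine (h.norm_sub_proj_le (hT q hq) hq hq').trans ?_
    rw [← hw, div_le_iff₀ (by positivity)]
    have : r / R * ‖w‖ * (2 * R) = 2 * r * ‖w‖ := by field_simp
    rw [this]
    nlinarith [norm_nonneg w]
  have h2 := h.perp_tangent_le hT hq hs hr (by linarith) (by rwa [norm_sub_rev])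
    ((T q).starProjection_apply_mem w)
  have h3 := (T q).norm_starProjection_apply_le w
  have h4 : w = perp (T q) w + (T q).starProjection w := by rw [perp]; abel
  have h5 : ‖perp (T s) w‖ ≤ r / R * ‖w‖ + 7 * r / R * ‖w‖ := by
    conv_lhs => rw [h4, perp_add]
    refine (norm_add_le _ _).trans (add_le_add ((norm_perp_le _ _).trans h1) (h2.trans ?_))
    gcongr
  have h6 : r / R ≤ 1 / 16 := by rw [div_le_iff₀ hR]; linarith
  have h7 : r / R * ‖w‖ + 7 * r / R * ‖w‖ = r / R * (8 * ‖w‖) := by ring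
  have h8 : r / R * (8 * ‖w‖) ≤ 1 / 16 * (8 * ‖w‖) := by gcongr
  linarith

/-- The projection of a patch covers a disc. Minimize the distance from the projected patch to `u`:
if the error `e` is nonzero at the minimizer `q`, moving in `S` along minus the projection of `e` to
the tangent space at `q` decreases it, because the two tangent spaces are close. -/
theorem exists_proj_eq (h : UniqueNearest S R) (hT : ∀ p ∈ S, IsTangent S p (T p)) {s u : E}
    (hs : s ∈ S) {r : ℝ} (hr : 0 < r) (hrR : r ≤ R / 16) (hu : u ∈ T s) (hur : ‖u‖ < r / 4) :
    ∃ q ∈ S, ‖q - s‖ ≤ r ∧ (T s).starProjection (q - s) = u := by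
  have hR := h.pos
  set P := (T s).starProjection with hP
  obtain ⟨q, ⟨hq, hqr⟩, hmin⟩ := ((isCompact_closedBall s r).inter_left h.closed).exists_isMinOn
    ⟨s, hs, mem_closedBall_self hr.le⟩ (f := fun q => ‖P (q - s) - u‖) (by fun_prop)
  have hmin' : ∀ y ∈ S, ‖y - s‖ ≤ r → ‖P (q - s) - u‖ ≤ ‖P (y - s) - u‖ := fun y hy hyr =>
    hmin ⟨hy, by rwa [mem_closedBall, dist_eq_norm]⟩
  rw [mem_closedBall, dist_eq_norm] at hqr
  refine ⟨q, hq, hqr, ?_⟩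
  rw [← sub_eq_zero]
  by_contra hne
  set e := P (q - s) - u with he
  have he0 : 0 < ‖e‖ := norm_pos_iff.2 hne
  have heT : e ∈ T s := (T s).sub_mem ((T s).starProjection_apply_mem _) hu
  have heu : ‖e‖ ≤ ‖u‖ := by
    have := hmin' s hs (by simp [hr.le])
    simpa using this
  -- At the rim of the patch the projection has norm at least r/2, but it is `e + u`, of norm at
  -- most 2‖u‖ < r/2.
  have hqlt : ‖q - s‖ < r := by
    refine lt_of_le_of_ne hqr fun heq => ?_
    have h1 := norm_le_two_mul_proj (h.perp_sub_le hT hs hs hq hr hrR (by simp [hr.le]) hqr)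
    have h2 : P (q - s) = e + u := by rw [he]; abel
    rw [← hP, h2, heq] at h1
    linarith [norm_add_le e u]
  have h1 := h.perp_tangent_le hT hs hq hr (by linarith) hqr heT
  have h2 : ‖perp (T q) e‖ ≤ ‖e‖ / 2 := by
    refine h1.trans ?_
    have : 7 * r / R ≤ 1 / 2 := by rw [div_le_iff₀ hR]; linarith
    nlinarith
  set τ := (T q).starProjection e with hτ
  obtain ⟨t₀, ht₀, happ⟩ := (hT q hq).approx (-τ) ((T q).neg_mem ((T q).starProjection_apply_mem e))
    (‖e‖ / 4) (by positivity)
  set L := ‖τ‖ + ‖e‖ / 4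
  have hL : 0 < L := by positivity
  have hlt' : 0 < r - ‖q - s‖ := by linarith
  set t := min t₀ (min 1 ((r - ‖q - s‖) / L))
  have ht : 0 < t := by positivity
  have ht1 : t ≤ 1 := (min_le_right _ _).trans (min_le_left _ _)
  have ht2 : t * L ≤ r - ‖q - s‖ :=
    (le_div_iff₀ hL).1 ((min_le_right _ _).trans (min_le_right _ _))
  obtain ⟨y, hy, hyq⟩ := happ t ht (min_le_left _ _)
  set m := y - q - t • -τ with hm
  have e1 : y - s = (q - s) - t • τ + m := by rw [hm, smul_neg]; abel
  have h3 := hmin' y hy (by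
    rw [e1]
    have := norm_add_le ((q - s) - t • τ) m
    have := norm_sub_le (q - s) (t • τ)
    rw [norm_smul, Real.norm_of_nonneg ht.le] at this
    have : t * L = t * ‖τ‖ + ‖e‖ / 4 * t := by ring
    linarith)
  have e2 : P (y - s) - u = P ((1 - t) • e + t • perp (T q) e + m) := by
    have e3 : P e = e := (T s).starProjection_eq_self_iff.2 heT
    have e4 : P (q - s) = e + u := by rw [he]; abel
    rw [e1, map_add, map_sub, e4, perp, ← hτ]
    simp only [map_add, map_sub, map_smul, e3, smul_sub, sub_smul, one_smul]
    abel
  have h4 : ‖P (y - s) - u‖ ≤ (1 - t) * ‖e‖ + t * (‖e‖ / 2) + ‖e‖ / 4 * t := by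
    rw [e2]
    refine ((T s).norm_starProjection_apply_le _).trans ?_
    refine (norm_add_le _ _).trans (add_le_add ((norm_add_le _ _).trans (add_le_add ?_ ?_)) hyq)
    · rw [norm_smul, Real.norm_of_nonneg (by linarith)]
    · rw [norm_smul, Real.norm_of_nonneg ht.le]
      gcongr
  have : 0 < t * ‖e‖ := by positivity
  linarith

end UniqueNearest

end Reach2

/-! ### Tangent spaces from C² charts -/

section Charts

open Metric
open scoped RealInnerProductSpace Topology

theorem exists_quadratic_remainder {E F : Type*} [NormedAddCommGroup E] [NormedSpace ℝ E]
    [NormedAddCommGroup F] [NormedSpace ℝ F] {f : E → F} {p : E} (hf : ContDiffAt ℝ 2 f p) :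
    ∃ C > 0, ∃ r > 0, ∀ q, ‖q - p‖ < r → ‖f q - f p - fderiv ℝ f p (q - p)‖ ≤ C * ‖q - p‖ ^ 2 := by
  have h1 : ContDiffAt ℝ 1 (fderiv ℝ f) p := hf.fderiv_right (by norm_num)
  obtain ⟨K, t, ht, hK⟩ := h1.exists_lipschitzOnWith
  have h2 : ∀ᶠ x in 𝓝 p, DifferentiableAt ℝ f x :=
    (hf.eventually (by simp)).mono fun x hx => hx.differentiableAt (by simp)
  obtain ⟨r, hr, hball⟩ := Metric.mem_nhds_iff.1 (Filter.inter_mem ht h2)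
  refine ⟨K + 1, by positivity, r, hr, fun q hq => ?_⟩
  have hsub : closedBall p ‖q - p‖ ⊆ ball p r := closedBall_subset_ball hq
  have hpt : p ∈ t := (hball (mem_ball_self hr)).1
  have h3 := (convex_closedBall p ‖q - p‖).norm_image_sub_le_of_norm_fderiv_le' (𝕜 := ℝ) (f := f)
    (φ := fderiv ℝ f p) (C := K * ‖q - p‖) (x := p) (y := q)
    (fun x hx => (hball (hsub hx)).2) (fun x hx => by
      have := hK.dist_le_mul x (hball (hsub hx)).1 p hpt
      rw [dist_eq_norm] at this
      refine this.trans ?_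
      gcongr
      exact hx)
    (mem_closedBall_self (norm_nonneg _)) (by rw [mem_closedBall, dist_eq_norm])
  refine h3.trans ?_
  rw [mul_assoc, ← sq]
  gcongr
  linarith

/-- The subspace `ℝ^d × {0}` of `ℝ^D`. -/
def coordSubspace (D d : ℕ) : Submodule ℝ (Space D) where
  carrier := {w | ∀ i : Fin D, d ≤ (i : ℕ) → w i = 0}
  add_mem' ha hb i hi := by simp [ha i hi, hb i hi]
  zero_mem' i _ := by simp
  smul_mem' c a ha i hi := by simp [ha i hi]

theorem finrank_coordSubspace {D d : ℕ} (hd : d ≤ D) :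
    Module.finrank ℝ (coordSubspace D d) = d := by
  let e : coordSubspace D d ≃ₗ[ℝ] (Fin d → ℝ) :=
    { toFun := fun w j => w.1 (Fin.castLE hd j)
      map_add' := fun a b => by ext; simp
      map_smul' := fun c a => by ext; simp
      invFun := fun f => ⟨WithLp.toLp 2 fun i => if h : (i : ℕ) < d then f ⟨i, h⟩ else 0,
        fun i hi => by simp [not_lt.2 hi]⟩
      left_inv := fun w => by
        ext i
        by_cases h : (i : ℕ) < d
        · simp [h]
        · simp [h, w.2 i (not_lt.1 h)]
      right_inv := fun f => by ext j; simp }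
  rw [e.finrank_eq, Module.finrank_fin_fun]

/-- The tangent space is the preimage of the coordinate subspace under the derivative of the chart.
Quadratic contact is Taylor's formula at order two for the chart, and tangent vectors are velocities
of curves pulled back from straight lines in the coordinate subspace. -/
theorem IsC2Submanifold.exists_tangent {D d : ℕ} (hd : d ≤ D) {S : Set (Space D)}
    (hS : IsC2Submanifold d S) {p : Space D} (hp : p ∈ S) :
    ∃ T : Submodule ℝ (Space D), IsTangent S p T ∧ Module.finrank ℝ T = d := by
  obtain ⟨Φ, hpΦ, hc, hcs, hΦ⟩ := hS p hp
  have hΦp : Φ p ∈ Φ.target := Φ.map_source hpΦ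
  have hc' : ContDiffAt ℝ 2 Φ p := hc.contDiffAt (Φ.open_source.mem_nhds hpΦ)
  have hcs' : ContDiffAt ℝ 2 Φ.symm (Φ p) := hcs.contDiffAt (Φ.open_target.mem_nhds hΦp)
  set A := fderiv ℝ Φ p with hA
  set B := fderiv ℝ Φ.symm (Φ p) with hB
  have hAd : HasFDerivAt Φ A p := (hc'.differentiableAt (by simp)).hasFDerivAt
  have hBd : HasFDerivAt Φ.symm B (Φ p) := (hcs'.differentiableAt (by simp)).hasFDerivAt
  have hBA : B.comp A = ContinuousLinearMap.id ℝ _ := by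
    have h1 : HasFDerivAt (Φ.symm ∘ Φ) (B.comp A) p := hBd.comp p hAd
    have h2 : HasFDerivAt (Φ.symm ∘ Φ) (ContinuousLinearMap.id ℝ _) p :=
      (hasFDerivAt_id p).congr_of_eventuallyEq (by
        filter_upwards [Φ.open_source.mem_nhds hpΦ] with x hx
        exact Φ.left_inv hx)
    exact h1.unique h2
  have hBA' : ∀ v, B (A v) = v := fun v => by
    rw [← ContinuousLinearMap.comp_apply, hBA]; rfl
  have hinj : Function.Injective (A : Space D →ₗ[ℝ] Space D) :=
    Function.LeftInverse.injective (g := B) hBA'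
  set A' := LinearEquiv.ofInjectiveEndo (A : Space D →ₗ[ℝ] Space D) hinj with hA'
  have hAA' : ∀ v, A' v = A v := fun v => rfl
  have hAB : ∀ w, A (B w) = w := fun w => by
    obtain ⟨v, rfl⟩ := A'.surjective w
    rw [hAA', hBA']
  set W := coordSubspace D d with hW
  have hSW : ∀ x ∈ Φ.source, x ∈ S ↔ Φ x ∈ W := hΦ
  have hpW : Φ p ∈ W := (hSW p hpΦ).1 hp
  refine ⟨W.comap (A' : Space D →ₗ[ℝ] Space D), ⟨?_, ?_⟩, ?_⟩
  · obtain ⟨C, hC, r, hr, hrem⟩ := exists_quadratic_remainder hc'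
    obtain ⟨r', hr', hball⟩ := Metric.mem_nhds_iff.1 (Φ.open_source.mem_nhds hpΦ)
    refine ⟨(‖B‖ + 1) * C, by positivity, min r r', lt_min hr hr', fun q hq hqp n hn => ?_⟩
    have hqΦ : q ∈ Φ.source := hball (lt_of_lt_of_le hqp (min_le_right _ _))
    have hqW := (hSW q hqΦ).1 hq
    have h1 := hrem q (by rw [← dist_eq_norm]; exact lt_of_lt_of_le hqp (min_le_left _ _))
    set m := Φ q - Φ p - A (q - p) with hm
    have hT : B (Φ q - Φ p) ∈ W.comap (A' : Space D →ₗ[ℝ] Space D) := by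
      show A (B (Φ q - Φ p)) ∈ W
      rw [hAB]
      exact W.sub_mem hqW hpW
    have h2 : q - p = B (Φ q - Φ p) - B m := by
      rw [← map_sub, hm, sub_sub_cancel, hBA']
    rw [Submodule.mem_orthogonal] at hn
    have h3 : ⟪q - p, n⟫ = -⟪B m, n⟫ := by
      conv_lhs => rw [h2, inner_sub_left, hn _ hT]
      ring
    rw [h3]
    calc -⟪B m, n⟫ ≤ ‖B m‖ * ‖n‖ := by
          have := abs_real_inner_le_norm (B m) n
          linarith [neg_abs_le ⟪B m, n⟫]
      _ ≤ ((‖B‖ + 1) * (C * ‖q - p‖ ^ 2)) * ‖n‖ := by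
          gcongr
          refine (B.le_opNorm m).trans ?_
          gcongr
          linarith
      _ = _ := by ring
  · intro v hv e he
    have hv' : A v ∈ W := hv
    have h1 : HasDerivAt (fun t : ℝ => Φ p + t • A v) (A v) 0 := by
      simpa using ((hasDerivAt_id (0 : ℝ)).smul_const (A v)).const_add (Φ p)
    have h2 : HasDerivAt (fun t : ℝ => Φ.symm (Φ p + t • A v)) v 0 := by
      have hBd' : HasFDerivAt Φ.symm B (Φ p + (0 : ℝ) • A v) := by simpa using hBd
      have := hBd'.comp_hasDerivAt (0 : ℝ) h1
      rwa [hBA'] at this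
    have h3 : ∀ᶠ t : ℝ in 𝓝 0, Φ p + t • A v ∈ Φ.target := by
      have : ContinuousAt (fun t : ℝ => Φ p + t • A v) 0 := h1.continuousAt
      exact this.preimage_mem_nhds (by simpa using Φ.open_target.mem_nhds hΦp)
    have h4 := (hasDerivAt_iff_isLittleO.1 h2).def he
    obtain ⟨t₀, ht₀, hball⟩ := Metric.eventually_nhds_iff.1 (h3.and h4)
    refine ⟨t₀ / 2, by positivity, fun t ht htt => ?_⟩
    obtain ⟨h5, h6⟩ := hball (y := t) (by rw [dist_zero_right, Real.norm_of_nonneg ht.le]; linarith)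
    refine ⟨Φ.symm (Φ p + t • A v), ?_, ?_⟩
    · rw [hSW _ (Φ.map_target h5), Φ.right_inv h5]
      exact W.add_mem hpW (W.smul_mem _ hv')
    · simpa [Φ.left_inv hpΦ, abs_of_pos ht] using h6
  · rw [← finrank_coordSubspace hd]
    exact (A'.ofSubmodule' W).finrank_eq

theorem IsSurface.uniqueNearest {D d : ℕ} {κ : ℝ} (hκ : 0 < κ) {S : Set (Space D)}
    (hS : IsSurface d κ S) : UniqueNearest S (1 / κ) := by
  have key : ∀ x, infDist x S < 1 / κ → ∃! s, s ∈ S ∧ dist x s = infDist x S := by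
    intro x hx
    have h1 : ENNReal.ofReal (infDist x S) < reach S :=
      ((ENNReal.ofReal_lt_ofReal_iff (by positivity)).2 hx).trans_le hS.le_reach
    simp only [reach, lt_iSup_iff] at h1
    obtain ⟨t, ht, hlt⟩ := h1
    refine ht x ?_
    rw [← ENNReal.ofReal_coe_nnreal, ENNReal.ofReal_lt_ofReal_iff'] at hlt
    exact hlt.1
  refine ⟨by positivity, hS.connected.nonempty, ?_, key⟩
  -- A point of the closure has distance 0, less than the reach, hence has a nearest point in `S`,
  -- which is the point itself.
  refine isClosed_of_closure_subset fun x hx => ?_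
  have h0 := (mem_closure_iff_infDist_zero hS.connected.nonempty).1 hx
  obtain ⟨s, ⟨hs, hxs⟩, -⟩ := key x (by rw [h0]; positivity)
  rw [h0, dist_eq_zero] at hxs
  rwa [hxs]

theorem IsSurface.exists_tangents {D d : ℕ} (hd : d ≤ D) {κ : ℝ} {S : Set (Space D)}
    (hS : IsSurface d κ S) :
    ∃ T : Space D → Submodule ℝ (Space D), ∀ p ∈ S, IsTangent S p (T p) ∧
      Module.finrank ℝ (T p) = d := by
  classical
  choose! T hT using fun p (hp : p ∈ S) => hS.submanifold.exists_tangent hd hp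
  exact ⟨T, hT⟩

end Charts

/-! ### Volumes of tubes and of their flat pieces -/

section Tubes

open Metric
open scoped RealInnerProductSpace

theorem finrank_space (D : ℕ) : Module.finrank ℝ (Space D) = D := by simp

/-- The volume of the unit ball of `ℝ^D`. -/
def unitVol (D : ℕ) : ℝ := volume.real (Metric.ball (0 : Space D) 1)

theorem unitVol_pos (D : ℕ) : 0 < unitVol D := volume_real_unit_ball_pos _

namespace UniqueNearest

variable {D d : ℕ} {S : Set (Space D)} {R : ℝ} {T : Space D → Submodule ℝ (Space D)}

/-- The balls of radius `l` about a maximal 2l-separated subset of the patch are disjoint. Its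
projection is a 2l-net of a disc of radius r/4 in the tangent space, so the subset has at least
(r/(8l))^d points. -/
theorem le_volume_patch (h : UniqueNearest S R) (hT : ∀ p ∈ S, IsTangent S p (T p)) {s : Space D}
    (hs : s ∈ S) (hdim : Module.finrank ℝ (T s) = d) (hd : d ≤ D) {r l : ℝ} (hr : 0 < r)
    (hrR : r ≤ R / 16) (hl : 0 < l) {A : Set (Space D)} (hA : volume A ≠ ⊤)
    (hSA : ∀ q ∈ S, ‖q - s‖ ≤ r → ball q l ⊆ A) :
    unitVol D * (1 / 8) ^ d * (r ^ d * l ^ (D - d)) ≤ volume.real A := by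
  classical
  obtain ⟨F, hFP, -, hsep, hcov⟩ := exists_net (P := S ∩ closedBall s r) (h := 2 * l)
    (by positivity) hr.le (x := s) fun y hy => hy.2
  have h1 := sep_volume_le (h := 2 * l) (by positivity) hsep hA (fun y hy => by
    have := hFP hy
    rw [mul_div_cancel_left₀ _ (two_ne_zero)]
    exact hSA y this.1 (by rw [← dist_eq_norm]; exact this.2))
  rw [mul_div_cancel_left₀ _ (two_ne_zero), finrank_space] at h1
  let P : Space D → T s := fun q => ⟨(T s).starProjection (q - s), (T s).starProjection_apply_mem _⟩
  have h2 := cover_volume_le (F := F.image P) (h := 2 * l) (by positivity)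
    (A := ball (0 : T s) (r / 4)) (by
      intro u hu
      rw [mem_ball_zero_iff] at hu
      obtain ⟨q, hq, hqs, hqu⟩ := h.exists_proj_eq hT hs hr hrR u.2 hu
      obtain ⟨z, hz, hqz⟩ := hcov q ⟨hq, by rwa [mem_closedBall, dist_eq_norm]⟩
      refine ⟨P z, Finset.mem_image_of_mem _ hz, lt_of_le_of_lt ?_ hqz⟩
      rw [Subtype.dist_eq, dist_eq_norm, dist_eq_norm, ← hqu]
      show ‖(T s).starProjection (q - s) - (T s).starProjection (z - s)‖ ≤ _
      rw [← map_sub, sub_sub_sub_cancel_right]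
      exact (T s).norm_starProjection_apply_le _)
  rw [volume_real_ball (0 : T s) (by positivity : 0 < r / 4), ← mul_assoc, hdim] at h2
  have h3 := le_of_mul_le_mul_right h2 (volume_real_unit_ball_pos (T s))
  have h4 : (r / 4) ^ d ≤ F.card * (2 * l) ^ d := by
    refine h3.trans ?_
    gcongr
    exact Finset.card_image_le
  have h5 : l ^ D = l ^ d * l ^ (D - d) := by rw [← pow_add, Nat.add_sub_cancel' hd]
  have h6 : (1 / 8) ^ d * r ^ d ≤ F.card * l ^ d := by
    have e1 : (r / 4) ^ d = 2 ^ d * ((1 / 8) ^ d * r ^ d) := by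
      rw [← mul_pow, ← mul_pow]; congr 1; ring
    rw [e1, mul_pow] at h4
    refine le_of_mul_le_mul_left (h4.trans_eq ?_) (by positivity : (0 : ℝ) < 2 ^ d)
    ring
  have hω := unitVol_pos D
  calc _ = ((1 / 8) ^ d * r ^ d) * (l ^ (D - d) * unitVol D) := by ring
    _ ≤ (F.card * l ^ d) * (l ^ (D - d) * unitVol D) := by gcongr
    _ = F.card * (l ^ D * unitVol D) := by rw [h5]; ring
    _ ≤ _ := h1

/-- The neighborhood is covered by balls of radius 2τ about a separated τ-net of `S`. The projection
to one tangent space keeps the net τ/2-separated, so a packing argument in dimension `d` bounds its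
cardinality. -/
theorem volume_neighborhood_le (h : UniqueNearest S R) (hT : ∀ p ∈ S, IsTangent S p (T p))
    (hdim : ∀ p ∈ S, Module.finrank ℝ (T p) = d) (hd : d ≤ D) {r τ : ℝ} (hτ : 0 < τ) (hτr : τ ≤ r)
    (hrR : r ≤ R / 64) (z : Space D) :
    volume.real (ball z r ∩ {x | infDist x S < τ})
      ≤ 17 ^ d * 2 ^ D * unitVol D * (r ^ d * τ ^ (D - d)) := by
  classical
  have hr : 0 < r := hτ.trans_le hτr
  have hω := unitVol_pos D
  have hcl : ∀ x ∈ ball z r ∩ {x | infDist x S < τ}, ∃ s ∈ S, dist x s < τ ∧ dist s z ≤ 2 * r := by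
    rintro x ⟨hx, hxS⟩
    obtain ⟨s, hs, hxs⟩ := (infDist_lt_iff h.nonempty).1 hxS
    refine ⟨s, hs, hxs, ?_⟩
    have := dist_triangle s x z
    rw [mem_ball] at hx
    rw [dist_comm s x] at this
    linarith
  rcases (ball z r ∩ {x | infDist x S < τ}).eq_empty_or_nonempty with h0 | ⟨x₀, hx₀⟩
  · rw [h0, measureReal_empty]; positivity
  obtain ⟨s₀, hs₀, -, hs₀z⟩ := hcl x₀ hx₀
  obtain ⟨F, hFP, -, hsep, hcov⟩ := exists_net (P := S ∩ closedBall s₀ (4 * r)) (h := τ)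
    hτ (by positivity : (0 : ℝ) ≤ 4 * r) (x := s₀) fun y hy => hy.2
  have h1 := cover_volume_le (F := F) (h := 2 * τ) (by positivity)
    (A := ball z r ∩ {x | infDist x S < τ}) (by
      intro x hx
      obtain ⟨s, hs, hxs, hsz⟩ := hcl x hx
      obtain ⟨y, hy, hsy⟩ := hcov s ⟨hs, by
        have := dist_triangle_right s s₀ z
        rw [mem_closedBall]; linarith⟩
      exact ⟨y, hy, by linarith [dist_triangle x s y]⟩)
  let P : Space D → T s₀ := fun q =>
    ⟨(T s₀).starProjection (q - s₀), (T s₀).starProjection_apply_mem _⟩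
  have hP : ∀ a ∈ F, ∀ b ∈ F, a ≠ b → τ / 2 ≤ dist (P a) (P b) := by
    intro a ha b hb hab
    have h2 := hsep a ha b hb hab
    have ha' := hFP ha
    have hb' := hFP hb
    have h3 := norm_le_two_mul_proj (h.perp_sub_le hT hs₀ hb'.1 ha'.1 (r := 4 * r) (by positivity)
      (by linarith) (by rw [← dist_eq_norm]; exact hb'.2) (by rw [← dist_eq_norm]; exact ha'.2))
    have h4 : dist (P a) (P b) = ‖(T s₀).starProjection (a - b)‖ := by
      rw [Subtype.dist_eq, dist_eq_norm]
      show ‖(T s₀).starProjection (a - s₀) - (T s₀).starProjection (b - s₀)‖ = _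
      rw [← map_sub, sub_sub_sub_cancel_right]
    rw [h4]
    rw [dist_eq_norm] at h2
    linarith
  have hinj : Set.InjOn P F := fun a ha b hb hab => by
    by_contra hne
    have := hP a ha b hb hne
    rw [hab, dist_self] at this
    linarith
  have h2 := sep_card_le (F := F.image P) (h := τ / 2) (R := 4 * r) (x := 0) (by positivity)
    (by positivity) (by
      intro a ha b hb hab
      obtain ⟨a, ha', rfl⟩ := Finset.mem_image.1 ha
      obtain ⟨b, hb', rfl⟩ := Finset.mem_image.1 hb
      exact hP a ha' b hb' fun hh => hab (by rw [hh])) (by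
      intro a ha
      obtain ⟨a, ha', rfl⟩ := Finset.mem_image.1 ha
      rw [dist_zero_right]
      refine ((T s₀).norm_starProjection_apply_le _).trans ?_
      rw [← dist_eq_norm]
      exact (hFP ha').2)
  rw [Finset.card_image_of_injOn hinj, hdim s₀ hs₀] at h2
  have hq : 1 ≤ r / τ := by rwa [one_le_div hτ]
  have h3 : (F.card : ℝ) ≤ (17 * (r / τ)) ^ d := by
    refine h2.trans ?_
    gcongr
    have : 2 * (4 * r) / (τ / 2) = 16 * (r / τ) := by field_simp; norm_num
    linarith
  rw [finrank_space] at h1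
  refine h1.trans ?_
  have h5 : τ ^ D = τ ^ d * τ ^ (D - d) := by rw [← pow_add, Nat.add_sub_cancel' hd]
  calc (F.card : ℝ) * ((2 * τ) ^ D * unitVol D)
      ≤ (17 * (r / τ)) ^ d * ((2 * τ) ^ D * unitVol D) := by gcongr
    _ = _ := by rw [mul_pow, mul_pow, h5, div_pow]; field_simp

end UniqueNearest

theorem norm_le_of_mem_cube {D : ℕ} {x : Space D} (hx : x ∈ cube D) : ‖x‖ ≤ D := by
  rcases Nat.eq_zero_or_pos D with rfl | hD
  · have : x = 0 := Subsingleton.elim _ _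
    simp [this]
  have hD' : (1 : ℝ) ≤ D := by exact_mod_cast hD
  rw [EuclideanSpace.norm_eq, Real.sqrt_le_left (by positivity)]
  calc ∑ i, ‖x i‖ ^ 2 ≤ ∑ _i : Fin D, (1 : ℝ) := Finset.sum_le_sum fun i _ => by
        obtain ⟨h1, h2⟩ := hx i
        rw [Real.norm_of_nonneg h1.le]
        exact pow_le_one₀ h1.le h2.le
    _ = D := by simp
    _ ≤ D ^ 2 := by nlinarith

theorem isOpen_cube (D : ℕ) : IsOpen (cube D) := by
  have : cube D = ⋂ i : Fin D, {x : Space D | 0 < x i ∧ x i < 1} := by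
    ext x; simp [cube]
  rw [this]
  refine isOpen_iInter_of_finite fun i => ?_
  have hi : Continuous fun x : Space D => x i := by fun_prop
  exact (isOpen_lt continuous_const hi).inter (isOpen_lt hi continuous_const)

theorem isOpen_tube {D : ℕ} (S : Set (Space D)) (τ : ℝ) : IsOpen (tube S τ) :=
  (isOpen_cube D).inter (isOpen_lt (continuous_infDist_pt S) continuous_const)

theorem volume_cube_lt_top (D : ℕ) : volume (cube D) < ⊤ :=
  (isBounded_closedBall.subset fun x hx => by
    rw [mem_closedBall_zero_iff]; exact norm_le_of_mem_cube hx : Bornology.IsBounded (cube D)).measure_lt_top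

theorem volume_tube_lt_top {D : ℕ} (S : Set (Space D)) (τ : ℝ) : volume (tube S τ) < ⊤ :=
  lt_of_le_of_lt (measure_mono fun _ hx => hx.1) (volume_cube_lt_top D)

/-- Upper bounds for the volumes of tubes, globally and in balls. -/
theorem exists_volume_upper (D d : ℕ) (hd : d ≤ D) {κ : ℝ} (hκ : 1 ≤ κ) :
    ∃ C > 0, ∃ r₁ > 0, ∀ S : Set (Space D), IsSurface d κ S → ∀ τ, 0 < τ →
      (τ ≤ r₁ → volume.real (tube S τ) ≤ C * τ ^ (D - d)) ∧
      ∀ z r, τ ≤ r → r ≤ r₁ →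
        volume.real (ball z r ∩ {x | infDist x S < τ}) ≤ C * (r ^ d * τ ^ (D - d)) := by
  have hκ0 : 0 < κ := by linarith
  have hω := unitVol_pos D
  set r₁ := 1 / κ / 64 with hr₁
  have hr₁0 : 0 < r₁ := by positivity
  set C₀ := 17 ^ d * 2 ^ D * unitVol D
  set n : ℝ := (1 + 2 * D / r₁) ^ D
  refine ⟨C₀ + n * (C₀ * r₁ ^ d), by positivity, r₁, hr₁0, fun S hS τ hτ => ?_⟩
  have hU := hS.uniqueNearest hκ0
  obtain ⟨T, hT⟩ := hS.exists_tangents hd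
  have key : ∀ z r, τ ≤ r → r ≤ r₁ → volume.real (ball z r ∩ {x | infDist x S < τ})
      ≤ C₀ * (r ^ d * τ ^ (D - d)) := fun z r hτr hr =>
    hU.volume_neighborhood_le (fun p hp => (hT p hp).1) (fun p hp => (hT p hp).2) hd hτ hτr hr z
  refine ⟨fun hτr => ?_, fun z r hτr hr => (key z r hτr hr).trans ?_⟩
  · obtain ⟨F, -, hFc, -, hF⟩ := exists_net (P := cube D) hr₁0 (Nat.cast_nonneg D) (x := 0)
      fun y hy => by rw [dist_zero_right]; exact norm_le_of_mem_cube hy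
    rw [finrank_space] at hFc
    have hsub : tube S τ ⊆ ⋃ z ∈ F, (ball z r₁ ∩ {x | infDist x S < τ}) := fun x hx => by
      obtain ⟨z, hz, hxz⟩ := hF x hx.1
      exact Set.mem_biUnion hz ⟨hxz, hx.2⟩
    calc volume.real (tube S τ)
        ≤ volume.real (⋃ z ∈ F, (ball z r₁ ∩ {x | infDist x S < τ})) :=
          measureReal_mono hsub (measure_biUnion_lt_top F.finite_toSet fun z _ =>
            (measure_mono Set.inter_subset_left).trans_lt measure_ball_lt_top).ne
      _ ≤ ∑ z ∈ F, volume.real (ball z r₁ ∩ {x | infDist x S < τ}) :=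
          measureReal_biUnion_finset_le _ _
      _ ≤ ∑ z ∈ F, C₀ * (r₁ ^ d * τ ^ (D - d)) := Finset.sum_le_sum fun z _ => key z r₁ hτr le_rfl
      _ = F.card * (C₀ * (r₁ ^ d * τ ^ (D - d))) := by simp
      _ ≤ n * (C₀ * (r₁ ^ d * τ ^ (D - d))) := by gcongr
      _ ≤ _ := by
        have : 0 ≤ C₀ * τ ^ (D - d) := by positivity
        linarith
  · have hr0 : 0 < r := by linarith
    gcongr
    have : 0 ≤ n * (C₀ * r₁ ^ d) := by positivity
    linarith

/-- A point of a surface can be pushed towards the centre of the cube, together with its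
neighborhood in the surface. -/
theorem exists_inward_shift {D : ℕ} (hD : 1 ≤ D) {S : Set (Space D)} (hS : S ⊆ cube D)
    {s₀ : Space D} {τ : ℝ} (hτ : 0 < τ) (hτ1 : τ ≤ 1 / 4) :
    ∃ w₀ : Space D, ∀ s ∈ S, ‖s - s₀‖ ≤ 1 / 4 → ∀ u : Space D, ‖u‖ < τ / (2 * D) →
      s + w₀ + u ∈ tube S τ := by
  have hD' : (1 : ℝ) ≤ D := by exact_mod_cast hD
  set b := τ / (2 * D) with hb
  have hb0 : 0 < b := by positivity
  have hbD : b * (2 * D) = τ := by rw [hb]; field_simp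
  have hbτ : 2 * b ≤ τ := by nlinarith
  -- Within 1/4 of `s₀` each coordinate keeps a distance of at least 1/4 from the face of the cube
  -- that it is pushed towards. The shift `b` exceeds ‖u‖, so no coordinate crosses the opposite
  -- face; the length of the shift plus `u` stays below τ.
  refine ⟨WithLp.toLp 2 fun i => if s₀ i ≤ 1 / 2 then b else -b, fun s hs hss u hu => ?_⟩
  set w₀ : Space D := WithLp.toLp 2 fun i => if s₀ i ≤ 1 / 2 then b else -b with hw₀
  have hcoord : ∀ (v : Space D) i, |v i| ≤ ‖v‖ := fun v i => by
    rw [← Real.norm_eq_abs]; exact PiLp.norm_apply_le v i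
  refine ⟨fun i => ?_, ?_⟩
  · have h1 := hS hs i
    have h2 := abs_le.1 ((hcoord (s - s₀) i).trans hss)
    have h3 := abs_lt.1 ((hcoord u i).trans_lt hu)
    simp only [PiLp.sub_apply] at h2
    have h4 : w₀ i = if s₀ i ≤ 1 / 2 then b else -b := rfl
    simp only [PiLp.add_apply]
    rw [h4]
    split_ifs with hle
    · constructor <;> linarith
    · constructor <;> linarith
  · refine lt_of_le_of_lt (infDist_le_dist_of_mem hs) ?_
    rw [dist_eq_norm, add_assoc, add_sub_cancel_left]
    have h1 : ‖w₀‖ ≤ b * D := by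
      rw [EuclideanSpace.norm_eq, Real.sqrt_le_left (by positivity)]
      calc ∑ i, ‖w₀ i‖ ^ 2 = ∑ _i : Fin D, b ^ 2 := Finset.sum_congr rfl fun i _ => by
            have h4 : w₀ i = if s₀ i ≤ 1 / 2 then b else -b := rfl
            rw [h4, Real.norm_eq_abs, sq_abs]
            split_ifs <;> ring
        _ = b ^ 2 * D := by simp [mul_comm]
        _ ≤ (b * D) ^ 2 := by
          rw [mul_pow]
          gcongr
          nlinarith
    have := norm_add_le w₀ u
    nlinarith

/-- A part of a tube, of positive proportion, covered by few flat pieces that are not small. -/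
theorem exists_flat_pieces (D d : ℕ) (hD : 1 ≤ D) (hd : d ≤ D) {κ : ℝ} (hκ : 1 ≤ κ) :
    ∃ c > 0, ∃ A > 0, ∀ S : Set (Space D), IsSurface d κ S → ∀ τ ε η : ℝ, 0 < τ → τ ≤ 1 / 4 →
      ε ≤ 1 → 0 < η → η ≤ ε → ε ^ 2 ≤ η → ∃ (G : Set (Space D)) (𝒬 : Finset (Set (Space D))),
        MeasurableSet G ∧ G ⊆ tube S τ ∧ c * τ ^ (D - d) ≤ volume.real G ∧
        (∀ y ∈ G, ∃ Q ∈ 𝒬, y ∈ Q) ∧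
        (𝒬.card : ℝ) ≤ A * ((1 / ε) * (τ / min η τ)) ^ D ∧
        ∀ Q ∈ 𝒬, MeasurableSet Q ∧ Q ⊆ tube S τ ∧
          c * (ε ^ d * min η τ ^ (D - d)) ≤ volume.real Q ∧
          (∀ y ∈ Q, ∀ y' ∈ Q, dist y y' ≤ ε / 2) ∧
          ∃ (a : Space D) (V : Submodule ℝ (Space D)), Module.finrank ℝ V = d ∧
            ∀ y ∈ Q, ∃ v ∈ V, ‖y - a - v‖ ≤ η / 2 := by
  classical
  have hκ0 : 0 < κ := by linarith
  have hω := unitVol_pos D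
  have hD' : (1 : ℝ) ≤ D := by exact_mod_cast hD
  set R := 1 / κ with hR
  have hR0 : 0 < R := by positivity
  set r₀ := min (1 / 8) (R / 16) with hr₀
  have hr₀0 : 0 < r₀ := by positivity
  set c₂ : ℝ := 1 / (8 * D) with hc₂
  have hc₂0 : 0 < c₂ := by positivity
  have hc₂D : c₂ * (8 * D) = 1 := by rw [hc₂]; field_simp
  have hc₂8 : c₂ ≤ 1 / 8 := by nlinarith
  have hr₀8 : r₀ ≤ 1 / 8 := min_le_left _ _
  have hr₀R : r₀ ≤ R / 16 := min_le_right _ _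
  set c := unitVol D * (1 / 8) ^ d * r₀ ^ d * c₂ ^ (D - d) with hc
  refine ⟨c, by positivity, (3 * 5) ^ D, by positivity, ?_⟩
  intro S hS τ ε η hτ hτ4 hε1 hη hηε hεη
  have hε : 0 < ε := hη.trans_le hηε
  have hU := hS.uniqueNearest hκ0
  obtain ⟨T, hT⟩ := hS.exists_tangents hd
  have hT1 : ∀ p ∈ S, IsTangent S p (T p) := fun p hp => (hT p hp).1
  obtain ⟨s₀, hs₀⟩ := hU.nonempty
  obtain ⟨w₀, hw₀⟩ := exists_inward_shift hD hS.subset_cube (s₀ := s₀) hτ hτ4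
  set l := min η τ with hl
  have hl0 : 0 < l := lt_min hη hτ
  have hlη : l ≤ η := min_le_left _ _
  have hlτ : l ≤ τ := min_le_right _ _
  set b := τ / (2 * D) with hb
  have hbτ : c₂ * τ = b / 4 := by rw [hc₂, hb]; field_simp; norm_num
  have hb0 : 0 < b := by positivity
  have hlb : c₂ * l ≤ b / 4 := by rw [← hbτ]; gcongr
  obtain ⟨F₁, hF₁S, hF₁c, -, hF₁⟩ := exists_net (P := S ∩ closedBall s₀ r₀) (h := r₀ * ε)
    (by positivity) hr₀0.le (x := s₀) fun y hy => hy.2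
  obtain ⟨F₂, hF₂S, hF₂c, -, hF₂⟩ := exists_net (E := Space D) (P := closedBall 0 (b / 2))
    (h := c₂ * l) (R := b / 2) (by positivity) (by positivity) (x := 0) fun y hy => hy
  rw [finrank_space] at hF₁c hF₂c
  -- A piece is a thickened small patch of `S` about `z`, translated by the inward shift and by an
  -- offset `w` from a net of the cross section. Translates of patches are as flat as the patches,
  -- which is why the thickness min(η, τ) may be much less than τ.
  let Q : Space D × Space D → Set (Space D) := fun p =>
    ⋃ s ∈ {s | s ∈ S ∧ ‖s - p.1‖ ≤ r₀ * ε}, ball (s + w₀ + p.2) (c₂ * l)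
  have hr₀ε : r₀ * ε ≤ r₀ := by nlinarith
  refine ⟨⋃ s ∈ {s | s ∈ S ∧ ‖s - s₀‖ ≤ r₀}, ball (s + w₀) (b / 2), (F₁ ×ˢ F₂).image Q,
    (isOpen_biUnion fun _ _ => isOpen_ball).measurableSet, ?_, ?_, ?_, ?_, ?_⟩
  · refine Set.iUnion₂_subset fun s hs y hy => ?_
    have := hw₀ s hs.1 (hs.2.trans (by linarith)) (y - (s + w₀)) (by
      rw [← dist_eq_norm]; exact lt_trans hy (by linarith))
    rwa [add_sub_cancel] at this
  · have h1 := hU.le_volume_patch hT1 hs₀ (hT s₀ hs₀).2 hd hr₀0 hr₀R (l := b / 2) (by positivity)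
      (A := (fun y => y + w₀) ⁻¹' (⋃ s ∈ {s | s ∈ S ∧ ‖s - s₀‖ ≤ r₀}, ball (s + w₀) (b / 2)))
      (by
        rw [measure_preimage_add_right]
        refine (((isBounded_closedBall (x := s₀ + w₀) (r := r₀ + b / 2)).subset ?_).measure_lt_top).ne
        refine Set.iUnion₂_subset fun s hs => ball_subset_closedBall.trans
          (closedBall_subset_closedBall' ?_)
        rw [dist_add_right, dist_eq_norm]
        linarith [hs.2])
      (fun q hq hqs y hy => Set.mem_biUnion (show q ∈ {s | s ∈ S ∧ ‖s - s₀‖ ≤ r₀} from ⟨hq, hqs⟩)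
        (by rw [mem_ball, dist_add_right]; exact hy))
    rw [measureReal_def, measure_preimage_add_right, ← measureReal_def] at h1
    refine le_trans ?_ h1
    have e1 : (c₂ * τ) ^ (D - d) ≤ (b / 2) ^ (D - d) := by
      rw [hbτ]; gcongr; norm_num
    calc c * τ ^ (D - d) = unitVol D * (1 / 8) ^ d * (r₀ ^ d * (c₂ * τ) ^ (D - d)) := by
          rw [hc, mul_pow]; ring
      _ ≤ _ := by gcongr
  · intro y hy
    obtain ⟨s, ⟨hs, hss⟩, hys⟩ := Set.mem_iUnion₂.1 hy
    obtain ⟨z, hz, hsz⟩ := hF₁ s ⟨hs, by rwa [mem_closedBall, dist_eq_norm]⟩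
    obtain ⟨w, hw, hyw⟩ := hF₂ (y - (s + w₀)) (by
      rw [mem_closedBall, dist_zero_right, ← dist_eq_norm]; exact (mem_ball.1 hys).le)
    refine ⟨Q (z, w), Finset.mem_image_of_mem _ (Finset.mk_mem_product hz hw), ?_⟩
    refine Set.mem_biUnion (show s ∈ {s | s ∈ S ∧ ‖s - z‖ ≤ r₀ * ε} from
      ⟨hs, by rw [← dist_eq_norm]; exact hsz.le⟩) ?_
    rw [mem_ball, dist_eq_norm, ← sub_sub, ← dist_eq_norm]
    exact hyw
  · calc (((F₁ ×ˢ F₂).image Q).card : ℝ) ≤ (F₁.card * F₂.card : ℕ) := by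
          rw [← Finset.card_product]; exact_mod_cast Finset.card_image_le
      _ = F₁.card * F₂.card := by push_cast; ring
      _ ≤ (1 + 2 * r₀ / (r₀ * ε)) ^ D * (1 + 2 * (b / 2) / (c₂ * l)) ^ D := by gcongr
      _ ≤ (3 * (1 / ε)) ^ D * (5 * (τ / l)) ^ D := by
        have e1 : 2 * r₀ / (r₀ * ε) = 2 * (1 / ε) := by field_simp
        have e2 : 2 * (b / 2) / (c₂ * l) = 4 * (τ / l) := by
          rw [div_eq_iff (by positivity)]
          have : 4 * (τ / l) * (c₂ * l) = 4 * (c₂ * τ) := by field_simp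
          rw [this, hbτ]; ring
        have e3 : 1 ≤ 1 / ε := by rwa [one_le_div hε]
        have e4 : 1 ≤ τ / l := by rwa [one_le_div hl0]
        rw [e1, e2]
        gcongr <;> linarith
      _ = _ := by rw [← mul_pow, ← mul_pow]; congr 1; ring
  · intro Q' hQ'
    obtain ⟨⟨z, w⟩, hzw, rfl⟩ := Finset.mem_image.1 hQ'
    obtain ⟨hz, hw⟩ := Finset.mem_product.1 hzw
    obtain ⟨hzS, hzs₀⟩ := hF₁S hz
    have hwb := hF₂S hw
    simp only at hz hw hzS hzs₀ hwb
    rw [mem_closedBall, dist_eq_norm] at hzs₀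
    rw [mem_closedBall, dist_zero_right] at hwb
    have hmem : ∀ y ∈ Q (z, w), ∃ s ∈ S, ‖s - z‖ ≤ r₀ * ε ∧ ‖y - (s + w₀ + w)‖ < c₂ * l := by
      intro y hy
      obtain ⟨s, ⟨hs, hss⟩, hys⟩ := Set.mem_iUnion₂.1 hy
      exact ⟨s, hs, hss, by rw [← dist_eq_norm]; exact hys⟩
    have hc₂l : c₂ * l ≤ ε / 8 := by
      calc c₂ * l ≤ 1 / 8 * ε := by gcongr; exact hlη.trans hηε
        _ = _ := by ring
    have hr₀ε8 : r₀ * ε ≤ ε / 8 := by nlinarith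
    refine ⟨(isOpen_biUnion fun _ _ => isOpen_ball).measurableSet, ?_, ?_, ?_, ?_⟩
    · intro y hy
      obtain ⟨s, hs, hsz, hys⟩ := hmem y hy
      have := hw₀ s hs (by
        have e1 : s - s₀ = (s - z) + (z - s₀) := by abel
        rw [e1]
        linarith [norm_add_le (s - z) (z - s₀)]) (w + (y - (s + w₀ + w))) (by
        refine (norm_add_le _ _).trans_lt ?_
        linarith)
      rwa [← add_assoc, add_sub_cancel] at this
    · have h1 := hU.le_volume_patch hT1 hzS (hT z hzS).2 hd (r := r₀ * ε) (by positivity)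
        (hr₀ε.trans hr₀R) (l := c₂ * l) (by positivity)
        (A := (fun y => y + (w₀ + w)) ⁻¹' Q (z, w))
        (by
          rw [measure_preimage_add_right]
          refine (((isBounded_closedBall (x := z + w₀ + w) (r := r₀ * ε + c₂ * l)).subset
            ?_).measure_lt_top).ne
          refine Set.iUnion₂_subset fun s hs => ball_subset_closedBall.trans
            (closedBall_subset_closedBall' ?_)
          rw [dist_add_right, dist_add_right, dist_eq_norm]
          linarith [hs.2])
        (fun q hq hqs y hy => Set.mem_biUnion
          (show q ∈ {s | s ∈ S ∧ ‖s - z‖ ≤ r₀ * ε} from ⟨hq, hqs⟩)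
          (by rw [mem_ball, add_assoc, dist_add_right]; exact hy))
      rw [measureReal_def, measure_preimage_add_right, ← measureReal_def] at h1
      refine le_trans (le_of_eq ?_) h1
      rw [hc, mul_pow, mul_pow]; ring
    · intro y hy y' hy'
      obtain ⟨s, hs, hsz, hys⟩ := hmem y hy
      obtain ⟨s', hs', hsz', hys'⟩ := hmem y' hy'
      rw [dist_eq_norm]
      have e1 : y - y' = ((y - (s + w₀ + w)) - (y' - (s' + w₀ + w))) + ((s - z) - (s' - z)) := by abel
      rw [e1]
      have := norm_add_le ((y - (s + w₀ + w)) - (y' - (s' + w₀ + w))) ((s - z) - (s' - z))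
      have := norm_sub_le (y - (s + w₀ + w)) (y' - (s' + w₀ + w))
      have := norm_sub_le (s - z) (s' - z)
      linarith
    · refine ⟨z + w₀ + w, T z, (hT z hzS).2, fun y hy => ?_⟩
      obtain ⟨s, hs, hsz, hys⟩ := hmem y hy
      refine ⟨(T z).starProjection (s - z), (T z).starProjection_apply_mem _, ?_⟩
      have e1 : y - (z + w₀ + w) - (T z).starProjection (s - z)
          = (y - (s + w₀ + w)) + ((s - z) - (T z).starProjection (s - z)) := by abel
      rw [e1]
      have h1 := norm_add_le (y - (s + w₀ + w)) ((s - z) - (T z).starProjection (s - z))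
      have h2 := hU.norm_sub_proj_le (hT1 z hzS) hzS hs
      -- The curvature of `S` over a distance ε is invisible at resolution η exactly because ε² ≤ η.
      have h3 : ‖s - z‖ ^ 2 / (2 * R) ≤ η / 8 := by
        rw [div_le_iff₀ (by positivity)]
        calc ‖s - z‖ ^ 2 ≤ (r₀ * ε) ^ 2 := by gcongr
          _ = r₀ * r₀ * ε ^ 2 := by ring
          _ ≤ 1 / 8 * (R / 16) * η := by gcongr
          _ ≤ _ := by nlinarith [mul_pos hR0 hη]
      have h4 : c₂ * l ≤ 1 / 8 * η := by gcongr
      linarith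

end Tubes

/-! ### Finite nets of affine subspaces -/

section Nets

open Metric

/-- A finite family of affine subspaces approximating all `d`-dimensional ones in the cube. -/
theorem exists_plane_net (D d : ℕ) : ∃ A ≥ (1 : ℝ), ∀ η : ℝ, 0 < η → η ≤ 1 →
    ∃ 𝓛 : Finset (Space D × Submodule ℝ (Space D)),
      (𝓛.card : ℝ) ≤ (A / η) ^ (D * (d + 1)) ∧ (∀ p ∈ 𝓛, Module.finrank ℝ p.2 ≤ d) ∧
      ∀ L : AffineSubspace ℝ (Space D), Module.finrank ℝ L.direction = d →
        (L : Set (Space D)).Nonempty → ∀ X ⊆ cube D, X.Nonempty →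
        (∀ x ∈ X, infDist x (L : Set (Space D)) < η) →
        ∃ p ∈ 𝓛, ∀ x ∈ X, ∃ v ∈ p.2, ‖x - p.1 - v‖ < 2 * η := by
  classical
  set B : ℝ := 1 + d * (2 * D + 2) with hB
  have hB1 : 1 ≤ B := by rw [hB]; have : (0 : ℝ) ≤ d * (2 * D + 2) := by positivity
                         linarith
  refine ⟨1 + 2 * (D + 1) * B, by
    have : (0 : ℝ) ≤ 2 * (D + 1) * B := by positivity
    linarith, fun η hη hη1 => ?_⟩
  set θ := η / B with hθ
  have hθ0 : 0 < θ := by positivity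
  have hθB : θ * B = η := by rw [hθ]; field_simp
  obtain ⟨F, -, hFc, -, hF⟩ := exists_net (E := Space D) (P := closedBall 0 (D + 1)) hθ0
    (by positivity : (0 : ℝ) ≤ D + 1) (x := 0) fun y hy => hy
  rw [finrank_space] at hFc
  -- A plane is encoded by a base point and `d` vectors approximating an orthonormal basis of its
  -- direction, whence the exponent D(d + 1). The approximating vectors may be dependent, so only an
  -- upper bound on the dimension survives.
  refine ⟨(F ×ˢ Fintype.piFinset fun _ : Fin d => F).image
    fun p => (p.1, Submodule.span ℝ (Set.range p.2)), ?_, ?_, ?_⟩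
  · calc _ ≤ ((F ×ˢ Fintype.piFinset fun _ : Fin d => F).card : ℝ) := by
          exact_mod_cast Finset.card_image_le
      _ = (F.card : ℝ) ^ (d + 1) := by
          rw [Finset.card_product, Fintype.card_piFinset]
          simp [pow_succ, mul_comm]
      _ ≤ ((1 + 2 * (D + 1) / θ) ^ D) ^ (d + 1) := by gcongr
      _ = (1 + 2 * (D + 1) / θ) ^ (D * (d + 1)) := by rw [pow_mul]
      _ ≤ _ := by
        gcongr
        have : 2 * ((D : ℝ) + 1) / θ = 2 * (D + 1) * B / η := by rw [hθ]; field_simp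
        rw [this, add_div]
        gcongr
        rwa [one_le_div hη]
  · intro p hp
    obtain ⟨q, -, rfl⟩ := Finset.mem_image.1 hp
    exact (finrank_range_le_card (R := ℝ) q.2).trans_eq (Fintype.card_fin d)
  · rintro L hL hLne X hX ⟨x₀, hx₀⟩ hXL
    have hnear : ∀ x ∈ X, ∃ l ∈ L, ‖x - l‖ < η := fun x hx => by
      obtain ⟨l, hl, hxl⟩ := (infDist_lt_iff hLne).1 (hXL x hx)
      exact ⟨l, hl, by rwa [← dist_eq_norm]⟩
    obtain ⟨a₀, ha₀, hxa₀⟩ := hnear x₀ hx₀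
    have ha₀n : ‖a₀‖ ≤ D + 1 := by
      have h1 := norm_le_of_mem_cube (hX hx₀)
      have h2 := norm_sub_norm_le a₀ x₀
      rw [norm_sub_rev] at h2
      linarith
    let b := (stdOrthonormalBasis ℝ L.direction).reindex (finCongr hL)
    obtain ⟨a, ha, haa⟩ := hF a₀ (by rwa [mem_closedBall, dist_zero_right])
    have hbn : ∀ j, ‖(b j : Space D)‖ = 1 := fun j => b.orthonormal.1 j
    choose w hw hbw using fun j => hF (b j : Space D) (by
      rw [mem_closedBall, dist_zero_right, hbn]
      linarith [(Nat.cast_nonneg D : (0 : ℝ) ≤ D)])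
    refine ⟨(a, Submodule.span ℝ (Set.range w)), Finset.mem_image.2 ⟨(a, w),
      Finset.mk_mem_product ha (Fintype.mem_piFinset.2 hw), rfl⟩, fun x hx => ?_⟩
    obtain ⟨l, hl, hxl⟩ := hnear x hx
    let u : L.direction := ⟨l - a₀, AffineSubspace.vsub_mem_direction hl ha₀⟩
    have hun : ‖u‖ ≤ 2 * D + 2 := by
      show ‖l - a₀‖ ≤ _
      have h1 := norm_le_of_mem_cube (hX hx)
      have h2 := norm_sub_norm_le l x
      rw [norm_sub_rev] at h2
      linarith [norm_sub_le l a₀]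
    have hsum : l - a₀ = ∑ j, b.repr u j • (b j : Space D) := by
      have := congrArg (Subtype.val : L.direction → Space D) (b.sum_repr u)
      rw [← show (u : Space D) = l - a₀ from rfl, ← this]
      simp
    have ht : ∀ j, |b.repr u j| ≤ 2 * D + 2 := fun j => by
      rw [← Real.norm_eq_abs]
      refine (PiLp.norm_apply_le (b.repr u) j).trans ?_
      rw [b.repr.norm_map]
      exact hun
    refine ⟨∑ j, b.repr u j • w j, Submodule.sum_mem _ fun j _ =>
      Submodule.smul_mem _ _ (Submodule.subset_span ⟨j, rfl⟩), ?_⟩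
    have e1 : x - a - ∑ j, b.repr u j • w j
        = (x - l) + (a₀ - a) + ∑ j, b.repr u j • ((b j : Space D) - w j) := by
      have : ∑ j, b.repr u j • ((b j : Space D) - w j) = (l - a₀) - ∑ j, b.repr u j • w j := by
        rw [hsum, ← Finset.sum_sub_distrib]
        simp only [smul_sub]
      rw [this]; abel
    show ‖x - a - ∑ j, b.repr u j • w j‖ < _
    rw [e1]
    have h1 : ‖∑ j, b.repr u j • ((b j : Space D) - w j)‖ ≤ d * ((2 * D + 2) * θ) := by
      refine (norm_sum_le _ _).trans ?_
      calc ∑ j, ‖b.repr u j • ((b j : Space D) - w j)‖ ≤ ∑ _j : Fin d, (2 * (D : ℝ) + 2) * θ :=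
            Finset.sum_le_sum fun j _ => by
              rw [norm_smul, Real.norm_eq_abs]
              have := (hbw j).le
              rw [dist_eq_norm] at this
              gcongr
              exact ht j
        _ = _ := by simp
    have h2 := norm_add_le ((x - l) + (a₀ - a)) (∑ j, b.repr u j • ((b j : Space D) - w j))
    have h3 := norm_add_le (x - l) (a₀ - a)
    rw [dist_eq_norm] at haa
    have h4 : θ + d * ((2 * D + 2) * θ) = η := by rw [← hθB, hB]; ring
    linarith

end Nets

/-! ### Chernoff bounds for counts of independent points -/

section Concentration

open ProbabilityTheory

variable {E : Type*} [MeasurableSpace E] {N : ℕ}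

open Classical in
/-- The number of points in `A` with index in `I`. -/
def cnt (I : Finset (Fin N)) (A : Set E) (x : Fin N → E) : ℕ := (I.filter fun i => x i ∈ A).card

omit [MeasurableSpace E] in
open Classical in
theorem cnt_eq_sum (I : Finset (Fin N)) (A : Set E) (x : Fin N → E) :
    (cnt I A x : ℝ) = ∑ i, if i ∈ I then A.indicator (fun _ => (1 : ℝ)) (x i) else 0 := by
  rw [cnt, Finset.card_filter, Nat.cast_sum, Finset.sum_ite_mem, Finset.univ_inter]
  refine Finset.sum_congr rfl fun i _ => ?_
  by_cases h : x i ∈ A <;> simp [h]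

variable (μ : Fin N → Measure E) [∀ i, IsProbabilityMeasure (μ i)]

theorem measurable_cnt (I : Finset (Fin N)) {A : Set E} (hA : MeasurableSet A) :
    Measurable fun x : Fin N → E => (cnt I A x : ℝ) := by
  classical
  simp only [cnt_eq_sum]
  refine Finset.measurable_sum _ fun i _ => ?_
  split_ifs
  · exact (measurable_const.indicator hA).comp (measurable_pi_apply i)
  · exact measurable_const

/-- Comparison with a Poisson variable: independence factors the moment generating function, and 1 +
x ≤ e^x on each factor. -/
theorem mgf_cnt_le (I : Finset (Fin N)) {A : Set E} (hA : MeasurableSet A) (t : ℝ) :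
    mgf (fun x : Fin N → E => (cnt I A x : ℝ)) (Measure.pi μ) t
      ≤ Real.exp ((Real.exp t - 1) * ∑ i ∈ I, (μ i).real A) := by
  classical
  let f : Fin N → E → ℝ := fun i y => if i ∈ I then A.indicator (fun _ => (1 : ℝ)) y else 0
  have h1 : ∀ x : Fin N → E, Real.exp (t * (cnt I A x : ℝ)) = ∏ i, Real.exp (t * f i (x i)) := by
    intro x
    rw [cnt_eq_sum, Finset.mul_sum, Real.exp_sum]
  have h2 : ∀ i, ∫ y, Real.exp (t * f i y) ∂(μ i)
      ≤ Real.exp (if i ∈ I then (Real.exp t - 1) * (μ i).real A else 0) := by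
    intro i
    by_cases hi : i ∈ I
    · have e1 : (fun y => Real.exp (t * f i y))
          = fun y => 1 + A.indicator (fun _ => Real.exp t - 1) y := by
        funext y
        by_cases hy : y ∈ A <;> simp [f, hi, hy]
      rw [e1, integral_add (integrable_const _) ((integrable_const _).indicator hA),
        integral_indicator_const _ hA]
      simp only [integral_const, probReal_univ, smul_eq_mul, one_mul, if_pos hi]
      rw [add_comm, mul_comm]
      exact Real.add_one_le_exp _
    · simp [f, hi]
  calc mgf (fun x : Fin N → E => (cnt I A x : ℝ)) (Measure.pi μ) t
      = ∏ i, ∫ y, Real.exp (t * f i y) ∂(μ i) := by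
        rw [mgf, ← integral_fintype_prod_eq_prod]
        exact integral_congr_ae (ae_of_all _ h1)
    _ ≤ ∏ i, Real.exp (if i ∈ I then (Real.exp t - 1) * (μ i).real A else 0) :=
        Finset.prod_le_prod (fun i _ => integral_nonneg fun _ => (Real.exp_pos _).le)
          fun i _ => h2 i
    _ = _ := by
        rw [← Real.exp_sum, Finset.sum_ite_mem, Finset.univ_inter, Finset.mul_sum]

omit [MeasurableSpace E] in
theorem cnt_le_card (I : Finset (Fin N)) (A : Set E) (x : Fin N → E) : cnt I A x ≤ I.card := by
  classical
  exact Finset.card_filter_le _ _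

theorem integrable_exp_cnt (I : Finset (Fin N)) {A : Set E} (hA : MeasurableSet A) (t : ℝ) :
    Integrable (fun x : Fin N → E => Real.exp (t * (cnt I A x : ℝ))) (Measure.pi μ) := by
  refine Integrable.of_bound (C := Real.exp (|t| * I.card))
    ((measurable_cnt I hA).const_mul t).exp.aestronglyMeasurable (ae_of_all _ fun x => ?_)
  rw [Real.norm_of_nonneg (Real.exp_pos _).le, Real.exp_le_exp]
  refine (le_abs_self _).trans ?_
  rw [abs_mul, Nat.abs_cast]
  gcongr
  exact cnt_le_card _ _ _

/-- Chernoff's bound at parameter 1: the exponent -3b + (e - 1)b is at most -b since e < 3. -/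
theorem measure_cnt_ge_le (I : Finset (Fin N)) {A : Set E} (hA : MeasurableSet A) {b : ℝ}
    (hb : ∑ i ∈ I, (μ i).real A ≤ b) :
    Measure.pi μ {x | 3 * b ≤ cnt I A x} ≤ ENNReal.ofReal (Real.exp (-b)) := by
  rw [← ofReal_measureReal, ENNReal.ofReal_le_ofReal_iff (Real.exp_pos _).le]
  have h0 : 0 ≤ ∑ i ∈ I, (μ i).real A := Finset.sum_nonneg fun i _ => measureReal_nonneg
  have h1 := measure_ge_le_exp_mul_mgf (μ := Measure.pi μ) (X := fun x => (cnt I A x : ℝ)) (3 * b)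
    zero_le_one (integrable_exp_cnt μ I hA 1)
  refine h1.trans ?_
  have h2 := mgf_cnt_le μ I hA 1
  calc _ ≤ Real.exp (-1 * (3 * b)) * Real.exp ((Real.exp 1 - 1) * ∑ i ∈ I, (μ i).real A) := by
        gcongr
    _ ≤ _ := by
      rw [← Real.exp_add, Real.exp_le_exp]
      have : Real.exp 1 < 3 := lt_trans Real.exp_one_lt_d9 (by norm_num)
      nlinarith

/-- Chernoff's bound at parameter -1: since 1/e ≤ 1/2, the exponent is at most b/4 - b/2. -/
theorem measure_cnt_le_le (I : Finset (Fin N)) {A : Set E} (hA : MeasurableSet A) {b : ℝ}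
    (hb : b ≤ ∑ i ∈ I, (μ i).real A) (hb0 : 0 ≤ b) :
    Measure.pi μ {x | (cnt I A x : ℝ) ≤ b / 4} ≤ ENNReal.ofReal (Real.exp (-(b / 4))) := by
  rw [← ofReal_measureReal, ENNReal.ofReal_le_ofReal_iff (Real.exp_pos _).le]
  have h1 := measure_le_le_exp_mul_mgf (μ := Measure.pi μ) (X := fun x => (cnt I A x : ℝ)) (b / 4)
    (by norm_num : (-1 : ℝ) ≤ 0) (integrable_exp_cnt μ I hA (-1))
  refine h1.trans ?_
  have h2 := mgf_cnt_le μ I hA (-1)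
  calc _ ≤ Real.exp (-(-1) * (b / 4)) * Real.exp ((Real.exp (-1) - 1) * ∑ i ∈ I, (μ i).real A) := by
        gcongr
    _ ≤ _ := by
      rw [← Real.exp_add, Real.exp_le_exp]
      have h3 : Real.exp (-1) ≤ 1 / 2 := by
        rw [Real.exp_neg, inv_eq_one_div]
        gcongr
        linarith [Real.add_one_le_exp 1]
      nlinarith

/-- Independent points with diffuse laws are almost surely distinct. -/
theorem ae_injective_pi [MeasurableSingletonClass E] [MeasurableEq E]
    (hμ : ∀ i y, μ i {y} = 0) : Measure.pi μ {x | ¬ Function.Injective x} = 0 := by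
  have hpair : ∀ i j, i ≠ j → Measure.pi μ {x | x i = x j} = 0 := by
    intro i j hij
    have hind : iIndepFun (fun (i : Fin N) (x : Fin N → E) => x i) (Measure.pi μ) :=
      iIndepFun_pi (X := fun _ y => y) fun i => aemeasurable_id
    have h1 := (indepFun_iff_map_prod_eq_prod_map_map (measurable_pi_apply i).aemeasurable
      (measurable_pi_apply j).aemeasurable).1 (hind.indepFun hij)
    have hi : Measure.map (fun x : Fin N → E => x i) (Measure.pi μ) = μ i :=
      (measurePreserving_eval μ i).map_eq
    have hj : Measure.map (fun x : Fin N → E => x j) (Measure.pi μ) = μ j :=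
      (measurePreserving_eval μ j).map_eq
    rw [hi, hj] at h1
    have hdiag : MeasurableSet {p : E × E | p.1 = p.2} :=
      measurableSet_eq_fun measurable_fst measurable_snd
    have h2 : Measure.pi μ {x | x i = x j} = (μ i).prod (μ j) {p : E × E | p.1 = p.2} := by
      rw [← h1, Measure.map_apply (by fun_prop) hdiag]
      rfl
    rw [h2, Measure.prod_apply hdiag]
    refine (lintegral_congr fun y => ?_).trans lintegral_zero
    have : Prod.mk y ⁻¹' {p : E × E | p.1 = p.2} = {y} := by
      ext z; simp [eq_comm]
    rw [this, hμ]
  refine measure_mono_null (t := ⋃ p ∈ {p : Fin N × Fin N | p.1 ≠ p.2}, {x | x p.1 = x p.2}) ?_ ?_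
  · intro x hx
    simp only [Function.Injective, Set.mem_ofPred_eq, not_forall] at hx
    obtain ⟨i, j, hij, hne⟩ := hx
    exact Set.mem_biUnion (show (i, j) ∈ {p : Fin N × Fin N | p.1 ≠ p.2} from hne) hij
  · rw [measure_biUnion_null_iff (Set.to_countable _)]
    exact fun p hp => hpair _ _ hp

end Concentration

/-! ### Counting tuples: affinities, degrees and correlations -/

section Counting

open Metric

variable {D n N d m : ℕ} {ε η : ℝ}

theorem kernel_nonneg (s : ℝ) : 0 ≤ kernel s := by unfold kernel; split_ifs <;> norm_num

theorem kernel_le_one (s : ℝ) : kernel s ≤ 1 := by unfold kernel; split_ifs <;> norm_num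

theorem kernel_anti {s t : ℝ} (hs : 0 ≤ s) (hst : s ≤ t) : kernel t ≤ kernel s := by
  unfold kernel
  rw [abs_of_nonneg hs, abs_of_nonneg (hs.trans hst)]
  split_ifs <;> linarith

theorem affinity_nonneg (z : Fin n → Space D) : 0 ≤ affinity d ε η z := by
  unfold affinity
  split_ifs
  · exact mul_nonneg (kernel_nonneg _) (kernel_nonneg _)
  · exact le_rfl

theorem affinity_le_one (z : Fin n → Space D) : affinity d ε η z ≤ 1 := by
  unfold affinity
  split_ifs
  · exact mul_le_one₀ (kernel_le_one _) (kernel_nonneg _) (kernel_le_one _)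
  · exact zero_le_one

theorem width_nonneg (z : Fin n → Space D) : 0 ≤ width d z :=
  Real.iInf_nonneg fun _ => Real.iSup_nonneg fun _ => infDist_nonneg

theorem affinity_mono (hη : 0 < η) {η' : ℝ} (hηη' : η ≤ η') (z : Fin n → Space D) :
    affinity d ε η z ≤ affinity d ε η' z := by
  unfold affinity
  have hw := width_nonneg (d := d) z
  split_ifs
  · refine mul_le_mul_of_nonneg_left (kernel_anti ?_ ?_) (kernel_nonneg _)
    · have : 0 < η' := hη.trans_le hηη'
      positivity
    · gcongr
  · exact le_rfl

theorem of_affinity_ne_zero (hd : d ≤ D) (hε : 0 < ε) (hη : 0 < η) {z : Fin n → Space D}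
    (h : affinity d ε η z ≠ 0) :
    Function.Injective z ∧ (∀ a b, dist (z a) (z b) < ε) ∧
      ∃ L : AffineSubspace ℝ (Space D), (L : Set (Space D)).Nonempty ∧
        Module.finrank ℝ L.direction = d ∧ ∀ j, infDist (z j) (L : Set (Space D)) < η := by
  unfold affinity at h
  split_ifs at h with hinj
  · obtain ⟨h1, h2⟩ := mul_ne_zero_iff.1 h
    unfold kernel at h1 h2
    split_ifs at h1 with h1'
    · split_ifs at h2 with h2'
      · refine ⟨hinj, fun a b => ?_, ?_⟩
        · have := (le_abs_self _).trans_lt h1'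
          rw [div_lt_one hε] at this
          exact (dist_le_diam_of_mem (Set.finite_range z).isBounded ⟨a, rfl⟩ ⟨b, rfl⟩).trans_lt this
        · have hw := (le_abs_self _).trans_lt h2'
          rw [div_lt_one hη] at hw
          -- Over an empty family of planes the infimum would be 0 by convention and yield no plane;
          -- d ≤ D excludes this.
          have : Nonempty {L : AffineSubspace ℝ (Space D) //
              (L : Set (Space D)).Nonempty ∧ Module.finrank ℝ L.direction = d} :=
            ⟨⟨(coordSubspace D d).toAffineSubspace, ⟨0, (coordSubspace D d).zero_mem⟩, by
              rw [Submodule.toAffineSubspace_direction]; exact finrank_coordSubspace hd⟩⟩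
          obtain ⟨⟨L, hL, hLd⟩, hlt⟩ := exists_lt_of_ciInf_lt hw
          refine ⟨L, hL, hLd, fun j => ?_⟩
          exact (le_ciSup (Set.finite_range _).bddAbove j).trans_lt hlt
      · exact absurd rfl h2
    · exact absurd rfl h1
  · exact absurd rfl h

/-- The scales ε/2 and η/2 leave room for the strict inequalities in the kernel. -/
theorem affinity_eq_one (hε : 0 < ε) (hη : 0 < η) {z : Fin n → Space D}
    (hinj : Function.Injective z) (hz : ∀ a b, dist (z a) (z b) ≤ ε / 2) (a : Space D)
    (V : Submodule ℝ (Space D)) (hV : Module.finrank ℝ V = d)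
    (hzV : ∀ j, ∃ v ∈ V, ‖z j - a - v‖ ≤ η / 2) : affinity d ε η z = 1 := by
  have h1 : diam (Set.range z) ≤ ε / 2 := by
    refine diam_le_of_forall_dist_le (by positivity) ?_
    rintro _ ⟨i, rfl⟩ _ ⟨j, rfl⟩
    exact hz i j
  have h2 : width d z ≤ η / 2 := by
    let L : {L : AffineSubspace ℝ (Space D) //
        (L : Set (Space D)).Nonempty ∧ Module.finrank ℝ L.direction = d} :=
      ⟨AffineSubspace.mk' a V, ⟨a, AffineSubspace.self_mem_mk' a V⟩, by
        rw [AffineSubspace.direction_mk']; exact hV⟩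
    refine (ciInf_le ⟨0, ?_⟩ L).trans (Real.iSup_le (fun j => ?_) (by positivity))
    · rintro _ ⟨L', rfl⟩
      exact Real.iSup_nonneg fun _ => infDist_nonneg
    · obtain ⟨v, hv, hjv⟩ := hzV j
      refine (infDist_le_dist_of_mem (y := v + a) ?_).trans ?_
      · exact AffineSubspace.vadd_mem_mk' a hv
      · rw [dist_eq_norm]
        rwa [show z j - (v + a) = z j - a - v by abel]
  have h3 := width_nonneg (d := d) z
  unfold affinity kernel
  rw [if_pos hinj, if_pos, if_pos, one_mul]
  · rw [abs_of_nonneg (by positivity), div_lt_one hη]; linarith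
  · rw [abs_of_nonneg (div_nonneg diam_nonneg hε.le), div_lt_one hε]; linarith

/-- The points of a tuple `(i, j, w)`. -/
def pts (x : Fin N → Space D) (i j : Fin N) (w : Fin (m - 2) → Fin N) :
    Fin (m - 2 + 1 + 1) → Space D :=
  fun a => x ((Fin.cons i (Fin.cons j w) : Fin (m - 2 + 1 + 1) → Fin N) a)

theorem pts_zero (x : Fin N → Space D) (i j : Fin N) (w : Fin (m - 2) → Fin N) :
    pts x i j w 0 = x i := rfl

theorem pts_one (x : Fin N → Space D) (i j : Fin N) (w : Fin (m - 2) → Fin N) :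
    pts x i j w (Fin.succ 0) = x j := rfl

theorem pts_succ (x : Fin N → Space D) (i j : Fin N) (w : Fin (m - 2) → Fin N) (a : Fin (m - 2)) :
    pts x i j w a.succ.succ = x (w a) := rfl

theorem degree_eq (x : Fin N → Space D) (i : Fin N) :
    degree d m ε η x i
      = ∑ p : Fin N × (Fin (m - 2) → Fin N), affinity d ε η (pts x i p.1 p.2) := by
  rw [Fintype.sum_prod_type]; rfl

theorem degree_nonneg (x : Fin N → Space D) (i : Fin N) : 0 ≤ degree d m ε η x i := by
  rw [degree_eq]
  exact Finset.sum_nonneg fun _ _ => affinity_nonneg _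

theorem multiCor_mono (hm : 2 ≤ m) (hη : 0 < η) {η' : ℝ} (hηη' : η ≤ η') (x : Fin N → Space D) :
    multiCor d m x ε η ≤ multiCor d m x ε η' := by
  have hm' : (2 : ℝ) ≤ m := by exact_mod_cast hm
  refine Finset.sum_le_sum fun i _ => Real.rpow_le_rpow (degree_nonneg x i) ?_
    (div_nonneg zero_le_one (by linarith))
  rw [degree_eq, degree_eq]
  exact Finset.sum_le_sum fun p _ => affinity_mono hη hηη' _

/-- The contributing tuples lie in the union of the powers J^(m-1), and each contributes at most 1.
-/
theorem degree_le_of_cover (hm : 2 ≤ m) (x : Fin N → Space D) (i : Fin N)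
    (𝒥 : Finset (Finset (Fin N)))
    (h : ∀ j w, affinity d ε η (pts (m := m) x i j w) ≠ 0 → ∃ J ∈ 𝒥, j ∈ J ∧ ∀ a, w a ∈ J) :
    degree d m ε η x i ≤ ∑ J ∈ 𝒥, (J.card : ℝ) ^ (m - 1) := by
  classical
  let T : Finset (Fin N) → Finset (Fin N × (Fin (m - 2) → Fin N)) := fun J =>
    J ×ˢ Fintype.piFinset fun _ => J
  have hT : ∀ J, ((T J).card : ℝ) = (J.card : ℝ) ^ (m - 1) := fun J => by
    have e1 : m - 1 = m - 2 + 1 := by omega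
    rw [Finset.card_product, Fintype.card_piFinset, e1, pow_succ]
    simp [mul_comm]
  rw [degree_eq]
  calc ∑ p : Fin N × (Fin (m - 2) → Fin N), affinity d ε η (pts x i p.1 p.2)
      ≤ ∑ p : Fin N × (Fin (m - 2) → Fin N), if p ∈ 𝒥.biUnion T then (1 : ℝ) else 0 := by
        refine Finset.sum_le_sum fun p _ => ?_
        split_ifs with hp
        · exact affinity_le_one _
        · refine le_of_eq ?_
          by_contra hne
          obtain ⟨J, hJ, h1, h2⟩ := h p.1 p.2 hne
          exact hp (Finset.mem_biUnion.2 ⟨J, hJ, Finset.mem_product.2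
            ⟨h1, Fintype.mem_piFinset.2 h2⟩⟩)
    _ = ((𝒥.biUnion T).card : ℝ) := by
        rw [Finset.sum_ite_mem, Finset.univ_inter]; simp only [Finset.sum_const, nsmul_one]
    _ ≤ ((∑ J ∈ 𝒥, (T J).card : ℕ) : ℝ) := by exact_mod_cast Finset.card_biUnion_le
    _ = _ := by push_cast; exact Finset.sum_congr rfl fun J _ => hT J

theorem cor_eq (x : Fin N → Space D) (ε : ℝ) :
    cor x ε = ∑ i, (cnt (Finset.univ.erase i) (closedBall (x i) ε) x : ℝ) := by
  classical
  refine Finset.sum_congr rfl fun i _ => ?_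
  rw [cnt, Finset.card_filter, Nat.cast_sum]
  rw [← Finset.sum_filter_add_sum_filter_not Finset.univ (fun j => j ≠ i)]
  rw [Finset.sum_eq_zero (s := Finset.univ.filter fun j => ¬ j ≠ i) (fun j hj => by
    rw [if_neg]; exact fun h => (Finset.mem_filter.1 hj).2 h.1), add_zero]
  have : (Finset.univ.filter fun j => j ≠ i) = Finset.univ.erase i := by ext; simp
  rw [this]
  refine Finset.sum_congr rfl fun j hj => ?_
  have hji := (Finset.mem_erase.1 hj).1
  by_cases hd : dist (x i) (x j) ≤ ε
  · simp [hji, hd, dist_comm]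
  · simp [hd, dist_comm]

theorem rpow_inv_le (hm : 2 ≤ m) {a b : ℝ} (ha : 0 ≤ a) (hb : 0 ≤ b) (h : a ≤ b ^ (m - 1)) :
    a ^ (1 / ((m : ℝ) - 1)) ≤ b := by
  have e1 : (1 : ℝ) / ((m : ℝ) - 1) = (((m - 1 : ℕ) : ℝ))⁻¹ := by
    rw [Nat.cast_sub (by omega), one_div]; simp
  have hm0 : m - 1 ≠ 0 := by omega
  rw [e1]
  calc a ^ (((m - 1 : ℕ) : ℝ))⁻¹ ≤ (b ^ (m - 1)) ^ (((m - 1 : ℕ) : ℝ))⁻¹ :=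
        Real.rpow_le_rpow ha h (by positivity)
    _ = b := Real.pow_rpow_inv_natCast hb hm0

theorem le_rpow_inv (hm : 2 ≤ m) {a b : ℝ} (hb : 0 ≤ b) (h : b ^ (m - 1) ≤ a) :
    b ≤ a ^ (1 / ((m : ℝ) - 1)) := by
  have e1 : (1 : ℝ) / ((m : ℝ) - 1) = (((m - 1 : ℕ) : ℝ))⁻¹ := by
    rw [Nat.cast_sub (by omega), one_div]; simp
  have hm0 : m - 1 ≠ 0 := by omega
  rw [e1]
  calc b = (b ^ (m - 1)) ^ (((m - 1 : ℕ) : ℝ))⁻¹ := (Real.pow_rpow_inv_natCast hb hm0).symm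
    _ ≤ _ := Real.rpow_le_rpow (by positivity) h (by positivity)

/-- All entries of a tuple with nonzero affinity are neighbors of x_i other than x_i itself, so D_i
is at most the (m-1)st power of the number of neighbors. This turns lower bounds for the multiway
correlation into lower bounds for the pairwise one. -/
theorem multiCor_le_cor (hd : d ≤ D) (hm : 2 ≤ m) (hε : 0 < ε) (hη : 0 < η)
    (x : Fin N → Space D) : multiCor d m x ε η ≤ cor x ε := by
  classical
  rw [cor_eq]
  refine Finset.sum_le_sum fun i _ => rpow_inv_le hm (degree_nonneg _ _) (Nat.cast_nonneg _) ?_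
  refine (degree_le_of_cover hm x i
    {(Finset.univ.erase i).filter fun j => x j ∈ closedBall (x i) ε} ?_).trans (by
      rw [Finset.sum_singleton, cnt])
  intro j w hne
  obtain ⟨hinj, hdist, -⟩ := of_affinity_ne_zero hd hε hη hne
  refine ⟨_, Finset.mem_singleton_self _, ?_, fun a => ?_⟩
  · refine Finset.mem_filter.2 ⟨Finset.mem_erase.2 ⟨fun hji => ?_, Finset.mem_univ _⟩, ?_⟩
    · have : pts x i j w (Fin.succ 0) = pts x i j w 0 := by rw [pts_one, pts_zero, hji]
      exact absurd (hinj this) (Fin.succ_ne_zero _)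
    · have := hdist (Fin.succ 0) 0
      rw [pts_one, pts_zero] at this
      exact this.le
  · refine Finset.mem_filter.2 ⟨Finset.mem_erase.2 ⟨fun hji => ?_, Finset.mem_univ _⟩, ?_⟩
    · have : pts x i j w a.succ.succ = pts x i j w 0 := by rw [pts_succ, pts_zero, hji]
      exact absurd (hinj this) (Fin.succ_ne_zero _)
    · have := hdist a.succ.succ 0
      rw [pts_succ, pts_zero] at this
      exact this.le

/-- Every injective tuple from a flat cluster `J` has affinity 1. Their number is a falling
factorial, all of whose factors are at least |J|/2 because |J| ≥ 2m. -/
theorem le_degree_rpow (hm : 2 ≤ m) (hε : 0 < ε) (hη : 0 < η) {x : Fin N → Space D}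
    (hx : Function.Injective x) {i : Fin N} {J : Finset (Fin N)} (hi : i ∈ J) (hJm : 2 * m ≤ J.card)
    (hJ : ∀ j ∈ J, ∀ k ∈ J, dist (x j) (x k) ≤ ε / 2) (a : Space D) (V : Submodule ℝ (Space D))
    (hV : Module.finrank ℝ V = d) (hJV : ∀ j ∈ J, ∃ v ∈ V, ‖x j - a - v‖ ≤ η / 2) :
    (J.card : ℝ) / 2 ≤ degree d m ε η x i ^ (1 / ((m : ℝ) - 1)) := by
  classical
  refine le_rpow_inv hm (by positivity) ?_
  let f : (Fin (m - 2 + 1) ↪ {k // k ∈ J.erase i}) → Fin N × (Fin (m - 2) → Fin N) :=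
    fun e => ((e 0).1, fun a => (e a.succ).1)
  have hf : Function.Injective f := by
    intro e e' hee
    refine DFunLike.ext _ _ fun b => Subtype.ext ?_
    refine Fin.cases ?_ (fun b => ?_) b
    · exact congrArg Prod.fst hee
    · exact congrFun (congrArg Prod.snd hee) b
  have h1 : ∀ p ∈ Finset.univ.image f, affinity d ε η (pts x i p.1 p.2) = 1 := by
    intro p hp
    obtain ⟨e, -, rfl⟩ := Finset.mem_image.1 hp
    have hidx : ∀ b, pts x i (f e).1 (f e).2 b
        = x ((Fin.cons i (fun b => (e b).1) : Fin (m - 2 + 1 + 1) → Fin N) b) := by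
      intro b
      refine Fin.cases ?_ (fun b => ?_) b
      · rfl
      · refine Fin.cases ?_ (fun b => ?_) b
        · rfl
        · rfl
    have hmem : ∀ b, (Fin.cons i (fun b => (e b).1) : Fin (m - 2 + 1 + 1) → Fin N) b ∈ J := by
      intro b
      refine Fin.cases hi (fun b => ?_) b
      exact Finset.mem_of_mem_erase (e b).2
    refine affinity_eq_one hε hη ?_ (fun b c => ?_) a V hV fun b => ?_
    · have : pts x i (f e).1 (f e).2
          = x ∘ (Fin.cons i (fun b => (e b).1) : Fin (m - 2 + 1 + 1) → Fin N) := funext hidx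
      rw [this]
      refine hx.comp (Fin.cons_injective_iff.2 ⟨?_, ?_⟩)
      · rintro ⟨b, hb⟩
        exact Finset.ne_of_mem_erase (e b).2 hb
      · exact Subtype.val_injective.comp e.injective
    · rw [hidx, hidx]
      exact hJ _ (hmem b) _ (hmem c)
    · rw [hidx]
      exact hJV _ (hmem b)
  have h2 : ((J.card - 1).descFactorial (m - 2 + 1) : ℝ) ≤ degree d m ε η x i := by
    rw [degree_eq]
    calc ((J.card - 1).descFactorial (m - 2 + 1) : ℝ) = ((Finset.univ.image f).card : ℝ) := by
          rw [Finset.card_image_of_injective _ hf, Finset.card_univ, Fintype.card_embedding_eq,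
            Fintype.card_fin, Fintype.card_coe, Finset.card_erase_of_mem hi]
      _ = ∑ p ∈ Finset.univ.image f, affinity d ε η (pts x i p.1 p.2) := by
          rw [Finset.sum_congr rfl h1]; simp
      _ ≤ _ := Finset.sum_le_sum_of_subset_of_nonneg (Finset.subset_univ _)
          fun _ _ _ => affinity_nonneg _
  refine le_trans ?_ h2
  have h3 := Nat.pow_sub_le_descFactorial (J.card - 1) (m - 2 + 1)
  have e1 : m - 2 + 1 = m - 1 := by omega
  rw [e1] at h3 ⊢
  refine le_trans ?_ (by exact_mod_cast h3 :
    ((J.card - 1 + 1 - (m - 1) : ℕ) : ℝ) ^ (m - 1) ≤ ((J.card - 1).descFactorial (m - 1) : ℝ))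
  gcongr
  rw [Nat.cast_sub (by omega), Nat.cast_sub (by omega), Nat.cast_add, Nat.cast_sub (by omega)]
  have : (2 * m : ℝ) ≤ J.card := by exact_mod_cast hJm
  push_cast
  linarith

end Counting

/-! ### The sampling model and the lower bound for the multiway correlation -/

section Model

open Metric ProbabilityTheory

/-- The standing assumptions on a sample; `M` is the size of the largest cluster. -/
structure Setup (D d K N : ℕ) (κ v ρ τ δ₀ : ℝ) (S : Fin K → Set (Space D))
    (c : Fin N → Option (Fin K)) (M : ℕ) : Prop where
  one_le_d : 1 ≤ d
  d_lt : d < D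
  one_le_κ : 1 ≤ κ
  v_pos : 0 < v
  ρ_ge : 2 ≤ ρ
  surface : ∀ k, IsSurface d κ (S k)
  τ_pos : 0 < τ
  τ_le : τ * ρ ^ 3 ≤ 1
  count_le : ∀ k, labelCount c (some k) ≤ M
  exists_count : ∃ k, labelCount c (some k) = M
  N_le : (N : ℝ) ≤ K * ρ * M
  outlier : labelCount c none ≠ 0 → ENNReal.ofReal v ≤ volume (outlierRegion S δ₀)

/-- The expected number of neighbors of a point, up to constants. -/
def level (D d M : ℕ) (τ ε η : ℝ) : ℝ := M * (ε ^ d * (min η τ / τ) ^ (D - d))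

/-- The indices of the points with a given label. -/
def idx {K N : ℕ} (c : Fin N → Option (Fin K)) (l : Option (Fin K)) : Finset (Fin N) :=
  Finset.univ.filter fun i => c i = l

theorem mem_idx {K N : ℕ} {c : Fin N → Option (Fin K)} {l : Option (Fin K)} {i : Fin N} :
    i ∈ idx c l ↔ c i = l := by simp [idx]

theorem card_idx {K N : ℕ} (c : Fin N → Option (Fin K)) (l : Option (Fin K)) :
    (idx c l).card = labelCount c l := by
  rw [labelCount, Nat.card_eq_fintype_card, Fintype.card_subtype, idx]

theorem cond_real_apply' {E : Type*} [MeasurableSpace E] (μ : Measure E) {s : Set E}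
    (hs : MeasurableSet s) (A : Set E) : (cond μ s).real A = μ.real (s ∩ A) / μ.real s := by
  rw [measureReal_def, cond_apply hs, ENNReal.toReal_mul, ENNReal.toReal_inv, measureReal_def,
    measureReal_def, inv_mul_eq_div]

theorem measurableSet_region {D K : ℕ} (S : Fin K → Set (Space D)) (τ δ₀ : ℝ)
    (l : Option (Fin K)) : MeasurableSet (region S τ δ₀ l) := by
  cases l with
  | some k => exact (isOpen_tube _ _).measurableSet
  | none =>
    exact (isOpen_cube D).measurableSet.diff
      (MeasurableSet.iUnion fun k => (isOpen_tube _ _).measurableSet)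

theorem region_subset_cube {D K : ℕ} (S : Fin K → Set (Space D)) (τ δ₀ : ℝ)
    (l : Option (Fin K)) : region S τ δ₀ l ⊆ cube D := by
  cases l with
  | some k => exact fun x hx => hx.1
  | none => exact fun x hx => hx.1

/-- The volume of a tube is at least a multiple of `τ ^ (D - d)`. -/
theorem exists_volume_lower (D d : ℕ) (hD : 1 ≤ D) (hd : d ≤ D) {κ : ℝ} (hκ : 1 ≤ κ) :
    ∃ c > 0, ∀ S : Set (Space D), IsSurface d κ S → ∀ τ, 0 < τ → τ ≤ 1 / 4 →
      c * τ ^ (D - d) ≤ volume.real (tube S τ) := by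
  obtain ⟨c, hc, A, -, h⟩ := exists_flat_pieces D d hD hd hκ
  refine ⟨c, hc, fun S hS τ hτ hτ4 => ?_⟩
  obtain ⟨G, 𝒬, -, hG, hvol, -⟩ := h S hS τ 1 1 hτ hτ4 le_rfl one_pos le_rfl (by norm_num)
  exact hvol.trans (measureReal_mono hG (volume_tube_lt_top S τ).ne)

namespace Setup

variable {D d K N : ℕ} {κ v ρ τ δ₀ : ℝ} {S : Fin K → Set (Space D)}
  {c : Fin N → Option (Fin K)} {M : ℕ}

theorem τ_le_quarter (h : Setup D d K N κ v ρ τ δ₀ S c M) : τ ≤ 1 / 4 := by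
  have h1 : (2 : ℝ) ^ 3 ≤ ρ ^ 3 := pow_le_pow_left₀ (by norm_num) h.ρ_ge 3
  have h2 := h.τ_le
  have h3 := h.τ_pos
  nlinarith

theorem volume_region_pos (h : Setup D d K N κ v ρ τ δ₀ S c M) (i : Fin N) :
    0 < volume (region S τ δ₀ (c i)) := by
  rcases hi : c i with _ | k
  · refine lt_of_lt_of_le (ENNReal.ofReal_pos.2 h.v_pos) (h.outlier ?_)
    rw [← card_idx]
    exact (Finset.card_pos.2 ⟨i, mem_idx.2 hi⟩).ne'
  · obtain ⟨c₁, hc₁, hlow⟩ := exists_volume_lower D d (by have := h.d_lt; omega) h.d_lt.le h.one_le_κ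
    have h1 := hlow (S k) (h.surface k) τ h.τ_pos h.τ_le_quarter
    have h2 : 0 < c₁ * τ ^ (D - d) := by have := h.τ_pos; positivity
    exact (ENNReal.toReal_pos_iff.1 (h2.trans_le h1)).1

theorem volume_region_lt_top (i : Fin N) : volume (region S τ δ₀ (c i)) < ⊤ :=
  (measure_mono (region_subset_cube _ _ _ _)).trans_lt (volume_cube_lt_top D)

theorem isProbabilityMeasure (h : Setup D d K N κ v ρ τ δ₀ S c M) (i : Fin N) :
    IsProbabilityMeasure (cond volume (region S τ δ₀ (c i))) :=
  cond_isProbabilityMeasure_of_finite (h.volume_region_pos i).ne' (volume_region_lt_top i).ne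

/-- Almost surely, the points are distinct and lie in their regions. -/
theorem ae_good (h : Setup D d K N κ v ρ τ δ₀ S c M) :
    dataLaw S τ δ₀ c {x | ¬ (Function.Injective x ∧ ∀ i, x i ∈ region S τ δ₀ (c i))} = 0 := by
  have := h.isProbabilityMeasure
  have hD : 0 < D := by have := h.d_lt; omega
  have : Nonempty (Fin D) := ⟨⟨0, hD⟩⟩
  refine measure_mono_null (t := {x | ¬ Function.Injective x} ∪
    ⋃ i, (fun x : Fin N → Space D => x i) ⁻¹' (region S τ δ₀ (c i))ᶜ) ?_ (measure_union_null ?_ ?_)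
  · intro x hx
    simp only [Set.mem_ofPred_eq, not_and_or, not_forall] at hx
    rcases hx with hx | ⟨i, hi⟩
    · exact Or.inl hx
    · exact Or.inr (Set.mem_iUnion.2 ⟨i, hi⟩)
  · refine ae_injective_pi _ fun i y => ?_
    exact cond_absolutelyContinuous (measure_singleton y)
  · rw [measure_iUnion_null_iff]
    intro i
    have hm := (measurableSet_region S τ δ₀ (c i)).compl
    rw [dataLaw, (measurePreserving_eval (fun i => cond volume (region S τ δ₀ (c i))) i).measure_preimage
      hm.nullMeasurableSet, cond_apply (measurableSet_region _ _ _ _), Set.inter_compl_self,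
      measure_empty, mul_zero]

/-- Events may be compared on the set of full measure where the points are distinct and lie in their
regions. No measurability of the correlations or estimators is needed, as measures serve as outer
measures. -/
theorem measure_le_of_good (h : Setup D d K N κ v ρ τ δ₀ S c M) {A B : Set (Fin N → Space D)}
    (hAB : ∀ x ∈ A, Function.Injective x → (∀ i, x i ∈ region S τ δ₀ (c i)) → x ∈ B) :
    dataLaw S τ δ₀ c A ≤ dataLaw S τ δ₀ c B := by
  calc dataLaw S τ δ₀ c A ≤ dataLaw S τ δ₀ c
        (B ∪ {x | ¬ (Function.Injective x ∧ ∀ i, x i ∈ region S τ δ₀ (c i))}) := by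
        refine measure_mono fun x hx => ?_
        by_cases hg : Function.Injective x ∧ ∀ i, x i ∈ region S τ δ₀ (c i)
        · exact Or.inl (hAB x hx hg.1 hg.2)
        · exact Or.inr hg
    _ ≤ _ := (measure_union_le _ _).trans (by rw [h.ae_good, add_zero])

theorem level_le (h : Setup D d K N κ v ρ τ δ₀ S c M) {ε η : ℝ} (hε : 0 < ε) (hε1 : ε ≤ 1)
    (hη : 0 < η) : level D d M τ ε η ≤ M := by
  have hτ := h.τ_pos
  have h1 : min η τ / τ ≤ 1 := (div_le_one hτ).2 (min_le_right _ _)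
  have h2 : 0 ≤ min η τ / τ := by positivity
  have h3 : ε ^ d * (min η τ / τ) ^ (D - d) ≤ 1 :=
    mul_le_one₀ (pow_le_one₀ hε.le hε1) (by positivity) (pow_le_one₀ h2 h1)
  exact mul_le_of_le_one_right (Nat.cast_nonneg M) h3

theorem level_nonneg (h : Setup D d K N κ v ρ τ δ₀ S c M) {ε η : ℝ} (hε : 0 < ε) (hη : 0 < η) :
    0 ≤ level D d M τ ε η := by
  have hτ := h.τ_pos
  unfold level
  positivity

end Setup

/-- With high probability, the multiway correlation is not small. -/
theorem exists_multiCor_lower (D d : ℕ) (hd : d < D) {κ : ℝ} (hκ : 1 ≤ κ) :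
    ∃ a > 0, ∃ A > 0, ∃ r₁ > 0, ∀ (K N : ℕ) (v ρ τ δ₀ : ℝ) (S : Fin K → Set (Space D))
      (c : Fin N → Option (Fin K)) (M m : ℕ), Setup D d K N κ v ρ τ δ₀ S c M → τ ≤ r₁ →
      ∀ ε η : ℝ, ε ≤ 1 → 0 < η → η ≤ ε → ε ^ 2 ≤ η → 2 ≤ m → m ≤ a * level D d M τ ε η →
      dataLaw S τ δ₀ c {x | multiCor d m x ε η < a * (M * level D d M τ ε η)}
        ≤ ENNReal.ofReal (A * ((1 / ε) * (τ / min η τ)) ^ D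
          * Real.exp (-(a * level D d M τ ε η))) := by
  classical
  obtain ⟨c₁, hc₁, A, hA, hflat⟩ := exists_flat_pieces D d (by omega) hd.le hκ
  obtain ⟨C, hC, r₁, hr₁, hup⟩ := exists_volume_upper D d hd.le hκ
  set c₂ := c₁ / C with hc₂
  have hc₂0 : 0 < c₂ := by positivity
  refine ⟨min (c₂ / 16) (c₂ ^ 2 / 32), by positivity, A + 1, by positivity, r₁, hr₁, ?_⟩
  -- The value c₂/16 ensures both 2m ≤ c₂q/4, the guaranteed count in a piece, and the tail
  -- exponent. The value c₂²/32 is the product of c₂/4, for the proportion of points in `G`, and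
  -- c₂/8, for the root of the degree of each.
  set a := min (c₂ / 16) (c₂ ^ 2 / 32) with ha
  have ha1 : a ≤ c₂ / 16 := min_le_left _ _
  have ha2 : a ≤ c₂ ^ 2 / 32 := min_le_right _ _
  intro K N v ρ τ δ₀ S c M m h hτr ε η hε1 hη hηε hεη hm hmq
  have hε : 0 < ε := hη.trans_le hηε
  have hτ := h.τ_pos
  obtain ⟨k, hk⟩ := h.exists_count
  obtain ⟨G, 𝒬, hGm, hGt, hGv, hGQ, hQc, hQ⟩ :=
    hflat (S k) (h.surface k) τ ε η hτ h.τ_le_quarter hε1 hη hηε hεη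
  have htube := (hup (S k) (h.surface k) τ hτ).1 hτr
  set q := level D d M τ ε η with hq
  have hq0 : 0 ≤ q := h.level_nonneg hε hη
  have hqM : q ≤ M := h.level_le hε hε1 hη
  have := h.isProbabilityMeasure
  set μ : Fin N → Measure (Space D) := fun i => cond volume (region S τ δ₀ (c i)) with hμ
  have htpos : 0 < volume.real (tube (S k) τ) := by
    refine lt_of_lt_of_le ?_ (hGv.trans (measureReal_mono hGt (volume_tube_lt_top _ _).ne))
    positivity
  have hsum : ∀ (A : Set (Space D)) (l : ℝ), 0 ≤ l → A ⊆ tube (S k) τ → c₁ * l ≤ volume.real A →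
      c₂ * (M * (l / τ ^ (D - d))) ≤ ∑ i ∈ idx c (some k), (μ i).real A := by
    intro A l hl hAt hAl
    have h1 : ∀ i ∈ idx c (some k), c₂ * (l / τ ^ (D - d)) ≤ (μ i).real A := by
      intro i hi
      show _ ≤ (cond volume (region S τ δ₀ (c i))).real A
      rw [mem_idx.1 hi, cond_real_apply' _ (measurableSet_region _ _ _ _)]
      show _ ≤ volume.real (tube (S k) τ ∩ A) / volume.real (tube (S k) τ)
      rw [Set.inter_eq_right.2 hAt]
      calc c₂ * (l / τ ^ (D - d)) = (c₁ * l) / (C * τ ^ (D - d)) := by rw [hc₂]; field_simp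
        _ ≤ _ := by gcongr
    have h2 := Finset.sum_le_sum h1
    rw [Finset.sum_const, card_idx, hk, nsmul_eq_mul] at h2
    linarith
  have hG1 := measure_cnt_le_le μ (idx c (some k)) hGm (b := c₂ * M) (by
    have := hsum G (τ ^ (D - d)) (by positivity) hGt hGv
    rwa [div_self (by positivity), mul_one] at this) (by positivity)
  have hQ1 : ∀ Q ∈ 𝒬, Measure.pi μ {x | (cnt (idx c (some k)) Q x : ℝ) ≤ c₂ * q / 4}
      ≤ ENNReal.ofReal (Real.exp (-(c₂ * q / 4 / 4))) := by
    intro Q hQ'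
    obtain ⟨hQm, hQt, hQv, -⟩ := hQ Q hQ'
    have hmin : 0 < min η τ := lt_min hη hτ
    have h2 := measure_cnt_le_le μ (idx c (some k)) hQm (b := c₂ * q) (by
      have := hsum Q (ε ^ d * min η τ ^ (D - d)) (by positivity) hQt hQv
      rw [hq, level, div_pow, ← mul_div_assoc]
      exact this) (by positivity)
    refine h2.trans (ENNReal.ofReal_le_ofReal (Real.exp_le_exp.2 ?_))
    have : 0 ≤ c₂ * q := by positivity
    linarith
  have hbad : dataLaw S τ δ₀ c {x | multiCor d m x ε η < a * (M * q)}
      ≤ Measure.pi μ ({x | (cnt (idx c (some k)) G x : ℝ) ≤ c₂ * M / 4}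
        ∪ ⋃ Q ∈ 𝒬, {x | (cnt (idx c (some k)) Q x : ℝ) ≤ c₂ * q / 4}) := by
    refine h.measure_le_of_good fun x hx hinj hreg => ?_
    by_contra hcon
    simp only [Set.mem_union, Set.mem_ofPred_eq, Set.mem_iUnion, not_or, not_exists, not_le] at hcon hx
    obtain ⟨hcG, hcQ⟩ := hcon
    have hdeg : ∀ i ∈ (idx c (some k)).filter (fun i => x i ∈ G),
        c₂ * q / 8 ≤ degree d m ε η x i ^ (1 / ((m : ℝ) - 1)) := by
      intro i hi
      obtain ⟨hik, hiG⟩ := Finset.mem_filter.1 hi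
      obtain ⟨Q, hQ', hiQ⟩ := hGQ _ hiG
      obtain ⟨hQm, hQt, hQv, hQd, p, V, hV, hQV⟩ := hQ Q hQ'
      have h3 := hcQ Q hQ'
      have h4 := le_degree_rpow (d := d) (J := (idx c (some k)).filter fun i => x i ∈ Q) hm hε hη hinj
        (Finset.mem_filter.2 ⟨hik, hiQ⟩) (by
          have h5 : (2 * m : ℝ) ≤ ((idx c (some k)).filter fun i => x i ∈ Q).card := by
            have : a * q ≤ c₂ / 16 * q := by gcongr
            have h6 : (cnt (idx c (some k)) Q x : ℝ)
              = ((idx c (some k)).filter fun i => x i ∈ Q).card := rfl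
            linarith
          exact_mod_cast h5)
        (fun j hj l hl => hQd _ (Finset.mem_filter.1 hj).2 _ (Finset.mem_filter.1 hl).2) p V hV
        (fun j hj => hQV _ (Finset.mem_filter.1 hj).2)
      refine le_trans ?_ h4
      have h6 : (cnt (idx c (some k)) Q x : ℝ)
        = ((idx c (some k)).filter fun i => x i ∈ Q).card := rfl
      linarith
    have h7 : (cnt (idx c (some k)) G x : ℝ) * (c₂ * q / 8) ≤ multiCor d m x ε η := by
      calc (cnt (idx c (some k)) G x : ℝ) * (c₂ * q / 8)
          = ∑ i ∈ (idx c (some k)).filter (fun i => x i ∈ G), c₂ * q / 8 := by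
            rw [Finset.sum_const, nsmul_eq_mul]; rfl
        _ ≤ ∑ i ∈ (idx c (some k)).filter (fun i => x i ∈ G),
            degree d m ε η x i ^ (1 / ((m : ℝ) - 1)) := Finset.sum_le_sum hdeg
        _ ≤ _ := Finset.sum_le_sum_of_subset_of_nonneg (Finset.subset_univ _)
            fun i _ _ => Real.rpow_nonneg (degree_nonneg x i) _
    have h8 : c₂ * M / 4 * (c₂ * q / 8) ≤ (cnt (idx c (some k)) G x : ℝ) * (c₂ * q / 8) := by
      gcongr
    have h9 : a * (M * q) ≤ c₂ ^ 2 / 32 * (M * q) := by gcongr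
    have h10 : c₂ ^ 2 / 32 * (M * q) = c₂ * M / 4 * (c₂ * q / 8) := by ring
    linarith
  have hfac : 1 ≤ ((1 / ε) * (τ / min η τ)) ^ D := by
    refine one_le_pow₀ (one_le_mul_of_one_le_of_one_le ?_ ?_)
    · rwa [one_le_div hε]
    · rw [one_le_div (lt_min hη hτ)]; exact min_le_right _ _
  have hexp : Real.exp (-(c₂ * q / 4 / 4)) ≤ Real.exp (-(a * q)) := by
    rw [Real.exp_le_exp]
    have : a * q ≤ c₂ / 16 * q := by gcongr
    linarith
  have hexp' : Real.exp (-(c₂ * M / 4)) ≤ Real.exp (-(a * q)) := by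
    rw [Real.exp_le_exp]
    have : a * q ≤ c₂ / 16 * M := by gcongr
    have h0 : 0 ≤ c₂ * M := by positivity
    linarith
  refine hbad.trans ((measure_union_le _ _).trans ?_)
  calc _ ≤ ENNReal.ofReal (Real.exp (-(a * q)))
        + ∑ Q ∈ 𝒬, ENNReal.ofReal (Real.exp (-(a * q))) := by
        refine add_le_add (hG1.trans (ENNReal.ofReal_le_ofReal hexp'))
          ((measure_biUnion_finset_le _ _).trans (Finset.sum_le_sum fun Q hQ' =>
            (hQ1 Q hQ').trans (ENNReal.ofReal_le_ofReal hexp)))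
    _ = ENNReal.ofReal ((1 + 𝒬.card) * Real.exp (-(a * q))) := by
        rw [Finset.sum_const, nsmul_eq_mul, add_mul, one_mul,
          ENNReal.ofReal_add (Real.exp_pos _).le (by positivity),
          ENNReal.ofReal_mul (Nat.cast_nonneg _), ENNReal.ofReal_natCast]
    _ ≤ _ := by
        refine ENNReal.ofReal_le_ofReal ?_
        gcongr
        linarith

end Model

/-! ### Upper bounds for the correlations in the presence of outliers -/

section Upper

open Metric ProbabilityTheory

/-- The part of the cube close to one of the surfaces. -/
def near {D K : ℕ} (S : Fin K → Set (Space D)) (r : ℝ) : Set (Space D) := ⋃ k, tube (S k) r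

theorem sum_eq_sum_idx {K N : ℕ} (c : Fin N → Option (Fin K)) (f : Fin N → ℝ) :
    ∑ i, f i = ∑ i ∈ idx c none, f i + ∑ k, ∑ i ∈ idx c (some k), f i := by
  rw [← Finset.sum_fiberwise Finset.univ c f, Fintype.sum_option]; rfl

/-- With high probability, no set of a given family contains many points. -/
theorem exists_cnt_upper (D d K : ℕ) (hd : d < D) (hK : 1 ≤ K) {κ v B : ℝ} (hκ : 1 ≤ κ)
    (hv : 0 < v) (hB : 0 < B) :
    ∃ C ≥ (1 : ℝ), ∃ a > 0, ∃ r₁ > 0, ∀ (N : ℕ) (ρ τ δ₀ : ℝ) (S : Fin K → Set (Space D))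
      (c : Fin N → Option (Fin K)) (M : ℕ), Setup D d K N κ v ρ τ δ₀ S c M →
      ∀ ε η : ℝ, 0 < η → η ≤ ε → τ + 2 * ε ≤ r₁ → ε * ρ ^ 3 ≤ 1 →
      ∀ 𝒜 : Finset (Set (Space D)), (∀ A ∈ 𝒜, MeasurableSet A ∧ volume A ≠ ⊤ ∧
        volume.real A ≤ B * (ε ^ d * η ^ (D - d)) ∧
        ∀ k, volume.real (A ∩ {x | infDist x (S k) < τ}) ≤ B * (ε ^ d * min η τ ^ (D - d))) →
      dataLaw S τ δ₀ c {x | ¬ ((∀ A ∈ 𝒜, (cnt Finset.univ A x : ℝ) ≤ C * level D d M τ ε η ∧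
          (cnt (idx c none) A x : ℝ) ≤ C * level D d M τ ε η / ρ) ∧
          (cnt (idx c none) (near S (τ + 2 * ε)) x : ℝ) ≤ C * M)}
        ≤ ENNReal.ofReal ((2 * 𝒜.card + 1) * Real.exp (-(a * (level D d M τ ε η / ρ)))) := by
  classical
  obtain ⟨c₁, hc₁, hlow⟩ := exists_volume_lower D d (by omega) hd.le hκ
  obtain ⟨C₀, hC₀, r₁, hr₁, hup⟩ := exists_volume_upper D d hd.le hκ
  have hK0 : (1 : ℝ) ≤ K := by exact_mod_cast hK
  set a := B * K / v with ha
  have ha0 : 0 < a := by positivity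
  set b₁ := B * K / c₁ with hb₁
  set b₂ := 3 * K ^ 2 * C₀ / v with hb₂
  have hb₁0 : 0 < b₁ := by positivity
  have hb₂0 : 0 < b₂ := by positivity
  refine ⟨3 * (b₁ + a + b₂) + 1, by linarith, a, ha0, r₁, hr₁, ?_⟩
  set C := 3 * (b₁ + a + b₂) + 1 with hC
  intro N ρ τ δ₀ S c M h ε η hη hηε hr hερ 𝒜 h𝒜
  have hε : 0 < ε := hη.trans_le hηε
  have hτ := h.τ_pos
  have hρ := h.ρ_ge
  have hρ0 : 0 < ρ := by linarith
  have hε1 : ε ≤ 1 := by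
    have h1 : (2 : ℝ) ^ 3 ≤ ρ ^ 3 := pow_le_pow_left₀ (by norm_num) h.ρ_ge 3
    nlinarith
  have := h.isProbabilityMeasure
  set μ : Fin N → Measure (Space D) := fun i => cond volume (region S τ δ₀ (c i)) with hμ
  set φ := ε ^ d * (min η τ / τ) ^ (D - d) with hφ
  have hmin : 0 < min η τ := lt_min hη hτ
  have hφ0 : 0 < φ := by positivity
  set q := level D d M τ ε η with hq
  have hqφ : q = M * φ := rfl
  have hq0 : 0 ≤ q := h.level_nonneg hε hη
  have hqM : q ≤ M := h.level_le hε hε1 hη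
  have hqρ : q / ρ ≤ q := div_le_self hq0 (by linarith)
  -- probabilities for the clusters
  have hpk : ∀ A ∈ 𝒜, ∀ k, ∀ i ∈ idx c (some k), (μ i).real A ≤ B / c₁ * φ := by
    intro A hA k i hi
    show (cond volume (region S τ δ₀ (c i))).real A ≤ _
    rw [mem_idx.1 hi, cond_real_apply' _ (measurableSet_region _ _ _ _)]
    show volume.real (tube (S k) τ ∩ A) / volume.real (tube (S k) τ) ≤ _
    have h1 := hlow (S k) (h.surface k) τ hτ h.τ_le_quarter
    have h2 : volume.real (tube (S k) τ ∩ A) ≤ B * (ε ^ d * min η τ ^ (D - d)) := by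
      refine le_trans (measureReal_mono (show tube (S k) τ ∩ A ⊆ A ∩ {x | infDist x (S k) < τ} from
        fun x hx => ⟨hx.2, hx.1.2⟩) ?_) ((h𝒜 A hA).2.2.2 k)
      exact ((measure_mono Set.inter_subset_left).trans_lt (h𝒜 A hA).2.1.lt_top).ne
    calc _ ≤ B * (ε ^ d * min η τ ^ (D - d)) / (c₁ * τ ^ (D - d)) := by gcongr
      _ = _ := by rw [hφ, div_pow]; field_simp
  have hpo : ∀ (A : Set (Space D)), volume A ≠ ⊤ → ∀ i ∈ idx c none,
      (μ i).real A ≤ volume.real A / v := by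
    intro A hA i hi
    show (cond volume (region S τ δ₀ (c i))).real A ≤ _
    rw [cond_real_apply' _ (measurableSet_region _ _ _ _)]
    have h0 : labelCount c none ≠ 0 := by
      rw [← card_idx]; exact (Finset.card_pos.2 ⟨i, hi⟩).ne'
    have h1 : v ≤ volume.real (region S τ δ₀ (c i)) := by
      rw [measureReal_def, ← ENNReal.ofReal_le_iff_le_toReal (Setup.volume_region_lt_top i).ne,
        mem_idx.1 hi]
      exact h.outlier h0
    have h2 : volume.real (region S τ δ₀ (c i) ∩ A) ≤ volume.real A :=
      measureReal_mono Set.inter_subset_right hA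
    gcongr
  have hNcard : ((idx c none).card : ℝ) ≤ K * ρ * M := by
    refine le_trans ?_ h.N_le
    have := Finset.card_le_univ (idx c none)
    rw [Fintype.card_fin] at this
    exact_mod_cast this
  have hso : ∀ A ∈ 𝒜, ∑ i ∈ idx c none, (μ i).real A ≤ a * (q / ρ) := by
    intro A hA
    -- This beats the excess of outliers. Since η = (min(η, τ)/τ) max(η, τ) and max(η, τ) ≤ ρ^(-3),
    -- a set of volume ε^d η^(D-d) gains a factor ρ^(-2) over q/M, against at most KρM outliers.
    have hpow : ρ ^ 2 * η ^ (D - d) ≤ (min η τ / τ) ^ (D - d) := by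
      have e1 : η = min η τ / τ * max η τ := by
        rw [div_mul_eq_mul_div, min_mul_max]; field_simp
      have e2 : max η τ * ρ ^ 3 ≤ 1 := by
        rcases max_cases η τ with ⟨e, -⟩ | ⟨e, -⟩ <;> rw [e]
        · exact le_trans (by gcongr) hερ
        · exact h.τ_le
      have e3 : 0 < max η τ := lt_max_of_lt_left hη
      have e4 : max η τ ≤ 1 := by
        have h1 : (2 : ℝ) ^ 3 ≤ ρ ^ 3 := pow_le_pow_left₀ (by norm_num) h.ρ_ge 3
        nlinarith
      have e5 : max η τ ^ (D - d) ≤ max η τ := pow_le_of_le_one e3.le e4 (by omega)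
      calc ρ ^ 2 * η ^ (D - d) = (min η τ / τ) ^ (D - d) * (ρ ^ 2 * max η τ ^ (D - d)) := by
            conv_lhs => rw [e1, mul_pow]
            ring
        _ ≤ (min η τ / τ) ^ (D - d) * (ρ ^ 2 * max η τ) := by gcongr
        _ ≤ (min η τ / τ) ^ (D - d) * 1 := by
            gcongr
            have : ρ ^ 2 * max η τ ≤ max η τ * ρ ^ 3 := by
              have : 0 ≤ ρ ^ 2 * max η τ := by positivity
              nlinarith
            linarith
        _ = _ := mul_one _
    calc ∑ i ∈ idx c none, (μ i).real A
        ≤ ∑ _i ∈ idx c none, B * (ε ^ d * η ^ (D - d)) / v := Finset.sum_le_sum fun i hi =>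
          (hpo A (h𝒜 A hA).2.1 i hi).trans (by gcongr; exact (h𝒜 A hA).2.2.1)
      _ = (idx c none).card * (B * (ε ^ d * η ^ (D - d)) / v) := by
          rw [Finset.sum_const, nsmul_eq_mul]
      _ ≤ K * ρ * M * (B * (ε ^ d * η ^ (D - d)) / v) := by gcongr
      _ = a * (M * (ε ^ d * (ρ ^ 2 * η ^ (D - d)))) / ρ := by rw [ha]; field_simp
      _ ≤ a * (M * φ) / ρ := by rw [hφ]; gcongr
      _ = _ := by rw [hqφ]; ring
  have hsa : ∀ A ∈ 𝒜, ∑ i ∈ Finset.univ, (μ i).real A ≤ (b₁ + a) * q := by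
    intro A hA
    rw [sum_eq_sum_idx c]
    have h1 : ∀ k, ∑ i ∈ idx c (some k), (μ i).real A ≤ M * (B / c₁ * φ) := fun k => by
      refine (Finset.sum_le_sum (hpk A hA k)).trans ?_
      rw [Finset.sum_const, nsmul_eq_mul, card_idx]
      gcongr
      exact_mod_cast h.count_le k
    have h2 : ∑ k, ∑ i ∈ idx c (some k), (μ i).real A ≤ b₁ * q := by
      refine (Finset.sum_le_sum fun k _ => h1 k).trans_eq ?_
      rw [Finset.sum_const, nsmul_eq_mul, Finset.card_univ, Fintype.card_fin, hqφ, hb₁]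
      ring
    have h3 := hso A hA
    have h4 : a * (q / ρ) ≤ a * q := by gcongr
    linarith
  have hnm : MeasurableSet (near S (τ + 2 * ε)) :=
    MeasurableSet.iUnion fun k => (isOpen_tube _ _).measurableSet
  have hnt : volume (near S (τ + 2 * ε)) ≠ ⊤ :=
    ((measure_mono (Set.iUnion_subset fun k x hx => hx.1)).trans_lt (volume_cube_lt_top D)).ne
  -- The neighborhoods have codimension at least 1, so their volume is O(τ + ε) = O(ρ^(-3)), more
  -- than enough against KρM outliers.
  have hsn : ∑ i ∈ idx c none, (μ i).real (near S (τ + 2 * ε)) ≤ (b₂ + a) * M := by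
    have e1 : (τ + 2 * ε) * ρ ^ 3 ≤ 3 := by linarith [h.τ_le]
    have e2 : τ + 2 * ε ≤ 1 := by
      have h1 : (2 : ℝ) ^ 3 ≤ ρ ^ 3 := pow_le_pow_left₀ (by norm_num) h.ρ_ge 3
      nlinarith
    have h1 : volume.real (near S (τ + 2 * ε)) ≤ K * (C₀ * (τ + 2 * ε)) := by
      refine (measureReal_iUnion_fintype_le _).trans ?_
      calc ∑ k, volume.real (tube (S k) (τ + 2 * ε)) ≤ ∑ _k : Fin K, C₀ * (τ + 2 * ε) :=
            Finset.sum_le_sum fun k _ => ((hup (S k) (h.surface k) _ (by positivity)).1 hr).trans (by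
              gcongr
              exact pow_le_of_le_one (by positivity) e2 (by omega))
        _ = _ := by rw [Finset.sum_const, nsmul_eq_mul, Finset.card_univ, Fintype.card_fin]
    calc ∑ i ∈ idx c none, (μ i).real (near S (τ + 2 * ε))
        ≤ ∑ _i ∈ idx c none, K * (C₀ * (τ + 2 * ε)) / v := Finset.sum_le_sum fun i hi =>
          (hpo _ hnt i hi).trans (by gcongr)
      _ = (idx c none).card * (K * (C₀ * (τ + 2 * ε)) / v) := by
          rw [Finset.sum_const, nsmul_eq_mul]
      _ ≤ K * ρ * M * (K * (C₀ * (τ + 2 * ε)) / v) := by gcongr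
      _ = K ^ 2 * C₀ / v * M * ((τ + 2 * ε) * ρ) := by ring
      _ ≤ K ^ 2 * C₀ / v * M * 3 := by
          gcongr
          refine le_trans ?_ e1
          have : ρ ≤ ρ ^ 3 := le_self_pow₀ (by linarith) (by norm_num)
          gcongr
      _ = b₂ * M := by rw [hb₂]; ring
      _ ≤ _ := by
        have : 0 ≤ a * M := by positivity
        linarith
  have hM0 : (0 : ℝ) ≤ M := Nat.cast_nonneg M
  have hexp : ∀ b, a * (q / ρ) ≤ b → ENNReal.ofReal (Real.exp (-b))
      ≤ ENNReal.ofReal (Real.exp (-(a * (q / ρ)))) := fun b hb =>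
    ENNReal.ofReal_le_ofReal (Real.exp_le_exp.2 (by linarith))
  have haq : a * (q / ρ) ≤ a * q := by gcongr
  have hsub : {x | ¬ ((∀ A ∈ 𝒜, (cnt Finset.univ A x : ℝ) ≤ C * q ∧
          (cnt (idx c none) A x : ℝ) ≤ C * q / ρ) ∧
          (cnt (idx c none) (near S (τ + 2 * ε)) x : ℝ) ≤ C * M)}
      ⊆ (⋃ A ∈ 𝒜, ({x | 3 * ((b₁ + a) * q) ≤ (cnt Finset.univ A x : ℝ)} ∪
          {x | 3 * (a * (q / ρ)) ≤ (cnt (idx c none) A x : ℝ)})) ∪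
        {x | 3 * ((b₂ + a) * M) ≤ (cnt (idx c none) (near S (τ + 2 * ε)) x : ℝ)} := by
    intro x hx
    by_contra hcon
    simp only [Set.mem_union, Set.mem_iUnion, Set.mem_ofPred_eq, not_or, not_exists, not_le] at hcon
    refine hx ⟨fun A hA => ⟨?_, ?_⟩, ?_⟩
    · have := (hcon.1 A hA).1
      have : 0 ≤ (3 * b₂ + 1) * q := by positivity
      rw [hC]; linarith
    · have := (hcon.1 A hA).2
      have h5 : 0 ≤ (3 * (b₁ + b₂) + 1) * (q / ρ) := by positivity
      have h6 : C * q / ρ = C * (q / ρ) := by ring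
      rw [h6, hC]; linarith
    · have := hcon.2
      have : 0 ≤ (3 * b₁ + 1) * (M : ℝ) := by positivity
      rw [hC]; linarith
  have hE := Real.exp_pos (-(a * (q / ρ)))
  calc dataLaw S τ δ₀ c _ ≤ Measure.pi μ _ := measure_mono hsub
    _ ≤ (∑ A ∈ 𝒜, (ENNReal.ofReal (Real.exp (-(a * (q / ρ))))
          + ENNReal.ofReal (Real.exp (-(a * (q / ρ))))))
        + ENNReal.ofReal (Real.exp (-(a * (q / ρ)))) := by
        refine (measure_union_le _ _).trans (add_le_add ((measure_biUnion_finset_le _ _).trans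
          (Finset.sum_le_sum fun A hA => (measure_union_le _ _).trans (add_le_add ?_ ?_))) ?_)
        · refine (measure_cnt_ge_le μ _ (h𝒜 A hA).1 (hsa A hA)).trans (hexp _ ?_)
          have : 0 ≤ b₁ * q := by positivity
          linarith
        · exact measure_cnt_ge_le μ _ (h𝒜 A hA).1 (hso A hA)
        · refine (measure_cnt_ge_le μ _ hnm hsn).trans (hexp _ ?_)
          have h1 : a * q ≤ a * M := by gcongr
          have : 0 ≤ b₂ * (M : ℝ) := by positivity
          linarith
    _ = _ := by
        rw [Finset.sum_const, nsmul_eq_mul, ← ENNReal.ofReal_add hE.le hE.le,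
          ← ENNReal.ofReal_natCast, ← ENNReal.ofReal_mul (Nat.cast_nonneg _),
          ← ENNReal.ofReal_add (by positivity) hE.le]
        congr 1
        ring

/-- The clusters contribute at most KMX, the at most CM outliers in `Y` at most CMX, and the
remaining outliers, at most KρM in number, at most X/ρ each. -/
theorem Setup.sum_le {D d K N : ℕ} {κ v ρ τ δ₀ : ℝ} {S : Fin K → Set (Space D)}
    {c : Fin N → Option (Fin K)} {M : ℕ} (h : Setup D d K N κ v ρ τ δ₀ S c M)
    {x : Fin N → Space D} {f : Fin N → ℝ} {Y : Set (Space D)} {X C : ℝ} (hX : 0 ≤ X)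
    (hall : ∀ i, f i ≤ X) (hfar : ∀ i, c i = none → x i ∉ Y → f i ≤ X / ρ)
    (hY : (cnt (idx c none) Y x : ℝ) ≤ C * M) : ∑ i, f i ≤ (2 * K + C) * (M * X) := by
  classical
  have hρ0 : 0 < ρ := by linarith [h.ρ_ge]
  have h0 : 0 ≤ X / ρ := by positivity
  have h1 : ∑ i ∈ idx c none, f i ≤ C * M * X + K * M * X := by
    calc ∑ i ∈ idx c none, f i ≤ ∑ i ∈ idx c none, ((if x i ∈ Y then X else 0) + X / ρ) := by
          refine Finset.sum_le_sum fun i hi => ?_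
          split_ifs with hY
          · linarith [hall i]
          · linarith [hfar i (mem_idx.1 hi) hY]
      _ = cnt (idx c none) Y x * X + (idx c none).card * (X / ρ) := by
          rw [Finset.sum_add_distrib, ← Finset.sum_filter, Finset.sum_const, Finset.sum_const,
            nsmul_eq_mul, nsmul_eq_mul, cnt]
      _ ≤ C * M * X + K * ρ * M * (X / ρ) := by
          have hN : ((idx c none).card : ℝ) ≤ K * ρ * M := by
            refine le_trans ?_ h.N_le
            have := Finset.card_le_univ (idx c none)
            rw [Fintype.card_fin] at this
            exact_mod_cast this
          gcongr
      _ = _ := by field_simp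
  have h2 : ∀ k, ∑ i ∈ idx c (some k), f i ≤ M * X := fun k => by
    refine (Finset.sum_le_sum fun i _ => hall i).trans ?_
    rw [Finset.sum_const, nsmul_eq_mul, card_idx]
    gcongr
    exact_mod_cast h.count_le k
  have h3 := Finset.sum_le_sum fun k (_ : k ∈ Finset.univ) => h2 k
  rw [Finset.sum_const, nsmul_eq_mul, Finset.card_univ, Fintype.card_fin] at h3
  rw [sum_eq_sum_idx c]
  linarith

theorem exists_cube_net (D : ℕ) {ε : ℝ} (hε : 0 < ε) (hε1 : ε ≤ 1) : ∃ F : Finset (Space D),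
    (F.card : ℝ) ≤ ((1 + 2 * D) / ε) ^ D ∧ ∀ y ∈ cube D, ∃ z ∈ F, dist y z < ε := by
  obtain ⟨F, -, hFc, -, hF⟩ := exists_net (P := cube D) hε (Nat.cast_nonneg D) (x := 0)
    fun y hy => by rw [dist_zero_right]; exact norm_le_of_mem_cube hy
  refine ⟨F, hFc.trans ?_, hF⟩
  rw [finrank_space]
  gcongr
  rw [add_div]
  gcongr
  rwa [one_le_div hε]

theorem mem_near_of_dist {D K : ℕ} {S : Fin K → Set (Space D)} {τ δ₀ ε : ℝ} {y z : Space D}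
    {k : Fin K} (hε : 0 < ε) (hy : y ∈ cube D) (hz : z ∈ region S τ δ₀ (some k))
    (hyz : dist y z ≤ ε) : y ∈ near S (τ + 2 * ε) := by
  refine Set.mem_iUnion.2 ⟨k, hy, ?_⟩
  have h1 : infDist y (S k) ≤ infDist z (S k) + dist y z := infDist_le_infDist_add_dist
  have h2 : infDist z (S k) < τ := hz.2
  show infDist y (S k) < _
  linarith

/-- With high probability, the pairwise correlation is not large. -/
theorem exists_cor_upper (D d K : ℕ) (hd : d < D) (hK : 1 ≤ K) {κ v : ℝ} (hκ : 1 ≤ κ)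
    (hv : 0 < v) :
    ∃ C ≥ (1 : ℝ), ∃ a > 0, ∃ A > 0, ∃ r₁ > 0, ∀ (N : ℕ) (ρ τ δ₀ : ℝ) (S : Fin K → Set (Space D))
      (c : Fin N → Option (Fin K)) (M : ℕ), Setup D d K N κ v ρ τ δ₀ S c M →
      ∀ ε : ℝ, 0 < ε → τ + 2 * ε ≤ r₁ → ε * ρ ^ 3 ≤ 1 →
      dataLaw S τ δ₀ c {x | C * (M * level D d M τ ε ε) < cor x ε}
        ≤ ENNReal.ofReal (A * (1 / ε) ^ D * Real.exp (-(a * (level D d M τ ε ε / ρ)))) := by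
  classical
  obtain ⟨C₀, hC₀, r₀, hr₀, hup⟩ := exists_volume_upper D d hd.le hκ
  have hω := unitVol_pos D
  set B := 2 ^ D * unitVol D + C₀ * 2 ^ d with hB
  obtain ⟨C, hC, a, ha, r₁, hr₁, hcnt⟩ := exists_cnt_upper D d K hd hK hκ hv
    (B := B) (by positivity)
  have hK0 : (1 : ℝ) ≤ K := by exact_mod_cast hK
  refine ⟨(2 * K + C) * C, by nlinarith, a, ha, 3 * (1 + 2 * D) ^ D, by positivity, min r₀ r₁,
    lt_min hr₀ hr₁, ?_⟩
  intro N ρ τ δ₀ S c M h ε hε hr hερ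
  have hτ := h.τ_pos
  have hρ0 : 0 < ρ := by linarith [h.ρ_ge]
  have hε1 : ε ≤ 1 := by
    have h1 : (2 : ℝ) ^ 3 ≤ ρ ^ 3 := pow_le_pow_left₀ (by norm_num) h.ρ_ge 3
    nlinarith
  obtain ⟨F, hFc, hF⟩ := exists_cube_net D hε hε1
  have hpowD : ε ^ D = ε ^ d * ε ^ (D - d) := by rw [← pow_add, Nat.add_sub_cancel' hd.le]
  have hball : ∀ z : Space D, volume.real (ball z (2 * ε))
      = 2 ^ D * unitVol D * (ε ^ d * ε ^ (D - d)) := fun z => by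
    rw [volume_real_ball z (by positivity), finrank_space, mul_pow, hpowD, unitVol]; ring
  have hb := hcnt N ρ τ δ₀ S c M h ε ε hε le_rfl (hr.trans (min_le_right _ _)) hερ
    (F.image fun z => ball z (2 * ε)) (by
      intro A hA
      obtain ⟨z, -, rfl⟩ := Finset.mem_image.1 hA
      refine ⟨isOpen_ball.measurableSet, measure_ball_lt_top.ne, ?_, fun k => ?_⟩
      · rw [hball]
        gcongr
        rw [hB]
        have : 0 ≤ C₀ * 2 ^ d := by positivity
        linarith
      · rcases le_total τ ε with hτε | hτε
        · rw [min_eq_right hτε]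
          have h1 := (hup (S k) (h.surface k) τ hτ).2 z (2 * ε) (by linarith)
            (by linarith [min_le_left r₀ r₁])
          refine h1.trans ?_
          have e1 : C₀ * ((2 * ε) ^ d * τ ^ (D - d)) = C₀ * 2 ^ d * (ε ^ d * τ ^ (D - d)) := by
            rw [mul_pow]; ring
          rw [e1]
          gcongr
          rw [hB]
          have : 0 ≤ 2 ^ D * unitVol D := by positivity
          linarith
        · rw [min_eq_left hτε]
          refine (measureReal_mono Set.inter_subset_left measure_ball_lt_top.ne).trans ?_
          rw [hball]
          gcongr
          rw [hB]
          have : 0 ≤ C₀ * 2 ^ d := by positivity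
          linarith)
  set q := level D d M τ ε ε with hq
  have hq0 : 0 ≤ q := h.level_nonneg hε hε
  refine (h.measure_le_of_good fun x hx hinj hreg => ?_).trans (hb.trans
    (ENNReal.ofReal_le_ofReal ?_))
  · rintro ⟨hg1, hg2⟩
    rw [Set.mem_ofPred_eq] at hx
    refine absurd hx (not_lt.2 ?_)
    rw [cor_eq]
    have hcov : ∀ i, ∃ A ∈ F.image (fun z => ball z (2 * ε)), closedBall (x i) ε ⊆ A := fun i => by
      obtain ⟨z, hz, hxz⟩ := hF (x i) (region_subset_cube _ _ _ _ (hreg i))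
      refine ⟨_, Finset.mem_image_of_mem _ hz, fun y hy => ?_⟩
      rw [mem_ball]
      rw [mem_closedBall] at hy
      linarith [dist_triangle y (x i) z]
    have := h.sum_le (x := x) (Y := near S (τ + 2 * ε)) (X := C * q)
      (f := fun i => (cnt (Finset.univ.erase i) (closedBall (x i) ε) x : ℝ)) (by positivity)
      (fun i => by
        obtain ⟨A, hA, hxA⟩ := hcov i
        refine le_trans ?_ (hg1 A hA).1
        refine Nat.cast_le.2 (Finset.card_le_card fun j hj => ?_)
        obtain ⟨hj1, hj2⟩ := Finset.mem_filter.1 hj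
        exact Finset.mem_filter.2 ⟨Finset.mem_univ _, hxA hj2⟩)
      (fun i hi hfar => by
        obtain ⟨A, hA, hxA⟩ := hcov i
        refine le_trans ?_ (hg1 A hA).2
        refine Nat.cast_le.2 (Finset.card_le_card fun j hj => ?_)
        obtain ⟨hj1, hj2⟩ := Finset.mem_filter.1 hj
        refine Finset.mem_filter.2 ⟨mem_idx.2 ?_, hxA hj2⟩
        rcases hcj : c j with _ | k
        · rfl
        · have hrj := hreg j
          rw [hcj] at hrj
          exact absurd (mem_near_of_dist hε (region_subset_cube _ _ _ _ (hreg i)) hrj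
            (by rw [dist_comm]; exact hj2)) hfar) hg2
    refine this.trans_eq ?_
    ring
  · gcongr
    calc (2 * ((F.image fun z => ball z (2 * ε)).card : ℝ) + 1) ≤ 2 * ((1 + 2 * D) / ε) ^ D + 1 := by
          gcongr
          exact (Nat.cast_le.2 Finset.card_image_le).trans hFc
      _ ≤ 2 * ((1 + 2 * D) / ε) ^ D + ((1 + 2 * D) / ε) ^ D := by
          gcongr
          refine one_le_pow₀ ?_
          rw [one_le_div hε]
          have : (0 : ℝ) ≤ D := Nat.cast_nonneg D
          linarith
      _ = _ := by rw [div_pow, div_pow, one_pow]; ring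

/-- With high probability, the multiway correlation is not large. -/
theorem exists_multiCor_upper (D d K : ℕ) (hd : d < D) (hK : 1 ≤ K) {κ v : ℝ} (hκ : 1 ≤ κ)
    (hv : 0 < v) :
    ∃ C ≥ (1 : ℝ), ∃ a > 0, ∃ A > 0, ∃ r₁ > 0, ∀ (N : ℕ) (ρ τ δ₀ : ℝ) (S : Fin K → Set (Space D))
      (c : Fin N → Option (Fin K)) (M m : ℕ), Setup D d K N κ v ρ τ δ₀ S c M →
      ∀ ε η : ℝ, 0 < η → η ≤ ε → η ≤ τ → τ + 2 * ε ≤ r₁ → ε * ρ ^ 3 ≤ 1 → 2 ≤ m →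
      A * (1 / ε) ^ D * (1 / η) ^ (D * (d + 1)) ≤ 3 ^ (m - 1) →
      dataLaw S τ δ₀ c {x | C * (M * level D d M τ ε η) < multiCor d m x ε η}
        ≤ ENNReal.ofReal (A * (1 / ε) ^ D * (1 / η) ^ (D * (d + 1))
          * Real.exp (-(a * (level D d M τ ε η / ρ)))) := by
  classical
  have hω := unitVol_pos D
  set B := 9 ^ d * 2 ^ D * unitVol D * (2 ^ d * 2 ^ (D - d)) with hB
  obtain ⟨C, hC, a, ha, r₁, hr₁, hcnt⟩ := exists_cnt_upper D d K hd hK hκ hv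
    (B := B) (by positivity)
  obtain ⟨A₀, hA₀, hnet⟩ := exists_plane_net D d
  have hK0 : (1 : ℝ) ≤ K := by exact_mod_cast hK
  refine ⟨(2 * K + C) * (3 * C), by nlinarith, a, ha,
    3 * ((1 + 2 * D) ^ D * A₀ ^ (D * (d + 1))), by positivity, r₁, hr₁, ?_⟩
  intro N ρ τ δ₀ S c M m h ε η hη hηε hητ hr hερ hm hAm
  have hε : 0 < ε := hη.trans_le hηε
  have hτ := h.τ_pos
  have hρ0 : 0 < ρ := by linarith [h.ρ_ge]
  have hε1 : ε ≤ 1 := by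
    have h1 : (2 : ℝ) ^ 3 ≤ ρ ^ 3 := pow_le_pow_left₀ (by norm_num) h.ρ_ge 3
    nlinarith
  have hη1 : η ≤ 1 := hηε.trans hε1
  obtain ⟨F, hFc, hF⟩ := exists_cube_net D hε hε1
  obtain ⟨𝓛, h𝓛c, h𝓛d, h𝓛⟩ := hnet η hη hη1
  -- Doubled scales absorb the errors of the two nets, so a tuple with nonzero affinity lies
  -- entirely in one slab.
  let slab : Space D × (Space D × Submodule ℝ (Space D)) → Set (Space D) := fun p =>
    ball p.1 (2 * ε) ∩ {y | ∃ w ∈ p.2.2, ‖y - p.2.1 - w‖ < 2 * η}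
  set 𝒜 := (F ×ˢ 𝓛).image slab with h𝒜
  have hvol : ∀ A ∈ 𝒜, MeasurableSet A ∧ volume A ≠ ⊤ ∧
      volume.real A ≤ B * (ε ^ d * η ^ (D - d)) := by
    intro A hA
    obtain ⟨⟨z, p⟩, hzp, rfl⟩ := Finset.mem_image.1 hA
    have hp := (Finset.mem_product.1 hzp).2
    refine ⟨isOpen_ball.measurableSet.inter (IsOpen.measurableSet ?_),
      ((measure_mono Set.inter_subset_left).trans_lt measure_ball_lt_top).ne, ?_⟩
    · have : {y : Space D | ∃ w ∈ p.2, ‖y - p.1 - w‖ < 2 * η}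
          = ⋃ w ∈ p.2, ball (p.1 + w) (2 * η) := by
        ext y
        simp [dist_eq_norm, sub_sub]
      show IsOpen {y : Space D | ∃ w ∈ p.2, ‖y - p.1 - w‖ < 2 * η}
      rw [this]
      exact isOpen_biUnion fun _ _ => isOpen_ball
    · have h1 := volume_slab_le (d := d) (by rw [finrank_space]; exact hd.le) p.2 (h𝓛d p hp) p.1 z
        (r := 2 * ε) (η := 2 * η) (by positivity) (by linarith)
      refine h1.trans_eq ?_
      rw [finrank_space, hB, mul_pow, mul_pow, unitVol]
      ring
  have h𝒜c : (𝒜.card : ℝ) * 3 ≤ 3 * ((1 + 2 * D) ^ D * A₀ ^ (D * (d + 1))) * (1 / ε) ^ D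
      * (1 / η) ^ (D * (d + 1)) := by
    calc (𝒜.card : ℝ) * 3 ≤ (F.card * 𝓛.card : ℕ) * 3 := by
          rw [← Finset.card_product]
          gcongr
          exact Finset.card_image_le
      _ ≤ ((1 + 2 * D) / ε) ^ D * (A₀ / η) ^ (D * (d + 1)) * 3 := by push_cast; gcongr
      _ = _ := by rw [div_pow, div_pow, div_pow, div_pow, one_pow, one_pow]; ring
  have h𝒜1 : 1 ≤ 3 * ((1 + 2 * D) ^ D * A₀ ^ (D * (d + 1))) * (1 / ε) ^ D
      * (1 / η) ^ (D * (d + 1)) / 3 := by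
    have e1 : (1 : ℝ) ≤ (1 + 2 * D) ^ D := one_le_pow₀ (by linarith [(Nat.cast_nonneg D : (0:ℝ) ≤ D)])
    have e2 : (1 : ℝ) ≤ A₀ ^ (D * (d + 1)) := one_le_pow₀ hA₀
    have e3 : (1 : ℝ) ≤ (1 / ε) ^ D := one_le_pow₀ (by rwa [one_le_div hε])
    have e4 : (1 : ℝ) ≤ (1 / η) ^ (D * (d + 1)) := one_le_pow₀ (by rwa [one_le_div hη])
    have e5 := one_le_mul_of_one_le_of_one_le (one_le_mul_of_one_le_of_one_le
      (one_le_mul_of_one_le_of_one_le e1 e2) e3) e4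
    linarith
  have hb := hcnt N ρ τ δ₀ S c M h ε η hη hηε hr hερ 𝒜 (fun A hA =>
    ⟨(hvol A hA).1, (hvol A hA).2.1, (hvol A hA).2.2, fun k => by
      rw [min_eq_left hητ]
      exact (measureReal_mono Set.inter_subset_left (hvol A hA).2.1).trans (hvol A hA).2.2⟩)
  set q := level D d M τ ε η with hq
  have hq0 : 0 ≤ q := h.level_nonneg hε hη
  refine (h.measure_le_of_good fun x hx hinj hreg => ?_).trans (hb.trans
    (ENNReal.ofReal_le_ofReal ?_))
  · rintro ⟨hg1, hg2⟩
    rw [Set.mem_ofPred_eq] at hx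
    refine absurd hx (not_lt.2 ?_)
    have hcube : ∀ i, x i ∈ cube D := fun i => region_subset_cube _ _ _ _ (hreg i)
    have hcov : ∀ i j w, affinity d ε η (pts (m := m) x i j w) ≠ 0 →
        (∃ A ∈ 𝒜, ∀ b, pts x i j w b ∈ A) ∧ ∀ b, dist (x i) (pts x i j w b) ≤ ε := by
      intro i j w hne
      obtain ⟨-, hdist, L, hL, hLd, hLη⟩ := of_affinity_ne_zero hd.le hε hη hne
      refine ⟨?_, fun b => (hdist 0 b).le⟩
      obtain ⟨z, hz, hxz⟩ := hF (x i) (hcube i)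
      obtain ⟨p, hp, hpX⟩ := h𝓛 L hLd hL (Set.range (pts x i j w))
        (by rintro _ ⟨b, rfl⟩; exact hcube _) (Set.range_nonempty _)
        (by rintro _ ⟨b, rfl⟩; exact hLη b)
      refine ⟨slab (z, p), Finset.mem_image_of_mem _ (Finset.mk_mem_product hz hp), fun b =>
        ⟨?_, hpX _ ⟨b, rfl⟩⟩⟩
      have h1 := hdist b 0
      rw [mem_ball]
      have h2 := dist_triangle (pts x i j w b) (x i) z
      rw [pts_zero] at h1
      linarith
    -- The number of slabs is at most 3^(m-1), so it costs a factor 3 after the root. The index set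
    -- `I` is everything in general, and only the outliers when x_i is far from the surfaces.
    have hroot : ∀ (I : Finset (Fin N)) (i : Fin N) (X : ℝ), 0 ≤ X →
        (∀ A ∈ 𝒜, (cnt I A x : ℝ) ≤ X) →
        (∀ j, dist (x i) (x j) ≤ ε → j ∈ I) →
        degree d m ε η x i ^ (1 / ((m : ℝ) - 1)) ≤ 3 * X := by
      intro I i X hX hA hI
      refine rpow_inv_le hm (degree_nonneg _ _) (by positivity) ?_
      refine (degree_le_of_cover hm x i (𝒜.image fun A => I.filter fun j => x j ∈ A) ?_).trans ?_
      · intro j w hne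
        obtain ⟨⟨A, hA', hmem⟩, hdist⟩ := hcov i j w hne
        refine ⟨_, Finset.mem_image_of_mem _ hA', Finset.mem_filter.2 ⟨hI j ?_, ?_⟩,
          fun b => Finset.mem_filter.2 ⟨hI (w b) ?_, ?_⟩⟩
        · exact hdist (Fin.succ 0)
        · exact hmem (Fin.succ 0)
        · exact hdist b.succ.succ
        · exact hmem b.succ.succ
      · calc ∑ J ∈ 𝒜.image fun A => I.filter fun j => x j ∈ A, (J.card : ℝ) ^ (m - 1)
            ≤ ∑ J ∈ 𝒜.image fun A => I.filter fun j => x j ∈ A, X ^ (m - 1) := by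
              refine Finset.sum_le_sum fun J hJ => ?_
              obtain ⟨A, hA', rfl⟩ := Finset.mem_image.1 hJ
              have : ((I.filter fun j => x j ∈ A).card : ℝ) ≤ X := hA A hA'
              gcongr
          _ = (𝒜.image fun A => I.filter fun j => x j ∈ A).card * X ^ (m - 1) := by
              rw [Finset.sum_const, nsmul_eq_mul]
          _ ≤ 3 ^ (m - 1) * X ^ (m - 1) := by
              gcongr
              refine (Nat.cast_le.2 Finset.card_image_le).trans ?_
              have : (0 : ℝ) ≤ 𝒜.card := Nat.cast_nonneg _
              linarith
          _ = _ := by rw [mul_pow]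
    have := h.sum_le (x := x) (Y := near S (τ + 2 * ε)) (X := 3 * (C * q))
      (f := fun i => degree d m ε η x i ^ (1 / ((m : ℝ) - 1))) (by positivity)
      (fun i => hroot Finset.univ i (C * q) (by positivity) (fun A hA => (hg1 A hA).1)
        fun j _ => Finset.mem_univ j)
      (fun i hi hfar => by
        have := hroot (idx c none) i (C * q / ρ) (by positivity) (fun A hA => (hg1 A hA).2)
          fun j hj => by
            refine mem_idx.2 ?_
            rcases hcj : c j with _ | k
            · rfl
            · have hrj := hreg j
              rw [hcj] at hrj
              exact absurd (mem_near_of_dist hε (hcube i) hrj hj) hfar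
        refine this.trans_eq ?_
        ring) hg2
    refine this.trans_eq ?_
    ring
  · gcongr
    linarith

end Upper

/-! ### From bounds on correlations to slopes, and estimates of the level -/

section Endgame

/-- `P` fails with probability at most `n * δ`. -/
def Whp {Ω : Type*} [MeasurableSpace Ω] (μ : Measure Ω) (δ : ENNReal) (n : ℕ) (P : Ω → Prop) : Prop :=
  μ {x | ¬ P x} ≤ n * δ

namespace Whp

variable {Ω : Type*} [MeasurableSpace Ω] {μ : Measure Ω} {δ : ENNReal} {n n' : ℕ} {P Q : Ω → Prop}

theorem mono (h : Whp μ δ n P) (hn : n ≤ n') (hPQ : ∀ x, P x → Q x) : Whp μ δ n' Q :=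
  (measure_mono (show {x | ¬ Q x} ⊆ {x | ¬ P x} from fun x hx hP => hx (hPQ x hP))).trans (h.trans (by gcongr))

theorem and (h : Whp μ δ n P) (h' : Whp μ δ n' Q) : Whp μ δ (n + n') fun x => P x ∧ Q x := by
  have : {x | ¬ (P x ∧ Q x)} ⊆ {x | ¬ P x} ∪ {x | ¬ Q x} := fun x hx => by
    rcases not_and_or.1 hx with hx | hx
    · exact Or.inl hx
    · exact Or.inr hx
  refine (measure_mono this).trans ((measure_union_le _ _).trans ((add_le_add h h').trans_eq ?_))
  push_cast
  ring

end Whp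

theorem firstIndex_lt {T : ℤ → Prop} {a b : ℤ} (h : firstIndex T a b < b) :
    a ≤ firstIndex T a b ∧ T (firstIndex T a b) := by
  classical
  unfold firstIndex at h ⊢
  split_ifs at h ⊢ with hne
  · have := Finset.min'_mem _ hne
    rw [Finset.mem_filter, Finset.mem_Ico] at this
    exact ⟨this.1.1, this.2⟩
  · exact absurd h (lt_irrefl _)

theorem firstIndex_le {T : ℤ → Prop} {a b s : ℤ} (has : a ≤ s) (hsb : s < b) (hT : T s) :
    firstIndex T a b ≤ s := by
  classical
  unfold firstIndex
  have hs : s ∈ (Finset.Ico a b).filter T := Finset.mem_filter.2 ⟨Finset.mem_Ico.2 ⟨has, hsb⟩, hT⟩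
  rw [dif_pos ⟨s, hs⟩]
  exact Finset.min'_le _ _ hs

theorem kink_of_bounds {a C Q ρ X Y : ℝ} {k : ℕ} (ha : 0 < a) (hC : 1 ≤ C) (hQ : 1 ≤ Q) (hρ : 1 < ρ)
    (hX : a * (Q * ρ ^ k) ≤ X) (hY0 : 0 ≤ Y) (hY : Y ≤ C * Q)
    (hCa : 2 * Real.log (C / a) < Real.log ρ) :
    (k : ℝ) - 1 / 2 < (Real.log X - Real.log Y) / Real.log ρ := by
  have hL : 0 < Real.log ρ := Real.log_pos hρ
  have hQ0 : 0 < Q := by linarith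
  have hC0 : 0 < C := by linarith
  have hρ0 : 0 < ρ := by linarith
  -- If `Y` vanishes, its logarithm is 0 by convention, still below log(CQ) because CQ ≥ 1.
  have h1 : Real.log Y ≤ Real.log (C * Q) := by
    rcases hY0.eq_or_lt with h0 | h0
    · rw [← h0, Real.log_zero]
      exact Real.log_nonneg (by nlinarith)
    · exact Real.log_le_log h0 hY
  have h2 : Real.log (a * (Q * ρ ^ k)) ≤ Real.log X := Real.log_le_log (by positivity) hX
  rw [Real.log_mul ha.ne' (by positivity), Real.log_mul hQ0.ne' (by positivity), Real.log_pow] at h2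
  rw [Real.log_mul hC0.ne' hQ0.ne'] at h1
  rw [Real.log_div hC0.ne' ha.ne'] at hCa
  rw [lt_div_iff₀ hL]
  linarith

theorem no_kink_of_bounds {a C Q ρ X Y : ℝ} (ha : 0 < a) (hC : 1 ≤ C) (hQ : 1 ≤ Q) (hρ : 1 < ρ)
    (hX0 : 0 ≤ X) (hX : X ≤ C * Q) (hY : a * Q ≤ Y)
    (hCa : 2 * Real.log (C / a) < Real.log ρ) :
    (Real.log X - Real.log Y) / Real.log ρ < 1 / 2 := by
  have hL : 0 < Real.log ρ := Real.log_pos hρ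
  have hQ0 : 0 < Q := by linarith
  have hC0 : 0 < C := by linarith
  have h1 : Real.log X ≤ Real.log (C * Q) := by
    rcases hX0.eq_or_lt with h0 | h0
    · rw [← h0, Real.log_zero]
      exact Real.log_nonneg (by nlinarith)
    · exact Real.log_le_log h0 hX
  have h2 : Real.log (a * Q) ≤ Real.log Y := Real.log_le_log (by positivity) hY
  rw [Real.log_mul ha.ne' hQ0.ne'] at h2
  rw [Real.log_mul hC0.ne' hQ0.ne'] at h1
  rw [Real.log_div hC0.ne' ha.ne'] at hCa
  rw [div_lt_iff₀ hL]
  linarith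

/-- The estimator of the dimension is exact when the correlation function has no kink. -/
theorem round_slope_eq {a C ρ X Y Q : ℝ} {d D : ℕ} {R : ℤ} (ha : 0 < a) (hC : 1 ≤ C) (hQ : 1 ≤ Q)
    (hρ : 1 < ρ) (hdD : d < D) (hR : 8 * (D : ℤ) + 8 ≤ R)
    (hX : a * (Q * ((ρ ^ (-3 : ℤ)) ^ d)) ≤ X) (hX' : X ≤ C * (Q * ((ρ ^ (-3 : ℤ)) ^ d)))
    (hY : a * (Q * ((ρ ^ (-R)) ^ d) / ρ ^ (D - d)) ≤ Y) (hY' : Y ≤ C * (Q * ((ρ ^ (-R)) ^ d)))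
    (hCa : 2 * Real.log (C / a) < Real.log ρ) :
    round ((Real.log X - Real.log Y) / (R * Real.log ρ)) = (d : ℤ) := by
  have hL : 0 < Real.log ρ := Real.log_pos hρ
  have hQ0 : 0 < Q := by linarith
  have hC0 : 0 < C := by linarith
  have hρ0 : 0 < ρ := by linarith
  have hX0 : 0 < X := lt_of_lt_of_le (by positivity) hX
  have hY0 : 0 < Y := lt_of_lt_of_le (by positivity) hY
  have hR' : 8 * (D : ℝ) + 8 ≤ R := by exact_mod_cast hR
  have hdD' : (d : ℝ) + 1 ≤ D := by exact_mod_cast hdD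
  have h1 := Real.log_le_log (by positivity) hX
  have h2 := Real.log_le_log hX0 hX'
  have h3 := Real.log_le_log (by positivity) hY
  have h4 := Real.log_le_log hY0 hY'
  rw [Real.log_mul ha.ne' (by positivity), Real.log_mul hQ0.ne' (by positivity), Real.log_pow,
    Real.log_zpow] at h1
  rw [Real.log_mul hC0.ne' (by positivity), Real.log_mul hQ0.ne' (by positivity), Real.log_pow,
    Real.log_zpow] at h2
  rw [Real.log_mul ha.ne' (by positivity), Real.log_div (by positivity) (by positivity),
    Real.log_mul hQ0.ne' (by positivity), Real.log_pow, Real.log_zpow, Real.log_pow,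
    Nat.cast_sub hdD.le] at h3
  rw [Real.log_mul hC0.ne' (by positivity), Real.log_mul hQ0.ne' (by positivity), Real.log_pow,
    Real.log_zpow] at h4
  rw [Real.log_div hC0.ne' ha.ne'] at hCa
  push_cast at h1 h2 h3 h4
  set L := Real.log ρ
  have hd0 : (0 : ℝ) ≤ d := Nat.cast_nonneg d
  have hR0 : (0 : ℝ) < R := by linarith
  have hRL : 0 < R * L := by positivity
  have hslack : (8 * (D : ℝ) + 8) * L ≤ R * L := by gcongr
  have hdL : 0 ≤ d * L := by positivity
  have hDL : d * L + L ≤ D * L := by nlinarith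
  -- Up to (1/2) log ρ, the numerator lies between (R - 3)d log ρ and that plus (D - d) log ρ. The
  -- division is by R log ρ and not (R - 3) log ρ, which costs 3d/R; with R ≥ 8D + 8 all errors
  -- together stay below 1/2.
  rw [round_eq, Int.floor_eq_iff]
  constructor
  · rw [← sub_le_iff_le_add, le_div_iff₀ hRL]
    push_cast
    nlinarith
  · rw [← lt_sub_iff_add_lt, div_lt_iff₀ hRL]
    push_cast
    nlinarith

namespace Setup

variable {D d K N : ℕ} {κ v ρ τ δ₀ : ℝ} {S : Fin K → Set (Space D)}
  {c : Fin N → Option (Fin K)} {M : ℕ}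

/-- The hypothesis on ε is what stopping 2D before r_N provides: the surplus ρ^((2D+1)d) pays for N
≤ KρM and for a thickness up to ρ² below τ, one step below the scale where a kink is detected, and
still leaves a factor ρ². -/
theorem le_level (h : Setup D d K N κ v ρ τ δ₀ S c M) {ε η : ℝ} (hη : 0 < η)
    (hε : ρ ^ ((2 * D + 1) * d) * Real.log N ≤ N * ε ^ d) (hε0 : 0 < ε) (hτη : τ ≤ ρ ^ 2 * η)
    (hN : 0 ≤ Real.log N) : ρ ^ 2 * Real.log N ≤ K * level D d M τ ε η := by
  have hτ := h.τ_pos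
  have hρ := h.ρ_ge
  have hρ0 : 0 < ρ := by linarith
  have h1 : 1 / ρ ^ 2 ≤ min η τ / τ := by
    rw [div_le_div_iff₀ (by positivity) hτ, one_mul]
    rcases min_cases η τ with ⟨e, -⟩ | ⟨e, -⟩ <;> rw [e]
    · linarith
    · have : 1 ≤ ρ ^ 2 := one_le_pow₀ (by linarith)
      nlinarith
  have hexp : 3 + 2 * (D - d) ≤ (2 * D + 1) * d := by
    obtain ⟨d', rfl⟩ := Nat.exists_eq_add_of_le' h.one_le_d
    have h1 : (2 * D + 1) * (d' + 1) = 2 * D * d' + (d' + 2 * D + 1) := by ring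
    have h2 := Nat.zero_le (2 * D * d')
    have h3 := h.d_lt
    rw [h1]
    generalize 2 * D * d' = q at h2 ⊢
    omega
  have h2 : ρ ^ 3 * (ρ ^ 2) ^ (D - d) ≤ ρ ^ ((2 * D + 1) * d) := by
    rw [← pow_mul, ← pow_add]
    exact pow_le_pow_right₀ (by linarith) hexp
  have h3 : (1 / ρ ^ 2) ^ (D - d) ≤ (min η τ / τ) ^ (D - d) := by gcongr
  have h4 : ρ * (ρ ^ 2 * Real.log N) ≤ ρ * (K * level D d M τ ε η) := by
    calc ρ * (ρ ^ 2 * Real.log N)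
        = (ρ ^ 3 * (ρ ^ 2) ^ (D - d)) * Real.log N * (1 / ρ ^ 2) ^ (D - d) := by
          rw [div_pow, one_pow]; field_simp
      _ ≤ ρ ^ ((2 * D + 1) * d) * Real.log N * (1 / ρ ^ 2) ^ (D - d) := by gcongr
      _ ≤ N * ε ^ d * (1 / ρ ^ 2) ^ (D - d) := by gcongr
      _ ≤ K * ρ * M * ε ^ d * (min η τ / τ) ^ (D - d) := by
          gcongr
          exact h.N_le
      _ = _ := by rw [level]; ring
  exact le_of_mul_le_mul_left h4 hρ0

theorem level_mul_eq (h : Setup D d K N κ v ρ τ δ₀ S c M) {ε η : ℝ} (hητ : η ≤ τ) :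
    level D d M τ ε η = level D d M τ ε (η / ρ) * ρ ^ (D - d) := by
  have hρ := h.ρ_ge
  have hτ := h.τ_pos
  have hρ0 : 0 < ρ := by linarith
  have h1 : η / ρ ≤ τ := (div_le_iff₀ hρ0).2 (by nlinarith)
  rw [level, level, min_eq_left hητ, min_eq_left h1, div_pow, div_pow, div_pow]
  field_simp

theorem level_le_of_pos (h : Setup D d K N κ v ρ τ δ₀ S c M) {ε η : ℝ} (hε : 0 < ε) (hη : 0 < η) :
    level D d M τ ε η ≤ M * ε ^ d := by
  have hτ := h.τ_pos
  have h1 : min η τ / τ ≤ 1 := (div_le_one hτ).2 (min_le_right _ _)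
  have h2 : 0 ≤ min η τ / τ := by positivity
  rw [level]
  gcongr
  exact mul_le_of_le_one_right (by positivity) (pow_le_one₀ h2 h1)

theorem level_eq_of_le (h : Setup D d K N κ v ρ τ δ₀ S c M) {ε η : ℝ} (hτη : τ ≤ η) :
    level D d M τ ε η = M * ε ^ d := by
  rw [level, min_eq_right hτη, div_self h.τ_pos.ne', one_pow, mul_one]

theorem div_pow_le_level (h : Setup D d K N κ v ρ τ δ₀ S c M) {ε : ℝ} (hε : 0 < ε)
    (hτε : τ ≤ ρ * ε) : M * ε ^ d / ρ ^ (D - d) ≤ level D d M τ ε ε := by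
  have hρ := h.ρ_ge
  have hτ := h.τ_pos
  have hρ0 : 0 < ρ := by linarith
  have h1 : 1 / ρ ≤ min ε τ / τ := by
    rw [div_le_div_iff₀ hρ0 hτ, one_mul]
    rcases min_cases ε τ with ⟨e, -⟩ | ⟨e, -⟩ <;> rw [e]
    · linarith
    · nlinarith
  calc M * ε ^ d / ρ ^ (D - d) = M * (ε ^ d * (1 / ρ) ^ (D - d)) := by
        rw [div_pow, one_pow]; ring
    _ ≤ _ := by rw [level]; gcongr

end Setup

end Endgame

/-! ### Uniform concentration bounds and the deterministic analysis of the second kink -/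

section Regime

/-- The exponent of the polynomial factors in the union bounds. -/
def unionExp (D d : ℕ) : ℕ := 3 * D + 2 * (D * (d + 1))

/-- The numerical conditions that hold for all large sample sizes; `R` is the largest exponent of
the scales at which the estimators look. -/
structure Regime (D d K N : ℕ) (C a A r₁ ρ : ℝ) (m : ℕ) (R : ℤ) : Prop where
  one_le_N : (1 : ℝ) ≤ N
  two_le_ρ : 2 ≤ ρ
  ρ_le : ρ ≤ N
  slack : 2 * Real.log (C / a) < Real.log ρ
  K_le : (K : ℝ) ≤ a * ρ
  K_le' : (K : ℝ) ≤ ρ ^ 2 * Real.log N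
  le_r₁ : 3 ≤ r₁ * ρ ^ 3
  two_le_m : 2 ≤ m
  m_le : (m : ℝ) ≤ ρ * Real.log N
  -- The lower bound on `m` in disguise: the (m-1)st root of the number of slabs is at most 3.
  net : A * (N : ℝ) ^ unionExp D d ≤ 3 ^ (m - 1)
  -- Union bound times Chernoff tail; the 1/8 leaves room for eight events.
  tail : A * (N : ℝ) ^ unionExp D d * Real.exp (-(a / K * (ρ * Real.log N)))
    ≤ (N : ℝ) ^ (-√ρ) / 8
  R_ge : 8 * (D : ℤ) + 8 ≤ R
  R_le : ρ ^ R ≤ N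
  R_pow : ρ ^ ((2 * D + 1) * d) * Real.log N ≤ N * (ρ ^ (-R)) ^ d

namespace Regime

variable {D d K N : ℕ} {C a A r₁ ρ : ℝ} {m : ℕ} {R : ℤ}

theorem ρ_pos (h : Regime D d K N C a A r₁ ρ m R) : 0 < ρ := by linarith [h.two_le_ρ]

theorem log_nonneg (h : Regime D d K N C a A r₁ ρ m R) : 0 ≤ Real.log N :=
  Real.log_nonneg h.one_le_N

theorem zpow_le (h : Regime D d K N C a A r₁ ρ m R) {i j : ℤ} (hij : i ≤ j) : ρ ^ i ≤ ρ ^ j :=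
  zpow_le_zpow_right₀ (by linarith [h.two_le_ρ]) hij

theorem one_div_le (h : Regime D d K N C a A r₁ ρ m R) {ε : ℝ} (hε : ρ ^ (-R) ≤ ε) :
    1 / ε ≤ N := by
  have h0 : 0 < ρ ^ R := zpow_pos h.ρ_pos _
  have h1 : 0 < ρ ^ (-R) := zpow_pos h.ρ_pos _
  refine (one_div_le_one_div_of_le h1 hε).trans ?_
  rw [zpow_neg, one_div, inv_inv]
  exact h.R_le

theorem le_level (h : Regime D d K N C a A r₁ ρ m R) {κ v τ δ₀ : ℝ} {S : Fin K → Set (Space D)}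
    {c : Fin N → Option (Fin K)} {M : ℕ} (hs : Setup D d K N κ v ρ τ δ₀ S c M) {ε η : ℝ}
    (hη : 0 < η) (hε : ρ ^ (-R) ≤ ε) (hτη : τ ≤ ρ ^ 2 * η) :
    ρ ^ 2 * Real.log N ≤ K * level D d M τ ε η := by
  have h1 : 0 < ρ ^ (-R) := zpow_pos h.ρ_pos _
  refine hs.le_level hη (h.R_pow.trans ?_) (h1.trans_le hε) hτη h.log_nonneg
  gcongr

end Regime

/-- All the concentration bounds, with common constants. -/
theorem exists_whp_bounds (D d K : ℕ) (hd : d < D) (hK : 1 ≤ K) {κ v : ℝ} (hκ : 1 ≤ κ)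
    (hv : 0 < v) :
    ∃ C ≥ (1 : ℝ), ∃ a > 0, ∃ A > 0, ∃ r₁ > 0, ∀ (N : ℕ) (ρ τ δ₀ : ℝ) (S : Fin K → Set (Space D))
      (c : Fin N → Option (Fin K)) (M m : ℕ) (R : ℤ), Setup D d K N κ v ρ τ δ₀ S c M →
      Regime D d K N C a A r₁ ρ m R →
      (∀ ε η : ℝ, ε ≤ 1 → 0 < η → η ≤ ε → ε ^ 2 ≤ η → τ ≤ ρ ^ 2 * η → ρ ^ (-R) ≤ ε →
        Whp (dataLaw S τ δ₀ c) (ENNReal.ofReal ((N : ℝ) ^ (-√ρ) / 8)) 1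
          fun x => a * (M * level D d M τ ε η) ≤ multiCor d m x ε η) ∧
      (∀ ε : ℝ, ε * ρ ^ 3 ≤ 1 → τ ≤ ρ ^ 2 * ε → ρ ^ (-R) ≤ ε →
        Whp (dataLaw S τ δ₀ c) (ENNReal.ofReal ((N : ℝ) ^ (-√ρ) / 8)) 1
          fun x => cor x ε ≤ C * (M * level D d M τ ε ε)) ∧
      (∀ ε η : ℝ, 0 < η → η ≤ ε → η ≤ τ → ε * ρ ^ 3 ≤ 1 → τ ≤ ρ ^ 2 * η → ρ ^ (-R) ≤ ε →
        1 / η ≤ N ^ 2 →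
        Whp (dataLaw S τ δ₀ c) (ENNReal.ofReal ((N : ℝ) ^ (-√ρ) / 8)) 1
          fun x => multiCor d m x ε η ≤ C * (M * level D d M τ ε η)) := by
  obtain ⟨a₁, ha₁, A₁, hA₁, r₁, hr₁, h₁⟩ := exists_multiCor_lower D d hd hκ
  obtain ⟨C₂, hC₂, a₂, ha₂, A₂, hA₂, r₂, hr₂, h₂⟩ := exists_cor_upper D d K hd hK hκ hv
  obtain ⟨C₃, hC₃, a₃, ha₃, A₃, hA₃, r₃, hr₃, h₃⟩ := exists_multiCor_upper D d K hd hK hκ hv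
  refine ⟨max C₂ C₃, le_max_of_le_left hC₂, min a₁ (min a₂ a₃), by positivity,
    max A₁ (max A₂ A₃), by positivity, min r₁ (min r₂ r₃), by positivity, ?_⟩
  intro N ρ τ δ₀ S c M m R hs hr
  set a := min a₁ (min a₂ a₃) with ha
  set A := max A₁ (max A₂ A₃) with hA
  set r := min r₁ (min r₂ r₃) with hr'
  have ea₁ : a ≤ a₁ := min_le_left _ _
  have ea₂ : a ≤ a₂ := (min_le_right _ _).trans (min_le_left _ _)
  have ea₃ : a ≤ a₃ := (min_le_right _ _).trans (min_le_right _ _)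
  have eA₁ : A₁ ≤ A := le_max_left _ _
  have eA₂ : A₂ ≤ A := (le_max_left _ _).trans (le_max_right _ _)
  have eA₃ : A₃ ≤ A := (le_max_right _ _).trans (le_max_right _ _)
  have er₁ : r ≤ r₁ := min_le_left _ _
  have er₂ : r ≤ r₂ := (min_le_right _ _).trans (min_le_left _ _)
  have er₃ : r ≤ r₃ := (min_le_right _ _).trans (min_le_right _ _)
  have ha0 : 0 < a := by positivity
  have hA0 : 0 < A := by positivity
  have hρ := hr.two_le_ρ
  have hρ0 := hr.ρ_pos
  have hN := hr.one_le_N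
  have hτ := hs.τ_pos
  have hlog := hr.log_nonneg
  have hK0 : (0 : ℝ) < K := by exact_mod_cast hK
  have hR0 : 0 < ρ ^ (-R) := zpow_pos hρ0 _
  have hr3 : 3 / ρ ^ 3 ≤ r := by rw [div_le_iff₀ (by positivity)]; exact hr.le_r₁
  have hτ3 : τ ≤ 1 / ρ ^ 3 := by rw [le_div_iff₀ (by positivity)]; exact hs.τ_le
  have hscale : ∀ ε : ℝ, ε * ρ ^ 3 ≤ 1 → τ + 2 * ε ≤ r := fun ε hε => by
    have : ε ≤ 1 / ρ ^ 3 := by rw [le_div_iff₀ (by positivity)]; exact hε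
    have e3 : 3 / ρ ^ 3 = 3 * (1 / ρ ^ 3) := by ring
    linarith
  have hτr : τ ≤ r := by
    have := div_nonneg zero_le_one (by positivity : (0 : ℝ) ≤ ρ ^ 3)
    have e3 : 3 / ρ ^ 3 = 3 * (1 / ρ ^ 3) := by ring
    linarith
  have hlev : ∀ ε η : ℝ, 0 < η → ρ ^ (-R) ≤ ε → τ ≤ ρ ^ 2 * η →
      a / K * (ρ * Real.log N) ≤ a * (level D d M τ ε η / ρ) := fun ε η hη hε hτη => by
    have := hr.le_level hs hη hε hτη
    rw [← mul_div_assoc, le_div_iff₀ hρ0, div_mul_eq_mul_div, div_mul_eq_mul_div, div_le_iff₀ hK0]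
    nlinarith
  have htail : ∀ (A' F X : ℝ), 0 ≤ A' → A' ≤ A → 0 ≤ F → F ≤ (N : ℝ) ^ unionExp D d →
      a / K * (ρ * Real.log N) ≤ X →
      ENNReal.ofReal (A' * F * Real.exp (-X)) ≤ ENNReal.ofReal ((N : ℝ) ^ (-√ρ) / 8) :=
    fun A' F X hA' hA'A hF hFN hX => by
      refine ENNReal.ofReal_le_ofReal (le_trans ?_ hr.tail)
      gcongr
  have hinv : ∀ ε, ρ ^ (-R) ≤ ε → 0 < ε ∧ 1 / ε ≤ N := fun ε hε =>
    ⟨hR0.trans_le hε, hr.one_div_le hε⟩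
  have hpow : ∀ i, i ≤ unionExp D d → (N : ℝ) ^ i ≤ (N : ℝ) ^ unionExp D d := fun i hi =>
    pow_le_pow_right₀ hN hi
  refine ⟨fun ε η hε1 hη hηε hεη hτη hε => ?_, fun ε hε3 hτε hε => ?_,
    fun ε η hη hηε hητ hε3 hτη hε hηN => ?_⟩
  · obtain ⟨hε0, hεN⟩ := hinv ε hε
    have hq0 : 0 ≤ level D d M τ ε η := hs.level_nonneg hε0 hη
    have hqρ : level D d M τ ε η / ρ ≤ level D d M τ ε η := div_le_self hq0 (by linarith)
    have hq : ρ ^ 2 * Real.log N ≤ K * level D d M τ ε η := hr.le_level hs hη hε hτη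
    have hm : (m : ℝ) ≤ a₁ * level D d M τ ε η := by
      refine hr.m_le.trans ?_
      have h4 : K * (ρ * Real.log N) ≤ K * (a * level D d M τ ε η) := by
        calc K * (ρ * Real.log N) ≤ a * ρ * (ρ * Real.log N) := by
              gcongr
              exact hr.K_le
          _ = a * (ρ ^ 2 * Real.log N) := by ring
          _ ≤ a * (K * level D d M τ ε η) := by gcongr
          _ = _ := by ring
      refine (le_of_mul_le_mul_left h4 hK0).trans ?_
      gcongr
    have hmin : 0 < min η τ := lt_min hη hτ
    have hτm : τ / min η τ ≤ N ^ 2 := by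
      rw [div_le_iff₀ hmin]
      have h5 : ρ ^ 2 ≤ (N : ℝ) ^ 2 := by gcongr; exact hr.ρ_le
      have h6 : 1 ≤ (N : ℝ) ^ 2 := one_le_pow₀ hN
      rcases min_cases η τ with ⟨e, -⟩ | ⟨e, -⟩ <;> rw [e]
      · exact hτη.trans (by gcongr)
      · nlinarith
    refine (measure_mono (?_ : _ ⊆ {x | multiCor d m x ε η < a₁ * (M * level D d M τ ε η)})).trans
      ((h₁ K N v ρ τ δ₀ S c M m hs (hτr.trans er₁) ε η hε1 hη hηε hεη hr.two_le_m hm).trans ?_)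
    · intro x hx
      have hx' : ¬ a * (M * level D d M τ ε η) ≤ multiCor d m x ε η := hx
      show multiCor d m x ε η < a₁ * (M * level D d M τ ε η)
      exact (not_le.1 hx').trans_le (by gcongr)
    · rw [Nat.cast_one, one_mul]
      refine htail _ _ _ hA₁.le eA₁ (by positivity) ?_ ?_
      · calc (1 / ε * (τ / min η τ)) ^ D ≤ ((N : ℝ) * N ^ 2) ^ D := by gcongr
          _ = (N : ℝ) ^ (3 * D) := by ring
          _ ≤ _ := hpow _ (by unfold unionExp; omega)
      · refine (hlev ε η hη hε hτη).trans ?_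
        gcongr
  · obtain ⟨hε0, hεN⟩ := hinv ε hε
    have hq0 : 0 ≤ level D d M τ ε ε := hs.level_nonneg hε0 hε0
    refine (measure_mono (?_ : _ ⊆ {x | C₂ * (M * level D d M τ ε ε) < cor x ε})).trans
      ((h₂ N ρ τ δ₀ S c M hs ε hε0 ((hscale ε hε3).trans er₂) hε3).trans ?_)
    · intro x hx
      have hx' : ¬ cor x ε ≤ max C₂ C₃ * (M * level D d M τ ε ε) := hx
      show C₂ * (M * level D d M τ ε ε) < cor x ε
      refine lt_of_le_of_lt ?_ (not_le.1 hx')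
      gcongr
      exact le_max_left _ _
    · rw [Nat.cast_one, one_mul]
      refine htail _ _ _ hA₂.le eA₂ (by positivity) ?_ ?_
      · calc (1 / ε) ^ D ≤ (N : ℝ) ^ D := by gcongr
          _ ≤ _ := hpow _ (by unfold unionExp; omega)
      · refine (hlev ε ε hε0 hε hτε).trans ?_
        gcongr
  · obtain ⟨hε0, hεN⟩ := hinv ε hε
    have hq0 : 0 ≤ level D d M τ ε η := hs.level_nonneg hε0 hη
    have hF : (1 / ε) ^ D * (1 / η) ^ (D * (d + 1)) ≤ (N : ℝ) ^ unionExp D d := by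
      calc (1 / ε) ^ D * (1 / η) ^ (D * (d + 1)) ≤ (N : ℝ) ^ D * ((N : ℝ) ^ 2) ^ (D * (d + 1)) := by
            gcongr
        _ = (N : ℝ) ^ (D + 2 * (D * (d + 1))) := by rw [← pow_mul, ← pow_add]
        _ ≤ _ := hpow _ (by unfold unionExp; omega)
    have hnet : A₃ * (1 / ε) ^ D * (1 / η) ^ (D * (d + 1)) ≤ 3 ^ (m - 1) := by
      rw [mul_assoc]
      refine le_trans ?_ hr.net
      gcongr
    refine (measure_mono (?_ : _ ⊆ {x | C₃ * (M * level D d M τ ε η) < multiCor d m x ε η})).trans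
      ((h₃ N ρ τ δ₀ S c M m hs ε η hη hηε hητ ((hscale ε hε3).trans er₃) hε3 hr.two_le_m
        hnet).trans ?_)
    · intro x hx
      have hx' : ¬ multiCor d m x ε η ≤ max C₂ C₃ * (M * level D d M τ ε η) := hx
      show C₃ * (M * level D d M τ ε η) < multiCor d m x ε η
      refine lt_of_le_of_lt ?_ (not_le.1 hx')
      gcongr
      exact le_max_right _ _
    · rw [Nat.cast_one, one_mul, mul_assoc A₃]
      refine htail _ _ _ hA₃.le eA₃ (by positivity) hF ?_
      refine (hlev ε η hη hε hτη).trans ?_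
      gcongr

/-- The refined estimator is correct as soon as the multiway correlation function has no kink above
the jitter level, and has one at the first scale below it. -/
theorem tauHat_spec {D d N m : ℕ} {ρ τ : ℝ} {x : Fin N → Space D} {R : ℤ} (hρ : 2 ≤ ρ)
    (hdD : d < D) (hR : rHat d ρ x = R) (hR0 : 0 < R) (hdim : dHat d ρ x = d)
    (hτ : τ < ρ ^ (-(R - 1)))
    (hno : ∀ s, 0 ≤ s → s < R → τ ≤ ρ ^ (-R - (s + 1)) →
      (logMultiCor d m ρ x s - logMultiCor d m ρ x (s + 1)) / Real.log ρ < 1 / 2)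
    (hkink : ∀ s, IsLeast {s : ℤ | 0 ≤ s ∧ ρ ^ (-R - s) ≤ τ} s → s < R →
      (D : ℝ) - d - 1 / 2
        < (logMultiCor d m ρ x s - logMultiCor d m ρ x (s + 1)) / Real.log ρ) :
    (sHat d m ρ x < rHat d ρ x →
        τ ∈ Set.Icc (tauHat d m ρ x / ρ) (ρ * tauHat d m ρ x)) ∧
      (sHat d m ρ x = rHat d ρ x → τ ≤ tauHat d m ρ x) := by
  have hρ0 : 0 < ρ := by linarith
  have hdD' : (d : ℝ) + 1 ≤ D := by exact_mod_cast hdD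
  have hkey : ∀ s, 0 ≤ s → s < R → ρ ^ (-R - s) ≤ τ → sHat d m ρ x ≤ s := fun s hs hsR hsτ => by
    obtain ⟨s', hs', hle⟩ := Int.exists_least_of_bdd (P := fun s : ℤ => 0 ≤ s ∧ ρ ^ (-R - s) ≤ τ)
      ⟨0, fun z hz => hz.1⟩ ⟨s, hs, hsτ⟩
    have h1 := hkink s' ⟨hs', hle⟩ ((hle s ⟨hs, hsτ⟩).trans_lt hsR)
    refine le_trans ?_ (hle s ⟨hs, hsτ⟩)
    refine firstIndex_le hs'.1 (hR ▸ (hle s ⟨hs, hsτ⟩).trans_lt hsR) ?_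
    rw [hdim]
    exact_mod_cast h1
  refine ⟨fun hlt => ?_, fun heq => ?_⟩
  · obtain ⟨h0, h1⟩ := firstIndex_lt hlt
    change 0 ≤ sHat d m ρ x at h0
    change (logMultiCor d m ρ x (sHat d m ρ x) - logMultiCor d m ρ x (sHat d m ρ x + 1))
      / Real.log ρ > (D : ℝ) - dHat d ρ x - 1 / 2 at h1
    rw [tauHat, if_pos hlt]
    rw [hR] at hlt ⊢
    rw [hdim] at h1
    push_cast at h1
    set s := sHat d m ρ x
    constructor
    · by_contra hc
      have h2 := hno s h0 hlt (by
        refine (not_le.1 hc).le.trans_eq ?_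
        rw [div_eq_mul_inv, ← zpow_sub_one₀ hρ0.ne']
        congr 1
        ring)
      linarith
    · by_contra hc
      have hc' : ρ ^ (-R - (s - 1)) < τ := by
        refine lt_of_eq_of_lt ?_ (not_le.1 hc)
        rw [← zpow_one_add₀ hρ0.ne']
        congr 1
        ring
      -- For ŝ = 0 there is no earlier scale, and the upper bound on τ is the one inherited from the
      -- first estimator; otherwise a kink would already occur at or before ŝ - 1.
      rcases h0.eq_or_lt with h3 | h3
      · rw [← h3] at hc'
        have : -R - (0 - 1) = -(R - 1) := by ring
        rw [this] at hc'
        linarith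
      · have := hkey (s - 1) (by omega) (by omega) hc'.le
        omega
  · rw [tauHat, if_neg heq.not_lt, heq, hR]
    by_contra hc
    have := hkey (R - 1) (by omega) (by omega) (by
      refine le_trans (le_of_eq ?_) (not_le.1 hc).le
      congr 1
      ring)
    omega

end Regime

/-! ### The estimate for a fixed sample size -/

section Estimate

theorem Whp.imp {Ω : Type*} [MeasurableSpace Ω] {μ : Measure Ω} {δ : ENNReal} {n : ℕ} {p : Prop}
    {P : Ω → Prop} (h : p → Whp μ δ n P) : Whp μ δ n fun x => p → P x := by
  by_cases hp : p
  · exact (h hp).mono le_rfl fun x hx _ => hx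
  · have : {x : Ω | ¬ (p → P x)} = ∅ := Set.eq_empty_of_forall_notMem fun x hx => hx fun h' => absurd h' hp
    rw [Whp, this, measure_empty]
    exact zero_le

theorem cor_nonneg {D N : ℕ} (x : Fin N → Space D) (ε : ℝ) : 0 ≤ cor x ε :=
  Finset.sum_nonneg fun i _ => Finset.sum_nonneg fun j _ => by split_ifs <;> norm_num

theorem level_self_eq {D d K N M : ℕ} {κ v ρ τ δ₀ : ℝ} {S : Fin K → Set (Space D)}
    {c : Fin N → Option (Fin K)} (h : Setup D d K N κ v ρ τ δ₀ S c M) {ε : ℝ} (hε : ε ≤ τ) :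
    level D d M τ ε ε = level D d M τ (ε / ρ) (ε / ρ) * ρ ^ D := by
  have hρ0 : 0 < ρ := by linarith [h.ρ_ge]
  have h1 : ρ ^ D = ρ ^ (D - d) * ρ ^ d := by rw [← pow_add, Nat.sub_add_cancel h.d_lt.le]
  rw [h.level_mul_eq hε, h1, level, level, div_pow ε ρ d]
  field_simp

theorem dataLaw_compl_le {D d K N M m : ℕ} {κ v ρ τ δ₀ C a A r₁ : ℝ} {S : Fin K → Set (Space D)}
    {c : Fin N → Option (Fin K)} (hC : 1 ≤ C) (ha : 0 < a) (hK : 1 ≤ K)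
    (hs : Setup D d K N κ v ρ τ δ₀ S c M)
    (hr : Regime D d K N C a A r₁ ρ m (rMax d N ρ - 2 * D))
    (hlow : ∀ ε η : ℝ, ε ≤ 1 → 0 < η → η ≤ ε → ε ^ 2 ≤ η → τ ≤ ρ ^ 2 * η →
      ρ ^ (-(rMax d N ρ - 2 * D)) ≤ ε →
      Whp (dataLaw S τ δ₀ c) (ENNReal.ofReal ((N : ℝ) ^ (-√ρ) / 8)) 1
        fun x => a * (M * level D d M τ ε η) ≤ multiCor d m x ε η)
    (hcor : ∀ ε : ℝ, ε * ρ ^ 3 ≤ 1 → τ ≤ ρ ^ 2 * ε → ρ ^ (-(rMax d N ρ - 2 * D)) ≤ ε →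
      Whp (dataLaw S τ δ₀ c) (ENNReal.ofReal ((N : ℝ) ^ (-√ρ) / 8)) 1
        fun x => cor x ε ≤ C * (M * level D d M τ ε ε))
    (hup : ∀ ε η : ℝ, 0 < η → η ≤ ε → η ≤ τ → ε * ρ ^ 3 ≤ 1 → τ ≤ ρ ^ 2 * η →
      ρ ^ (-(rMax d N ρ - 2 * D)) ≤ ε → 1 / η ≤ N ^ 2 →
      Whp (dataLaw S τ δ₀ c) (ENNReal.ofReal ((N : ℝ) ^ (-√ρ) / 8)) 1
        fun x => multiCor d m x ε η ≤ C * (M * level D d M τ ε η)) :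
    dataLaw S τ δ₀ c
      {x | rHat d ρ x = rMax d N ρ - 2 * D →
        (sHat d m ρ x < rHat d ρ x →
          τ ∈ Set.Icc (tauHat d m ρ x / ρ) (ρ * tauHat d m ρ x)) ∧
        (sHat d m ρ x = rHat d ρ x → τ ≤ tauHat d m ρ x)}ᶜ
      ≤ ENNReal.ofReal ((N : ℝ) ^ (-√ρ)) := by
  set R := rMax d N ρ - 2 * D with hR
  set μ := dataLaw S τ δ₀ c
  set δ := ENNReal.ofReal ((N : ℝ) ^ (-√ρ) / 8) with hδ
  have hρ := hr.two_le_ρ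
  have hρ0 := hr.ρ_pos
  have hρ1 : 1 < ρ := by linarith
  have hRD := hr.R_ge
  have hτ := hs.τ_pos
  have hd := hs.d_lt
  have hK0 : (0 : ℝ) < K := by exact_mod_cast hK
  have hpos : ∀ i : ℤ, 0 < ρ ^ i := fun i => zpow_pos hρ0 i
  have hone : ∀ {i : ℤ}, i ≤ 0 → ρ ^ i ≤ 1 := fun {i} hi => by
    simpa using hr.zpow_le hi
  have hcube : ∀ {i : ℤ}, i ≤ -3 → ρ ^ i * ρ ^ 3 ≤ 1 := fun {i} hi => by
    have h1 : ρ ^ i * ρ ^ 3 = ρ ^ (i + 3) := by rw [zpow_add₀ hρ0.ne']; norm_cast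
    rw [h1]
    exact hone (by omega)
  have hτ3 : τ ≤ ρ ^ (-3 : ℤ) := by
    rw [zpow_neg, ← one_div, le_div_iff₀ (hpos _)]
    exact_mod_cast hs.τ_le
  have hρsq : 1 ≤ ρ ^ 2 := one_le_pow₀ hρ1.le
  have hM : (1 : ℝ) ≤ M := by
    have h1 := hs.N_le
    have h2 := hr.one_le_N
    have : M ≠ 0 := fun h0 => by
      rw [h0, Nat.cast_zero, mul_zero] at h1
      linarith
    exact_mod_cast Nat.one_le_iff_ne_zero.2 this
  have hlev : ∀ {ε η : ℝ}, 0 < η → ρ ^ (-R) ≤ ε → τ ≤ ρ ^ 2 * η →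
      1 ≤ M * level D d M τ ε η := fun {ε η} hη hε hτη => by
    have h1 := hr.K_le'.trans (hr.le_level hs hη hε hτη)
    have h2 : 1 ≤ level D d M τ ε η := by nlinarith
    nlinarith
  suffices h : Whp μ δ 8 fun x => rHat d ρ x = R →
      (sHat d m ρ x < rHat d ρ x →
        τ ∈ Set.Icc (tauHat d m ρ x / ρ) (ρ * tauHat d m ρ x)) ∧
      (sHat d m ρ x = rHat d ρ x → τ ≤ tauHat d m ρ x) by
    refine (show μ _ ≤ _ from h).trans (le_of_eq ?_)
    rw [hδ, show ((8 : ℕ) : ENNReal) = ENNReal.ofReal 8 by norm_num, ← ENNReal.ofReal_mul (by norm_num)]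
    congr 1
    ring
  -- In this case the pairwise correlation has a kink at some r ≤ R - 1 outside the bad events, so
  -- r̂ = R is excluded. In the other case τ is at most one factor ρ above ρ^(-R).
  by_cases hcase : ρ ^ (-(R - 1)) ≤ τ
  · obtain ⟨r, ⟨hr3, hrτ⟩, hmin⟩ := Int.exists_least_of_bdd
      (P := fun r : ℤ => 3 ≤ r ∧ ρ ^ (-r) ≤ τ) ⟨3, fun z hz => hz.1⟩ ⟨R - 1, by omega, hcase⟩
    have hrR : r ≤ R - 1 := hmin _ ⟨by omega, hcase⟩
    have hrτ' : τ ≤ ρ ^ (-(r - 1)) := by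
      rcases hr3.eq_or_lt with h3 | h3
      · rw [← h3]
        exact hτ3.trans (hr.zpow_le (by norm_num))
      · by_contra hc
        have := hmin (r - 1) ⟨by omega, (not_le.1 hc).le⟩
        omega
    have hdiv : ρ ^ (-(r + 1)) = ρ ^ (-r) / ρ := by
      rw [div_eq_mul_inv, ← zpow_sub_one₀ hρ0.ne']
      congr 1
      ring
    have hτr : τ ≤ ρ ^ 2 * ρ ^ (-(r + 1)) := by
      refine hrτ'.trans_eq ?_
      rw [show -(r - 1) = 2 + -(r + 1) by ring, zpow_add₀ hρ0.ne']
      norm_cast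
    have hτr' : τ ≤ ρ ^ 2 * ρ ^ (-r) := hτr.trans (by gcongr; exacts [hρ1.le, by omega])
    have h1 := hlow (ρ ^ (-r)) (ρ ^ (-r)) (hone (by omega)) (hpos _) le_rfl
      (by rw [sq]; exact mul_le_of_le_one_left (hpos _).le (hone (by omega))) hτr'
      (hr.zpow_le (by omega))
    have h2 := hcor (ρ ^ (-(r + 1))) (hcube (by omega)) hτr (hr.zpow_le (by omega))
    refine (h1.and h2).mono (by norm_num) fun x hx hxR => ?_
    exfalso
    obtain ⟨hx1, hx2⟩ := hx
    have hQ := hlev (ε := ρ ^ (-(r + 1))) (hpos (-(r + 1))) (hr.zpow_le (by omega)) hτr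
    rw [level_self_eq hs hrτ, ← hdiv, ← mul_assoc (M : ℝ)] at hx1
    have hk := kink_of_bounds ha hC hQ hρ1
      (hx1.trans (multiCor_le_cor hd.le hr.two_le_m (hpos _) (hpos _) x))
      (cor_nonneg x (ρ ^ (-(r + 1)))) hx2 hr.slack
    have := firstIndex_le (T := fun r => (logCor ρ x r - logCor ρ x (r + 1)) / Real.log ρ
      > (D : ℝ) - 1 / 2) (b := R) hr3 (by omega) hk
    rw [rHat, ← hR] at hxR
    omega
  · have hτR : τ < ρ ^ (-(R - 1)) := not_le.1 hcase
    have hτρ : τ ≤ ρ * ρ ^ (-R) := by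
      refine hτR.le.trans_eq ?_
      rw [← zpow_one_add₀ hρ0.ne']
      congr 1
      ring
    have hεR := hpos (-R)
    have hεR1 : ρ ^ (-R) ≤ 1 := hone (by omega)
    have hεR2 : (ρ ^ (-R)) ^ 2 ≤ ρ ^ (-R) := by
      rw [sq]; exact mul_le_of_le_one_left hεR.le hεR1
    have hε32 : (ρ ^ (-3 : ℤ)) ^ 2 ≤ ρ ^ (-3 : ℤ) := by
      rw [sq]; exact mul_le_of_le_one_left (hpos _).le (hone (by norm_num))
    have hτ2 : τ ≤ ρ ^ 2 * ρ ^ (-R) := hτρ.trans (by gcongr; nlinarith)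
    have h1 := hlow (ρ ^ (-3 : ℤ)) (ρ ^ (-3 : ℤ)) (hone (by norm_num)) (hpos _) le_rfl hε32
      (hτ3.trans (le_mul_of_one_le_left (hpos _).le hρsq)) (hr.zpow_le (by omega))
    have h2 := hcor (ρ ^ (-3 : ℤ)) (hcube le_rfl)
      (hτ3.trans (le_mul_of_one_le_left (hpos _).le hρsq)) (hr.zpow_le (by omega))
    have h3 := hlow (ρ ^ (-R)) (ρ ^ (-R)) hεR1 hεR le_rfl hεR2 hτ2 le_rfl
    have h4 := hcor (ρ ^ (-R)) (hcube (by omega)) hτ2 le_rfl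
    -- The smallest thickness admissible in the lower bound at which the level no longer depends on
    -- η. Monotonicity carries this single bound to every s before the kink, so no union over s is
    -- needed.
    set η₀ := max τ ((ρ ^ (-R)) ^ 2) with hη₀
    have hη₀τ : τ ≤ η₀ := le_max_left _ _
    have hη₀0 : 0 < η₀ := hτ.trans_le hη₀τ
    have h5 : Whp μ δ 1 fun x => τ ≤ ρ ^ (-R) →
        a * (M * level D d M τ (ρ ^ (-R)) η₀) ≤ multiCor d m x (ρ ^ (-R)) η₀ :=
      Whp.imp fun hle => hlow _ _ hεR1 hη₀0 (max_le hle hεR2) (le_max_right _ _)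
        (hη₀τ.trans (le_mul_of_one_le_left hη₀0.le hρsq)) le_rfl
    have hdiv : ∀ s : ℤ, ρ ^ (-R - (s + 1)) = ρ ^ (-R - s) / ρ := fun s => by
      rw [div_eq_mul_inv, ← zpow_sub_one₀ hρ0.ne']
      congr 1
      ring
    have hleast : ∀ s, IsLeast {s : ℤ | 0 ≤ s ∧ ρ ^ (-R - s) ≤ τ} s →
        τ ≤ ρ ^ 2 * ρ ^ (-R - (s + 1)) := fun s hs' => by
      have h0 : τ ≤ ρ ^ (-R - (s - 1)) := by
        rcases hs'.1.1.eq_or_lt with h3 | h3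
        · rw [← h3]
          refine hτR.le.trans_eq ?_
          congr 1
          ring
        · by_contra hc
          have := hs'.2 (⟨by omega, (not_le.1 hc).le⟩ :
            s - 1 ∈ {s : ℤ | 0 ≤ s ∧ ρ ^ (-R - s) ≤ τ})
          omega
      refine h0.trans_eq ?_
      rw [show -R - (s - 1) = 2 + (-R - (s + 1)) by ring, zpow_add₀ hρ0.ne']
      norm_cast
    -- The first scale below τ is determined by τ, ρ and R and not by the sample, so the quantifier
    -- over s costs only two events.
    have h6 : Whp μ δ 2 fun x => ∀ s, IsLeast {s : ℤ | 0 ≤ s ∧ ρ ^ (-R - s) ≤ τ} s → s < R →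
        a * (M * level D d M τ (ρ ^ (-R)) (ρ ^ (-R - s))) ≤ multiCor d m x (ρ ^ (-R)) (ρ ^ (-R - s)) ∧
        multiCor d m x (ρ ^ (-R)) (ρ ^ (-R - (s + 1)))
          ≤ C * (M * level D d M τ (ρ ^ (-R)) (ρ ^ (-R - (s + 1)))) := by
      by_cases hex : ∃ s, IsLeast {s : ℤ | 0 ≤ s ∧ ρ ^ (-R - s) ≤ τ} s ∧ s < R
      · obtain ⟨s, hsl, hsR⟩ := hex
        have hs0 : 0 ≤ s := hsl.1.1
        have hτs := hleast s hsl
        have hsq : ρ ^ (-R - R) = (ρ ^ (-R)) ^ 2 := by rw [sq, ← zpow_add₀ hρ0.ne']; rfl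
        have g1 := hlow (ρ ^ (-R)) (ρ ^ (-R - s)) hεR1 (hpos _) (hr.zpow_le (by omega))
          (by rw [← hsq]; exact hr.zpow_le (by omega))
          (hτs.trans (by gcongr; exacts [hρ1.le, by omega])) le_rfl
        have g2 := hup (ρ ^ (-R)) (ρ ^ (-R - (s + 1))) (hpos _) (hr.zpow_le (by omega))
          ((hr.zpow_le (by omega)).trans hsl.1.2) (hcube (by omega)) hτs le_rfl (by
            have hle : (ρ ^ (-R)) ^ 2 ≤ ρ ^ (-R - (s + 1)) := by
              rw [← hsq]; exact hr.zpow_le (by omega)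
            refine (one_div_le_one_div_of_le (by positivity) hle).trans ?_
            rw [← one_div_pow]
            have := hr.one_div_le le_rfl
            gcongr)
        refine (g1.and g2).mono le_rfl fun x hx s' hs' _ => ?_
        rw [hs'.unique hsl]
        exact hx
      · refine (Whp.imp (p := False) (P := fun _ => True) (by simp)).mono le_rfl fun x _ s hs' hsR => ?_
        exact absurd ⟨s, hs', hsR⟩ hex
    refine ((h1.and h2).and ((h3.and h4).and (h5.and h6))).mono (by norm_num) fun x hx hxR => ?_
    obtain ⟨⟨hx1, hx2⟩, ⟨hx3, hx4⟩, hx5, hx6⟩ := hx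
    have hQ : (1 : ℝ) ≤ M * M := by nlinarith
    have hcle : cor x (ρ ^ (-R)) ≤ C * (M * (M * (ρ ^ (-R)) ^ d)) := by
      refine hx4.trans ?_
      gcongr
      exact hs.level_le_of_pos hεR hεR
    have hdim : dHat d ρ x = d := by
      rw [dHat, if_neg (by omega), hxR, logCor, logCor]
      refine round_slope_eq (D := D) ha hC hQ hρ1 hd hRD ?_ ?_ ?_ ?_ hr.slack
      · refine le_trans (le_of_eq ?_)
          (hx1.trans (multiCor_le_cor hd.le hr.two_le_m (hpos _) (hpos _) x))
        rw [hs.level_eq_of_le hτ3]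
        ring
      · refine hx2.trans (le_of_eq ?_)
        rw [hs.level_eq_of_le hτ3]
        ring
      · refine le_trans ?_
          (hx3.trans (multiCor_le_cor hd.le hr.two_le_m (hpos _) (hpos _) x))
        have := hs.div_pow_le_level hεR hτρ
        calc _ = a * (M * (M * (ρ ^ (-R)) ^ d / ρ ^ (D - d))) := by ring
          _ ≤ _ := by gcongr
      · exact hcle.trans (le_of_eq (by ring))
    have hB : ∀ s, logMultiCor d m ρ x s = Real.log (multiCor d m x (ρ ^ (-R)) (ρ ^ (-R - s))) :=
      fun s => by rw [logMultiCor, hdim, hxR, Int.toNat_natCast]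
    have hnn : ∀ s : ℤ, 0 ≤ multiCor d m x (ρ ^ (-R)) (ρ ^ (-R - s)) := fun s =>
      Finset.sum_nonneg fun i _ => Real.rpow_nonneg (degree_nonneg ..) _
    refine tauHat_spec hρ hd hxR (by omega) hdim hτR (fun s hs0 hsR hτs => ?_) fun s hsl hsR => ?_
    · rw [hB, hB]
      have hτε : τ ≤ ρ ^ (-R) := hτs.trans (hr.zpow_le (by omega))
      have hsq : (ρ ^ (-R)) ^ 2 ≤ ρ ^ (-R - (s + 1)) := by
        rw [sq, ← zpow_add₀ hρ0.ne']; exact hr.zpow_le (by omega)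
      have e1 := hs.level_eq_of_le (ε := ρ ^ (-R)) hη₀τ
      have hQ := hlev hη₀0 le_rfl (hη₀τ.trans (le_mul_of_one_le_left hη₀0.le hρsq))
      rw [e1] at hQ
      -- The upper bound is the pairwise correlation at ε, of order M²ε^d; the lower one comes from
      -- η₀, where the level is also Mε^d.
      refine no_kink_of_bounds ha hC hQ hρ1 (hnn s)
        ((multiCor_le_cor hd.le hr.two_le_m hεR (hpos _) x).trans hcle) ?_ hr.slack
      have := hx5 hτε
      rw [e1] at this
      exact this.trans (multiCor_mono hr.two_le_m hη₀0 (max_le hτs hsq) x)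
    · rw [hB, hB]
      obtain ⟨g1, g2⟩ := hx6 s hsl hsR
      have hQ := hlev (hpos (-R - (s + 1))) le_rfl (hleast s hsl)
      rw [hs.level_mul_eq hsl.1.2, ← hdiv, ← mul_assoc (M : ℝ)] at g1
      have := kink_of_bounds (k := D - d) ha hC hQ hρ1 g1 (hnn (s + 1)) g2 hr.slack
      rwa [Nat.cast_sub hd.le] at this

end Estimate

/-! ### Verification of the numerical conditions for large samples -/

section Asymptotic

/-- With x the quotient in the floor, R = -⌊x⌋ - 2 - 2D lies between -x - 2D - 2 and -x - 2D - 1.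
The first bound gives R ≥ 8D + 8 from -x ≥ 10D + 10, the second gives the two comparisons with N. -/
theorem rMax_bounds {d D N : ℕ} {ρ : ℝ} (hd : 1 ≤ d) (hρ : 1 < ρ) (hN : 1 ≤ Real.log N)
    (hbig : (10 * D + 10 : ℝ) * (d * Real.log ρ) ≤ Real.log N - Real.log (Real.log N)) :
    8 * (D : ℤ) + 8 ≤ rMax d N ρ - 2 * D ∧ ρ ^ (rMax d N ρ - 2 * D) ≤ N ∧
      ρ ^ ((2 * D + 1) * d) * Real.log N ≤ N * (ρ ^ (-(rMax d N ρ - 2 * D))) ^ d := by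
  have hL : 0 < Real.log ρ := Real.log_pos hρ
  have hd0 : (1 : ℝ) ≤ d := by exact_mod_cast hd
  have hρ0 : 0 < ρ := by linarith
  have hN0 : (0 : ℝ) < N := by
    rcases (Nat.cast_nonneg (α := ℝ) N).eq_or_lt with h | h
    · rw [← h, Real.log_zero] at hN
      linarith
    · exact h
  have hℓ0 : 0 ≤ Real.log (Real.log N) := Real.log_nonneg hN
  have hdL : 0 < d * Real.log ρ := by positivity
  set x := (Real.log (Real.log N) - Real.log N) / (d * Real.log ρ) with hx
  have hxm : x * (d * Real.log ρ) = Real.log (Real.log N) - Real.log N :=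
    div_mul_cancel₀ _ hdL.ne'
  have h1 : (10 * D + 10 : ℝ) ≤ -x := by
    rw [hx, ← neg_div, le_div_iff₀ hdL]
    linarith
  have hf1 := Int.floor_le x
  have hf2 := Int.lt_floor_add_one x
  have hRdef : rMax d N ρ = -⌊x⌋ - 2 := rfl
  set R := rMax d N ρ - 2 * D with hR
  have hRc : (R : ℝ) = -⌊x⌋ - 2 - 2 * D := by
    rw [hR, hRdef]
    push_cast
    ring
  have hRge : (8 * D + 8 : ℝ) ≤ R := by rw [hRc]; linarith
  have hD0 : (0 : ℝ) ≤ D := Nat.cast_nonneg D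
  have hRdL : R * (d * Real.log ρ)
      ≤ Real.log N - Real.log (Real.log N) - (2 * D + 1) * (d * Real.log ρ) := by
    have : R * (d * Real.log ρ) ≤ (-x - (2 * D + 1)) * (d * Real.log ρ) := by
      gcongr
      rw [hRc]
      linarith
    linarith
  have hR0 : (0 : ℝ) < R := by linarith
  refine ⟨by exact_mod_cast hRge, ?_, ?_⟩
  · rw [← Real.log_le_log_iff (zpow_pos hρ0 _) hN0, Real.log_zpow]
    have h2 : R * Real.log ρ ≤ R * (d * Real.log ρ) := by
      gcongr
      exact le_mul_of_one_le_left hL.le hd0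
    nlinarith
  · have hRp : 0 < ρ ^ (-R) := zpow_pos hρ0 _
    rw [← Real.log_le_log_iff (by positivity) (by positivity), Real.log_mul (by positivity)
      (by positivity), Real.log_mul hN0.ne' (by positivity), Real.log_pow, Real.log_pow,
      Real.log_zpow]
    push_cast
    linarith

/-- The condition ρ = o(log N) makes log ρ negligible against log N, hence R large. The factor (log
ρ)² in the lower bound on `m` eventually beats the polynomial number of slabs, and in the tail aρ/K
eventually exceeds √ρ by any constant. -/
theorem eventually_regime {D d K : ℕ} (hd : 1 ≤ d) (hK : 1 ≤ K) {C a A r₁ : ℝ} (ha : 0 < a)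
    (hA : 0 < A) (hr₁ : 0 < r₁) {ρ : ℕ → ℝ} (hρ : Tendsto ρ atTop atTop)
    (hρlog : ρ =o[atTop] fun N : ℕ => Real.log N) :
    ∀ᶠ N : ℕ in atTop, ∀ m : ℕ, Real.log N * Real.log (ρ N) ^ 2 ≤ m →
      (m : ℝ) ≤ ρ N * Real.log N →
      Regime D d K N C a A r₁ (ρ N) m (rMax d N (ρ N) - 2 * D) := by
  have hlogN : Tendsto (fun N : ℕ => Real.log N) atTop atTop :=
    Real.tendsto_log_atTop.comp tendsto_natCast_atTop_atTop
  have hlogρ : Tendsto (fun N : ℕ => Real.log (ρ N)) atTop atTop := Real.tendsto_log_atTop.comp hρ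
  have hsqrt : Tendsto (fun N : ℕ => √(ρ N)) atTop atTop := Real.tendsto_sqrt_atTop.comp hρ
  have hK0 : (0 : ℝ) < K := by exact_mod_cast hK
  have hll := (Real.isLittleO_log_id_atTop.comp_tendsto hlogN).def
    (c := 1 / ((10 * D + 10) * d + 1)) (by positivity)
  filter_upwards [hlogN.eventually_ge_atTop 1, hρlog.def one_pos, hll,
    hρ.eventually_ge_atTop (max 2 (max K (max (K / a) (3 / r₁)))),
    hlogρ.eventually_gt_atTop (2 * Real.log (C / a)),
    hlogρ.eventually_ge_atTop (unionExp D d + |Real.log A| + 2),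
    hsqrt.eventually_ge_atTop (K / a * (4 + unionExp D d + |Real.log A|)),
    eventually_ge_atTop 1] with N hN hρN hllN hρge hslack hL hsq hN1 m hm hm'
  obtain ⟨hρ2, hρ'⟩ := max_le_iff.1 hρge
  obtain ⟨hρK, hρ''⟩ := max_le_iff.1 hρ'
  obtain ⟨hρKa, hρr⟩ := max_le_iff.1 hρ''
  have hρ0 : 0 < ρ N := by linarith
  have hN1' : (1 : ℝ) ≤ N := by exact_mod_cast hN1
  have hN0 : (0 : ℝ) < N := by linarith
  have hlogA := abs_nonneg (Real.log A)
  have hlogA' := le_abs_self (Real.log A)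
  have he : (0 : ℝ) ≤ unionExp D d := Nat.cast_nonneg _
  have hρlogN : ρ N ≤ Real.log N := by
    rw [Real.norm_of_nonneg hρ0.le, Real.norm_of_nonneg (by linarith), one_mul] at hρN
    exact hρN
  have hlogN' : Real.log N ≤ N := (Real.log_le_sub_one_of_pos hN0).trans (by linarith)
  have hL1 : 1 ≤ Real.log (ρ N) := by linarith
  have hLl : Real.log (ρ N) ≤ Real.log (Real.log N) := Real.log_le_log hρ0 hρlogN
  have hll0 : 0 ≤ Real.log (Real.log N) := by linarith
  have hbig : (10 * D + 10 : ℝ) * (d * Real.log (ρ N))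
      ≤ Real.log N - Real.log (Real.log N) := by
    have h1 : Real.log (Real.log N) ≤ 1 / ((10 * D + 10) * d + 1) * Real.log N := by
      have : ‖Real.log (Real.log N)‖ ≤ 1 / ((10 * D + 10) * d + 1) * ‖Real.log N‖ := hllN
      rwa [Real.norm_of_nonneg hll0, Real.norm_of_nonneg (by linarith)] at this
    rw [div_mul_eq_mul_div, le_div_iff₀ (by positivity), one_mul] at h1
    have h2 : (10 * D + 10 : ℝ) * (d * Real.log (ρ N))
        ≤ (10 * D + 10 : ℝ) * (d * Real.log (Real.log N)) := by gcongr
    linarith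
  obtain ⟨hR1, hR2, hR3⟩ := rMax_bounds (D := D) hd (by linarith : 1 < ρ N) hN hbig
  have hLsq : unionExp D d + |Real.log A| + 2 ≤ Real.log (ρ N) ^ 2 :=
    hL.trans (le_self_pow₀ hL1 (by norm_num))
  have hmR : Real.log N * (unionExp D d + |Real.log A| + 2) ≤ m := le_trans (by gcongr) hm
  have hm2 : (2 : ℝ) ≤ m := by
    refine le_trans ?_ hm
    exact (by linarith : (2 : ℝ) ≤ Real.log (ρ N) ^ 2).trans
      (le_mul_of_one_le_left (by positivity) hN)
  have hm2' : 2 ≤ m := by exact_mod_cast hm2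
  have hlogn : ∀ t : ℝ, 0 ≤ t → t ≤ Real.log N * t := fun t ht => le_mul_of_one_le_left ht hN
  refine ⟨hN1', hρ2, hρlogN.trans hlogN', hslack, ?_, ?_, ?_, hm2', hm', ?_, ?_, hR1, hR2, hR3⟩
  · rw [div_le_iff₀ ha] at hρKa
    linarith
  · have h1 : 1 ≤ ρ N * Real.log N := one_le_mul_of_one_le_of_one_le (by linarith) hN
    calc (K : ℝ) ≤ ρ N := hρK
      _ ≤ ρ N * (ρ N * Real.log N) := le_mul_of_one_le_right hρ0.le h1
      _ = _ := by ring
  · rw [div_le_iff₀ hr₁] at hρr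
    have : ρ N ≤ ρ N ^ 3 := le_self_pow₀ (by linarith) (by norm_num)
    calc (3 : ℝ) ≤ r₁ * ρ N := by linarith
      _ ≤ _ := by gcongr
  · rw [← Real.log_le_log_iff (by positivity) (by positivity), Real.log_mul hA.ne' (by positivity),
      Real.log_pow, Real.log_pow, Nat.cast_sub (by omega : 1 ≤ m), Nat.cast_one]
    have h3 : 1 ≤ Real.log 3 := by
      rw [Real.le_log_iff_exp_le (by norm_num)]
      exact Real.exp_one_lt_d9.le.trans (by norm_num)
    have h4 := hlogn _ hlogA
    have h5 : (m - 1 : ℝ) ≤ (m - 1) * Real.log 3 := le_mul_of_one_le_right (by linarith) h3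
    linarith
  · have hs1 : 1 ≤ √(ρ N) := Real.one_le_sqrt.2 (by linarith)
    have hs2 : √(ρ N) * √(ρ N) = ρ N := Real.mul_self_sqrt hρ0.le
    rw [← Real.log_le_log_iff (by positivity) (by positivity), Real.log_mul (by positivity)
      (by positivity), Real.log_mul hA.ne' (by positivity), Real.log_pow, Real.log_exp,
      Real.log_div (by positivity) (by norm_num), Real.log_rpow hN0]
    have h8 : Real.log 8 ≤ 3 := by
      rw [show (8 : ℝ) = 2 ^ 3 by norm_num, Real.log_pow]
      have := Real.log_two_lt_d9
      norm_num
      linarith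
    have h1 : √(ρ N) * (4 + unionExp D d + |Real.log A|) ≤ a / K * ρ N := by
      have : 4 + unionExp D d + |Real.log A| ≤ a / K * √(ρ N) := by
        rw [div_mul_eq_mul_div, div_le_iff₀ ha] at hsq
        rw [div_mul_eq_mul_div, le_div_iff₀ hK0]
        linarith
      calc _ ≤ √(ρ N) * (a / K * √(ρ N)) := by gcongr
        _ = a / K * (√(ρ N) * √(ρ N)) := by ring
        _ = _ := by rw [hs2]
    have h2 : √(ρ N) + (3 + unionExp D d + |Real.log A|) ≤ a / K * ρ N := by
      have := le_mul_of_one_le_left (by positivity : 0 ≤ 3 + unionExp D d + |Real.log A|) hs1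
      linarith
    have h3 := hlogn _ (by positivity : 0 ≤ 3 + |Real.log A|)
    have h4 : Real.log N * (√(ρ N) + (3 + unionExp D d + |Real.log A|))
        ≤ Real.log N * (a / K * ρ N) := by gcongr
    linarith

/-- With M the largest cluster size, N/ρ ≤ N - N₀ ≤ KM. -/
theorem exists_setup {D d K N : ℕ} {κ v ρ τ δ₀ : ℝ} {S : Fin K → Set (Space D)}
    {c : Fin N → Option (Fin K)} (hd : 1 ≤ d) (hdD : d < D) (hK : 1 ≤ K) (hκ : 1 ≤ κ) (hv : 0 < v)
    (hρ : 2 ≤ ρ) (hS : ∀ k, IsSurface d κ (S k)) (hτ : 0 < τ) (hτρ : τ ≤ ρ ^ (-3 : ℤ))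
    (hN : (N : ℝ) - labelCount c none ≥ N / ρ)
    (hout : labelCount c none ≠ 0 → ENNReal.ofReal v ≤ volume (outlierRegion S δ₀)) :
    ∃ M, Setup D d K N κ v ρ τ δ₀ S c M := by
  have hρ0 : 0 < ρ := by linarith
  have : Nonempty (Fin K) := ⟨⟨0, hK⟩⟩
  obtain ⟨k₀, -, hk₀⟩ := Finset.exists_max_image Finset.univ (fun k => labelCount c (some k))
    Finset.univ_nonempty
  refine ⟨labelCount c (some k₀), hd, hdD, hκ, hv, hρ, hS, hτ, ?_, fun k => hk₀ k (Finset.mem_univ k),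
    ⟨k₀, rfl⟩, ?_, hout⟩
  · rw [zpow_neg, ← one_div, le_div_iff₀ (by positivity)] at hτρ
    exact_mod_cast hτρ
  · have h1 := sum_eq_sum_idx c fun _ => (1 : ℝ)
    simp only [Finset.sum_const, nsmul_eq_mul, mul_one, card_idx, Finset.card_univ,
      Fintype.card_fin] at h1
    have h2 : ∑ k, (labelCount c (some k) : ℝ) ≤ K * labelCount c (some k₀) := by
      refine (Finset.sum_le_card_nsmul _ _ (labelCount c (some k₀) : ℝ) fun k hk => ?_).trans_eq ?_
      · exact_mod_cast hk₀ k hk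
      · rw [Finset.card_univ, Fintype.card_fin, nsmul_eq_mul]
    have h3 : (N : ℝ) / ρ ≤ K * labelCount c (some k₀) := by linarith
    rw [div_le_iff₀ hρ0] at h3
    linarith

end Asymptotic

end HOSC

end

theorem mainTheorem7 (D d K : ℕ) (hd : 1 ≤ d) (hdD : d < D) (hK : 1 ≤ K)
    (κ ζ v : ℝ) (hκ : 1 ≤ κ) (hv : 0 < v)
    (ρ : ℕ → ℝ) (hρ : Tendsto ρ atTop atTop)
    (hρlog : ρ =o[atTop] fun N : ℕ => Real.log N) :
    ∀ᶠ N : ℕ in atTop,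
      ∀ (S : Fin K → Set (HOSC.Space D)) (τ δ₀ : ℝ) (c : Fin N → Option (Fin K)) (m : ℕ),
        (∀ k, HOSC.IsSurface d κ (S k)) →
        0 < τ → τ ≤ ρ N ^ (-3 : ℤ) →
        (∀ k l, k ≠ l →
          (HOSC.labelCount c (some k) : ℝ) ≤ ζ * HOSC.labelCount c (some l)) →
        (N : ℝ) - HOSC.labelCount c none ≥ N / ρ N →
        (HOSC.labelCount c none ≠ 0 →
          0 < δ₀ ∧ ENNReal.ofReal v ≤ volume (HOSC.outlierRegion S δ₀)) →
        Real.log N * Real.log (ρ N) ^ 2 ≤ m → (m : ℝ) ≤ ρ N * Real.log N →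
        HOSC.dataLaw S τ δ₀ c
          {x | HOSC.rHat d (ρ N) x = HOSC.rMax d N (ρ N) - 2 * D →
            (HOSC.sHat d m (ρ N) x < HOSC.rHat d (ρ N) x →
              τ ∈ Set.Icc (HOSC.tauHat d m (ρ N) x / ρ N) (ρ N * HOSC.tauHat d m (ρ N) x)) ∧
            (HOSC.sHat d m (ρ N) x = HOSC.rHat d (ρ N) x →
              τ ≤ HOSC.tauHat d m (ρ N) x)}ᶜ
          ≤ ENNReal.ofReal ((N : ℝ) ^ (-√(ρ N))) := by
  obtain ⟨C, hC, a, ha, A, hA, r₁, hr₁, hb⟩ := HOSC.exists_whp_bounds D d K hdD hK hκ hv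
  filter_upwards [HOSC.eventually_regime (D := D) (C := C) hd hK ha hA hr₁ hρ hρlog]
    with N hreg S τ δ₀ c m hS hτ hτρ _ hN hout hm hm'
  have hr := hreg m hm hm'
  obtain ⟨M, hs⟩ := HOSC.exists_setup hd hdD hK hκ hv hr.two_le_ρ hS hτ hτρ hN
    fun h => (hout h).2
  obtain ⟨hlow, hcor, hup⟩ := hb N (ρ N) τ δ₀ S c M m _ hs hr
  exact HOSC.dataLaw_compl_le hC ha hK hs hr hlow hcor hup
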